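/- Let $\Lambda$ be the Leech lattice in $\mathbb{Q}^{24}$ with positive definite quadratic form $q(v)=\frac1{16}\sum_i v_i^2$ and bilinear form $b(v,w)=q(v+w)-q(v)-q(w)=\frac18\sum_i v_iw_i$: it consists of the $v\in\mathbb{Z}^{24}$ for which there is $m\in\mathbb{Z}$ with $v_i\equiv m \bmod 2$ for all $i$, $((v_i-m)/2 \bmod 2)_i$ in the extended binary Golay code, and $\sum_i v_i\equiv 4m\bmod 8$. An automorphism of $\Lambda$ is an isometry of $(\mathbb{Q}^{24},q)$ mapping $\Lambda$ onto itself, and for an automorphism $\sigma$ let $\Lambda^\sigma=\{x\in\Lambda\mid\sigma x=x\}$. For a lattice $M$ with the form $q$, let $$\vartheta^{(n)}_M(Z)=\sum_{x\in M^n}\exp(2\pi i\,\mathrm{tr}(q(x)Z)),\qquad q(x)=\tfrac12\,(b(x_i,x_j))_{i,j},$$ be its theta series of degree $n$, for $Z$ in the Siegel upper half space of degree $n$ (the symmetric complex $n\times n$ matrices with positive definite imaginary part). For $f(Z)=\sum_T a(f,T)\exp(2\pi i\,\mathrm{tr}(TZ))$, with $T$ running over the half-integral symmetric $n\times n$ matrices,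 put $\Theta f(Z)=\sum_T\det(T)\,a(f,T)\exp(2\pi i\,\mathrm{tr}(TZ))$. For a prime $p$, $f\equiv g\bmod p$ means that all Fourier coefficients of $f$ and $g$ lie in $\mathbb{Z}_{(p)}$ and all $a(f,T)-a(g,T)$ lie in $p\mathbb{Z}_{(p)}$. Then: 1. $\Lambda$ has automorphisms of orders $2,3,4,5,7,11,13,23$. 2. For all $n$ the series $\vartheta^{(n)}_\Lambda$ converges absolutely on the Siegel upper half space, and its Fourier coefficient at $T$ is the number of $x\in\Lambda^n$ with $q(x)=T$. 3. For every automorphism $\sigma$ of order $23$ the lattice $\Lambda^\sigma$ has rank $2$ and, in a suitable $\mathbb{Z}$-basis, Gram matrix (with respect to $b$) $\begin{pmatrix}4&1\\1&6\end{pmatrix}$. One has $\Theta\vartheta^{(2)}_\Lambda\equiv0\bmod 23$, and $\vartheta^{(2)}_\Lambda$ has a Fourier coefficient at some $T$ with $\det T\neq0$ that is not divisible by $23$. 4. For every automorphism $\sigma$ of order $11$ the lattice $\Lambda^\sigma$ has rank $4$ and, in a suitable $\mathbb{Z}$-basis, Gram matrix $$\begin{pmatrix}4&2&1&0\\2&4&1&1\\1&1&4&2\\0&1&2&4\end{pmatrix}$$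 of determinant $121$. The theta series $\vartheta^{(4)}_{\Lambda^\sigma}$ converges absolutely, its Fourier coefficients are the corresponding representation numbers, and $\vartheta^{(4)}_\Lambda\equiv\vartheta^{(4)}_{\Lambda^\sigma}\bmod 11$. Moreover $\Theta\vartheta^{(4)}_\Lambda\equiv0\bmod 11$, and $4$ is the largest degree $n$ for which $\vartheta^{(n)}_\Lambda$ has a Fourier coefficient at some $T$ with $\det T\ne0$ that is not divisible by $11$. -/

import Mathlib

/-! ### Lattices in rational quadratic spaces

A lattice on a quadratic space `(V, q)` over `ℚ` is given as a `ℤ`-submodule `M` of `V`.  The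
associated bilinear form is `b(x, y) = q(x + y) - q(x) - q(y)`, i.e. `QuadraticMap.polar q`. -/

/-- The group `O(M, q)`: the isometries of `(V, q)` that map `M` onto itself. -/
def latticeAut {V : Type*} [AddCommGroup V] [Module ℚ V] (q : QuadraticForm ℚ V)
    (M : Submodule ℤ V) : Subgroup (V ≃ₗ[ℚ] V) where
  carrier := {σ | (∀ x, q (σ x) = q x) ∧ ∀ x, σ x ∈ M ↔ x ∈ M}
  one_mem' := ⟨fun _ => rfl, fun _ => Iff.rfl⟩
  mul_mem' := by
    rintro σ τ ⟨h1, h2⟩ ⟨h3, h4⟩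
    exact ⟨fun x => (h1 (τ x)).trans (h3 x), fun x => (h2 (τ x)).trans (h4 x)⟩
  inv_mem' := by
    rintro σ ⟨h1, h2⟩
    have h (x : V) : σ (σ⁻¹ x) = x := σ.apply_symm_apply x
    exact ⟨fun x => by rw [← h1, h], fun x => by rw [← h2, h]⟩

/-- The fixed lattice `M ∩ {x | σ x = x}` of a linear automorphism `σ` of `V`. -/
def fixedLattice {V : Type*} [AddCommGroup V] [Module ℚ V] (M : Submodule ℤ V)
    (σ : V ≃ₗ[ℚ] V) : Submodule ℤ V where
  carrier := {x | x ∈ M ∧ σ x = x}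
  zero_mem' := ⟨M.zero_mem, map_zero σ⟩
  add_mem' := by
    rintro x y ⟨h1, h2⟩ ⟨h3, h4⟩
    exact ⟨M.add_mem h1 h3, by rw [map_add, h2, h4]⟩
  smul_mem' := by
    rintro c x ⟨h1, h2⟩
    exact ⟨M.smul_mem c h1, by rw [map_zsmul, h2]⟩

/-- `M` has a `ℤ`-basis whose Gram matrix with respect to `b` is `G`. -/
def HasGramMatrix {V : Type*} [AddCommGroup V] [Module ℚ V] (q : QuadraticForm ℚ V)
    (M : Submodule ℤ V) {r : ℕ} (G : Matrix (Fin r) (Fin r) ℤ) : Prop :=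
  ∃ e : Module.Basis (Fin r) ℤ M,
    ∀ i j, QuadraticMap.polar q (e i : V) (e j : V) = (G i j : ℚ)

/-- `q(x) = ½ (b(xᵢ, xⱼ))ᵢⱼ` for an `n`-tuple `x` of vectors. -/
def halfGram {V : Type*} [AddCommGroup V] [Module ℚ V] (q : QuadraticForm ℚ V) {n : ℕ}
    (x : Fin n → V) : Matrix (Fin n) (Fin n) ℚ :=
  Matrix.of fun i j => QuadraticMap.polar q (x i) (x j) / 2

/-! ### Fourier expansions on the Siegel upper half space -/

/-- The Siegel upper half space of degree `n`. -/
def siegelUpperHalfSpace (n : ℕ) : Set (Matrix (Fin n) (Fin n) ℂ) :=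
  {Z | Z.IsSymm ∧ (Z.map Complex.im).PosDef}

/-- The half-integral symmetric matrices: `T = Tᵗ`, `Tᵢᵢ ∈ ℤ` and `2 Tᵢⱼ ∈ ℤ`. -/
def halfIntegralMatrices (n : ℕ) : Set (Matrix (Fin n) (Fin n) ℚ) :=
  {T | T.IsSymm ∧ (∀ i, ∃ a : ℤ, T i i = a) ∧ ∀ i j, ∃ a : ℤ, 2 * T i j = a}

/-- `exp(2πi tr(T Z))`. -/
noncomputable def fourierExp {n : ℕ} (T : Matrix (Fin n) (Fin n) ℚ)
    (Z : Matrix (Fin n) (Fin n) ℂ) : ℂ :=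
  Complex.exp (2 * Real.pi * Complex.I * (T.map (fun t : ℚ => (t : ℂ)) * Z).trace)

/-- `f(Z) = ∑_T a(T) exp(2πi tr(T Z))` for all `Z` in the Siegel upper half space, with (absolutely
convergent) summation over the half-integral symmetric matrices `T`. -/
def HasFourierExpansion {n : ℕ} (f : siegelUpperHalfSpace n → ℂ)
    (a : halfIntegralMatrices n → ℂ) : Prop :=
  ∀ Z : siegelUpperHalfSpace n,
    HasSum (fun T : halfIntegralMatrices n => a T * fourierExp T.1 Z.1) (f Z)

/-- Fourier expansions are unique. -/
theorem HasFourierExpansion.unique {n : ℕ} {f : siegelUpperHalfSpace n → ℂ}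
    {a a' : halfIntegralMatrices n → ℂ} (h : HasFourierExpansion f a)
    (h' : HasFourierExpansion f a') : a = a' := by
  -- the difference is an expansion of `0`; restrict it to `Z = i + U + Uᵗ` with `U` real
  have h0 (Z : siegelUpperHalfSpace n) :
      HasSum (fun T : halfIntegralMatrices n => (a T - a' T) * fourierExp T.1 Z.1) 0 := by
    have := (h Z).sub (h' Z)
    rw [sub_self] at this
    simpa only [sub_mul] using this
  choose N hN using fun T : halfIntegralMatrices n => T.2.2.2
  let ν (T : halfIntegralMatrices n) : Fin n × Fin n → ℤ := fun k => N T k.1 k.2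
  have hν : Function.Injective ν := by
    intro S T hST
    ext i j
    have e := congrFun hST (i, j)
    have e1 := hN S i j
    have e2 := hN T i j
    simp only [ν] at e
    rw [e] at e1
    linarith
  let Z0 (U : Fin n × Fin n → ℝ) : Matrix (Fin n) (Fin n) ℂ :=
    Matrix.of fun i j => (if i = j then Complex.I else 0) + ((U (i, j) + U (j, i) : ℝ) : ℂ)
  have hZ0 (U : Fin n × Fin n → ℝ) : Z0 U ∈ siegelUpperHalfSpace n := by
    refine ⟨?_, ?_⟩
    · ext i j
      simp only [Z0, Matrix.transpose_apply, Matrix.of_apply, eq_comm (a := i), add_comm (U (i, j))]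
    · have : (Z0 U).map Complex.im = 1 := by
        ext i j
        by_cases hij : i = j <;> simp [Z0, hij, Matrix.one_apply]
      rw [this]
      exact Matrix.PosDef.one
  have hexp (T : halfIntegralMatrices n) (U : Fin n × Fin n → ℝ) :
      fourierExp T.1 (Z0 U) = fourierExp T.1 (Z0 0) *
        UnitAddTorus.mFourier (ν T) (fun k => (U k : UnitAddCircle)) := by
    have e1 : (T.1.map (fun t : ℚ => (t : ℂ)) * Z0 U).trace =
        (T.1.map (fun t : ℚ => (t : ℂ)) * Z0 0).trace + ∑ k, (ν T k : ℂ) * U k := by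
      have hs (i j) : (T.1 j i : ℂ) = T.1 i j := by rw [T.2.1.apply i j]
      have hN' (i j) : ((N T i j : ℤ) : ℂ) = 2 * (T.1 i j : ℂ) := by
        have := congrArg (fun t : ℚ => (t : ℂ)) (hN T i j)
        push_cast at this
        exact this.symm
      simp only [Matrix.trace, Matrix.diag_apply, Matrix.mul_apply, Matrix.map_apply, Z0,
        Matrix.of_apply, ν, hN', Fintype.sum_prod_type, Pi.zero_apply, add_zero, mul_add,
        Finset.sum_add_distrib, Complex.ofReal_add, Complex.ofReal_zero, add_right_inj]
      have e2 : ∑ i, ∑ j, (T.1 i j : ℂ) * (U (j, i) : ℂ) = ∑ i, ∑ j, (T.1 i j : ℂ) * U (i, j) := by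
        rw [Finset.sum_comm]
        simp only [hs]
      rw [e2]
      simp only [mul_assoc, ← Finset.mul_sum]
      ring
    have e3 : UnitAddTorus.mFourier (ν T) (fun k => (U k : UnitAddCircle)) =
        ∏ k, fourier (ν T k) (U k : UnitAddCircle) := rfl
    rw [fourierExp, fourierExp, e1, e3, mul_add, Complex.exp_add, Finset.mul_sum, Complex.exp_sum]
    congr 1
    refine Finset.prod_congr rfl fun k _ => ?_
    rw [fourier_coe_apply]
    congr 1
    push_cast
    ring
  let d (T : halfIntegralMatrices n) : ℂ := (a T - a' T) * fourierExp T.1 (Z0 0)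
  have hd : Summable fun T => d T • UnitAddTorus.mFourier (ν T) := by
    refine Summable.of_norm ?_
    simpa only [norm_smul, UnitAddTorus.mFourier_norm, mul_one] using
      (h0 ⟨Z0 0, hZ0 0⟩).summable.norm
  have hz : HasSum (fun T => d T • UnitAddTorus.mFourier (ν T)) 0 := by
    convert hd.hasSum using 1
    symm
    ext t
    obtain ⟨U, rfl⟩ : ∃ U : Fin n × Fin n → ℝ, (fun k => (U k : UnitAddCircle)) = t :=
      ⟨fun k => (t k).out, funext fun k => Quotient.out_eq (t k)⟩
    have e1 := (ContinuousMap.evalCLM ℂ (fun k => (U k : UnitAddCircle))).hasSum hd.hasSum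
    refine e1.unique ?_
    have e2 := h0 ⟨Z0 U, hZ0 U⟩
    refine e2.congr_fun fun T => ?_
    rw [hexp T U, ← mul_assoc]
    rfl
  have hL : HasSum (fun T => d T • UnitAddTorus.mFourierLp 2 (ν T)) 0 := by
    have := (ContinuousMap.toLp (E := ℂ) 2 (MeasureTheory.Measure.pi
      fun _ : Fin n × Fin n => AddCircle.haarAddCircle (T := (1 : ℝ))) ℂ).hasSum hz
    simp only [map_smul, map_zero] at this
    exact this
  funext S
  have hI := (innerSL ℂ (UnitAddTorus.mFourierLp 2 (ν S))).hasSum hL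
  have hO := orthonormal_iff_ite.mp
    (UnitAddTorus.orthonormal_mFourier (d := Fin n × Fin n)) (ν S)
  have hI' : HasSum (fun T => if T = S then d T else 0) 0 := by
    rw [map_zero] at hI
    refine hI.congr_fun fun T => ?_
    rw [map_smul, innerSL_apply_apply, hO, smul_eq_mul]
    by_cases hT : T = S
    · simp [hT]
    · rw [if_neg (fun e => hT (hν e).symm), if_neg hT, mul_zero]
  have hS : d S = 0 := (hasSum_ite_eq S (d S)).unique (by
    convert hI' using 2 with T
    split_ifs with hT
    · rw [hT]
    · rfl)
  rcases mul_eq_zero.mp hS with e | e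
  · exact sub_eq_zero.mp e
  · exact absurd e (Complex.exp_ne_zero _)

open Classical in
/-- The Fourier coefficients `a(f, T)` of `f`; they are unique by `HasFourierExpansion.unique`
below.  (They are set to `0` if `f` has no Fourier expansion.) -/
noncomputable def fourierCoefficient {n : ℕ} (f : siegelUpperHalfSpace n → ℂ) :
    halfIntegralMatrices n → ℂ :=
  if h : ∃ a, HasFourierExpansion f a then h.choose else 0

/-- The Fourier coefficients of `f` are those of any Fourier expansion of `f`. -/
theorem HasFourierExpansion.fourierCoefficient_eq {n : ℕ} {f : siegelUpperHalfSpace n → ℂ}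
    {a : halfIntegralMatrices n → ℂ} (h : HasFourierExpansion f a) :
    fourierCoefficient f = a := by
  have h' : ∃ a, HasFourierExpansion f a := ⟨a, h⟩
  rw [fourierCoefficient, dif_pos h']
  exact h'.choose_spec.unique h

/-- The theta operator: `Θ(f)(Z) = ∑_T det(T) a(f, T) exp(2πi tr(T Z))`. -/
noncomputable def thetaOperator {n : ℕ} (f : siegelUpperHalfSpace n → ℂ) :
    siegelUpperHalfSpace n → ℂ :=
  fun Z => ∑' T : halfIntegralMatrices n,
    ((T.1.det : ℚ) : ℂ) * fourierCoefficient f T * fourierExp T.1 Z.1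

/-- The local ring `ℤ_(p)`, as a subset of `ℂ`. -/
def localRingAt (p : ℕ) : Set ℂ :=
  {z | ∃ a b : ℤ, ¬ (p : ℤ) ∣ b ∧ z = (a : ℂ) / b}

/-- The maximal ideal `p ℤ_(p)` of `ℤ_(p)`, as a subset of `ℂ`. -/
def maximalIdealAt (p : ℕ) : Set ℂ :=
  {z | ∃ a b : ℤ, ¬ (p : ℤ) ∣ b ∧ z = (p : ℂ) * a / b}

/-- `f ≡ g mod p`: both `f` and `g` have a Fourier expansion with coefficients in `ℤ_(p)`, and the
coefficients of `f - g` are in `p ℤ_(p)`. -/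
def CongruentMod (p : ℕ) {n : ℕ} (f g : siegelUpperHalfSpace n → ℂ) : Prop :=
  HasFourierExpansion f (fourierCoefficient f) ∧
  HasFourierExpansion g (fourierCoefficient g) ∧
  ∀ T, fourierCoefficient f T ∈ localRingAt p ∧ fourierCoefficient g T ∈ localRingAt p ∧
    fourierCoefficient f T - fourierCoefficient g T ∈ maximalIdealAt p

/-- `f` has a Fourier coefficient `a(f, T)`, at some `T` with `det T ≠ 0`, which is not divisible
by `p` (i.e. not in `p ℤ_(p)`). -/
def HasNondegenerateCoefficientNotDivisibleBy (p : ℕ) {n : ℕ}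
    (f : siegelUpperHalfSpace n → ℂ) : Prop :=
  ∃ T : halfIntegralMatrices n, T.1.det ≠ 0 ∧ fourierCoefficient f T ∉ maximalIdealAt p

/-! ### Theta series -/

/-- The degree `n` theta series `∑_{x ∈ Mⁿ} exp(2πi tr(q(x) Z))` of `(M, q)`. -/
noncomputable def siegelTheta {V : Type*} [AddCommGroup V] [Module ℚ V] (q : QuadraticForm ℚ V)
    (M : Submodule ℤ V) (n : ℕ) : siegelUpperHalfSpace n → ℂ :=
  fun Z => ∑' x : Fin n → M, fourierExp (halfGram q fun i => (x i : V)) Z.1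

/-- The series defining the degree `n` theta series of `(M, q)` converges absolutely. -/
def SiegelThetaConverges {V : Type*} [AddCommGroup V] [Module ℚ V] (q : QuadraticForm ℚ V)
    (M : Submodule ℤ V) (n : ℕ) : Prop :=
  ∀ Z : siegelUpperHalfSpace n,
    Summable fun x : Fin n → M => fourierExp (halfGram q fun i => (x i : V)) Z.1

/-- The number `A(M, T)` of `n`-tuples `x` in `M` with `q(x) = T`. -/
noncomputable def representationNumber {V : Type*} [AddCommGroup V] [Module ℚ V]
    (q : QuadraticForm ℚ V) (M : Submodule ℤ V) {n : ℕ} (T : Matrix (Fin n) (Fin n) ℚ) : ℕ :=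
  {x : Fin n → M | halfGram q (fun i => (x i : V)) = T}.ncard

/-! ### The Leech lattice

The coordinates are indexed by the projective line over the field with `23` elements,
`Option (ZMod 23)`, where `none` is the point at infinity. -/

/-- The (extended binary) Golay code: spanned by the all-one word and by the words which, for some
`a` mod `23`, are supported on the point at infinity and on those `i` for which `i + a` is not a
square mod `23`. -/
def golayCode : Submodule (ZMod 2) (Option (ZMod 23) → ZMod 2) :=
  Submodule.span (ZMod 2)
    ({fun _ => 1} ∪
      {c | ∃ a : ZMod 23, c none = 1 ∧
        ∀ i : ZMod 23, (IsSquare (i + a) → c (some i) = 0) ∧ (¬ IsSquare (i + a) → c (some i) = 1)})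

/-- The quadratic form `q(v) = (1/16) ∑ᵢ vᵢ²` on `ℚ²⁴`, so that `b(v, w) = (1/8) ∑ᵢ vᵢ wᵢ`. -/
def leechForm : QuadraticForm ℚ (Option (ZMod 23) → ℚ) :=
  QuadraticMap.weightedSumSquares ℚ fun _ => (1 / 16 : ℚ)

/-- The Leech lattice: the integral vectors `v` for which there is an integer `m` such that all
`vᵢ ≡ m mod 2`, such that the word `((vᵢ - m) / 2 mod 2)ᵢ` is in the Golay code, and such that
`∑ᵢ vᵢ ≡ 4 m mod 8`. -/
def leechLattice : Submodule ℤ (Option (ZMod 23) → ℚ) where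
  carrier := {v | ∃ (m : ℤ) (y : Option (ZMod 23) → ℤ),
    (∀ i, v i = ((m + 2 * y i : ℤ) : ℚ)) ∧
    (fun i => (y i : ZMod 2)) ∈ golayCode ∧
    (∑ i, (m + 2 * y i)) ≡ 4 * m [ZMOD 8]}
  zero_mem' := ⟨0, 0, by simp, by
    convert golayCode.zero_mem using 1
    funext i
    simp, by simp⟩
  add_mem' := by
    rintro v w ⟨m, y, h1, h2, h3⟩ ⟨m', y', h1', h2', h3'⟩
    refine ⟨m + m', y + y', fun i => ?_, ?_, ?_⟩
    · rw [Pi.add_apply, h1, h1', Pi.add_apply]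
      push_cast
      ring
    · have h := golayCode.add_mem h2 h2'
      convert h using 1
      funext i
      simp
    · have h := h3.add h3'
      rw [← Finset.sum_add_distrib, ← mul_add] at h
      have e : ∑ i, (m + m' + 2 * (y + y') i) = ∑ i, (m + 2 * y i + (m' + 2 * y' i)) :=
        Finset.sum_congr rfl fun i _ => by
          rw [Pi.add_apply]
          ring
      rwa [e]
  smul_mem' := by
    rintro c v ⟨m, y, h1, h2, h3⟩
    refine ⟨c * m, c • y, fun i => ?_, ?_, ?_⟩
    · rw [Pi.smul_apply, h1, Pi.smul_apply]
      simp only [zsmul_eq_mul, smul_eq_mul]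
      push_cast
      ring
    · have h := golayCode.smul_mem (c : ZMod 2) h2
      convert h using 1
      funext i
      simp
    · have h := h3.mul_left c
      rw [Finset.mul_sum] at h
      have e : ∑ i, (c * m + 2 * (c • y) i) = ∑ i, c * (m + 2 * y i) :=
        Finset.sum_congr rfl fun i _ => by
          rw [Pi.smul_apply, smul_eq_mul]
          ring
      rwa [e, mul_left_comm]

/-!
The theorem combines three ingredients.

*Fixed lattices.*  The Leech lattice is even and unimodular and has minimum `4`; this follows from the
Golay code being self-dual and doubly even of minimum weight `8`.  If an automorphism `σ` of prime
order `p` acts on a unimodular lattice, then the complement of the fixed lattice is a module over the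
`p`-th cyclotomic integers.  So it has rank `k (p - 1)` for some `k`, and since the cokernel of `σ - 1`
on it has order `p ^ k`, the determinant of the fixed lattice and of its complement divides `p ^ k`
(`det_gramMatrix_dvd_pow`).  For `p = 23` this leaves rank `2` and determinant dividing `23`.  For
`p = 11` it leaves ranks `4` and `14`; in the second case the complement would have rank `10`,
determinant at most `11` and minimum at least `4`, which the inequalities of Hermite and of Korkine
and Zolotarev rule out (`Matrix.IntPosDef.exists_lt_four`).  Reduction theory and a finite search show
that the remaining fixed lattices are determined by rank, determinant and minimum
(`Matrix.exists_congr_binary`, `Matrix.exists_congr_quaternary`).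

*Congruences.*  A group of order `p` acts on the representations of `T` by the Leech lattice, with the
representations by the fixed lattice as fixed points; so both representation numbers are congruent
modulo `p` (`representationNumber_modEq_fixedLattice`).  Let `G` be a Gram matrix of the fixed lattice,
of rank `r`.  In degree `r`, the fixed lattice only represents `T` with `det (2 T)` divisible by
`det G`, hence by `p`; so the theta operator annihilates the theta series modulo `p`.  In degrees
larger than `r` it only represents singular `T`.  Finally `½ G` is represented as many times as the
fixed lattice has automorphisms, and this number is prime to `p` because an automorphism of order `p`
needs a lattice of rank at least `p - 1` (`Matrix.not_dvd_ncard_isometries`).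

*Automorphisms.*  All orders except `13` are realised by permutations of the projective line over the
field with `23` elements that preserve the Golay code: fractional linear transformations and one more
generator of the Mathieu group `M₂₄`.  An automorphism of order `13` is the product of such a
permutation and of the involution attached to a sextet, which does not permute the coordinates up to
sign.
-/

open scoped Matrix

/-! ### Reduction of integral quadratic forms -/

open Matrix in
/-- The bilinear form `xᵗ G y` of an integral square matrix `G`. -/
def Matrix.intBil {n : ℕ} (G : Matrix (Fin n) (Fin n) ℤ) (x y : Fin n → ℤ) : ℤ :=
  x ⬝ᵥ G *ᵥ y

namespace Matrix

open Matrix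

variable {n : ℕ}

theorem intBil_mulVec (G U : Matrix (Fin n) (Fin n) ℤ) (x y : Fin n → ℤ) :
    (Uᵀ * G * U).intBil x y = G.intBil (U *ᵥ x) (U *ᵥ y) := by
  rw [intBil, intBil, ← mulVec_mulVec, ← mulVec_mulVec, dotProduct_mulVec, vecMul_transpose]

theorem intBil_single (G : Matrix (Fin n) (Fin n) ℤ) (i j : Fin n) :
    G.intBil (Pi.single i 1) (Pi.single j 1) = G i j := by
  simp [intBil]

theorem congr_apply (G U : Matrix (Fin n) (Fin n) ℤ) (i j : Fin n) :
    (Uᵀ * G * U) i j = G.intBil (U.col i) (U.col j) := by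
  rw [← intBil_single (Uᵀ * G * U), intBil_mulVec, mulVec_single_one, mulVec_single_one]

theorem IsSymm.congr {G : Matrix (Fin n) (Fin n) ℤ} (hG : G.IsSymm)
    (U : Matrix (Fin n) (Fin n) ℤ) : (Uᵀ * G * U).IsSymm := by
  rw [IsSymm, transpose_mul, transpose_mul, transpose_transpose, hG.eq, Matrix.mul_assoc]

theorem mulVec_ne_zero_of_isUnit_det {U : Matrix (Fin n) (Fin n) ℤ} (hU : IsUnit U.det)
    {x : Fin n → ℤ} (hx : x ≠ 0) : U *ᵥ x ≠ 0 := fun h =>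
  hx (mulVec_injective_of_isUnit ((isUnit_iff_isUnit_det U).2 hU) (by rw [h, mulVec_zero]))

theorem isUnit_det_sq {U : Matrix (Fin n) (Fin n) ℤ} (hU : IsUnit U.det) : U.det * U.det = 1 :=
  Int.isUnit_mul_self hU

theorem det_congr {G U : Matrix (Fin n) (Fin n) ℤ} (hU : IsUnit U.det) :
    (Uᵀ * G * U).det = G.det := by
  rw [det_mul, det_mul, det_transpose, mul_right_comm, isUnit_det_sq hU, one_mul]

/-- The integral Schur complement of the first diagonal entry: up to the factor `G₀₀`, the form
induced by `G` on the orthogonal complement of the first basis vector. -/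
def intSchur (G : Matrix (Fin (n + 1)) (Fin (n + 1)) ℤ) : Matrix (Fin n) (Fin n) ℤ :=
  of fun i j => G 0 0 * G i.succ j.succ - G 0 i.succ * G 0 j.succ

theorem intSchur_isSymm {G : Matrix (Fin (n + 1)) (Fin (n + 1)) ℤ} (hG : G.IsSymm) :
    G.intSchur.IsSymm := by
  ext i j
  simp only [intSchur, transpose_apply, of_apply, hG.apply i.succ j.succ]
  ring

/-- Completion of the square in the first coordinate. -/
theorem mul_intBil_cons {G : Matrix (Fin (n + 1)) (Fin (n + 1)) ℤ} (hG : G.IsSymm) (s t : ℤ)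
    (x y : Fin n → ℤ) :
    G 0 0 * G.intBil (Fin.cons s x) (Fin.cons t y) =
      (G 0 0 * s + ∑ i, G 0 i.succ * x i) * (G 0 0 * t + ∑ i, G 0 i.succ * y i) +
        G.intSchur.intBil x y := by
  have h (i : Fin n) : G i.succ 0 = G 0 i.succ := hG.apply _ _
  have e : G.intSchur.intBil x y = G 0 0 * ∑ i, x i * ∑ j, G i.succ j.succ * y j -
      (∑ i, G 0 i.succ * y i) * ∑ i, G 0 i.succ * x i := by
    simp only [intBil, intSchur, dotProduct, mulVec, of_apply, Finset.mul_sum, Finset.sum_mul,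
      ← Finset.sum_sub_distrib]
    refine Finset.sum_congr rfl fun i _ => ?_
    refine Finset.sum_congr rfl fun j _ => ?_
    ring
  rw [e]
  simp only [intBil, dotProduct, mulVec, Fin.sum_univ_succ, Fin.cons_zero, Fin.cons_succ, h,
    mul_add, Finset.sum_add_distrib]
  have e2 : ∑ i, x i * (G 0 i.succ * t) = (∑ i, G 0 i.succ * x i) * t := by
    rw [Finset.sum_mul]
    exact Finset.sum_congr rfl fun i _ => by ring
  rw [e2]
  ring

theorem mul_intBil_cons_self {G : Matrix (Fin (n + 1)) (Fin (n + 1)) ℤ} (hG : G.IsSymm) (t : ℤ)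
    (x : Fin n → ℤ) :
    G 0 0 * G.intBil (Fin.cons t x) (Fin.cons t x) =
      (G 0 0 * t + ∑ i, G 0 i.succ * x i) ^ 2 + G.intSchur.intBil x x := by
  rw [mul_intBil_cons hG, sq]

/-- Passing to the integral Schur complement multiplies the determinant by a power of the first
diagonal entry. -/
theorem det_intSchur_mul {G : Matrix (Fin (n + 1)) (Fin (n + 1)) ℤ} (hG : G.IsSymm) :
    G.intSchur.det * G 0 0 = G 0 0 ^ n * G.det := by
  -- eliminate the first column below the diagonal
  let L : Matrix (Fin (n + 1)) (Fin (n + 1)) ℤ :=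
    of (Fin.cons (Fin.cons 1 0) fun i => Fin.cons (-G 0 i.succ) fun j => if i = j then G 0 0 else 0)
  have hL : L.det = G 0 0 ^ n := by
    have e : L.submatrix Fin.succ Fin.succ = diagonal fun _ => G 0 0 := by
      ext i j
      simp [L, diagonal_apply]
    rw [det_succ_row_zero, Fin.sum_univ_succ]
    simp only [L, of_apply, Fin.cons_zero, Fin.cons_succ, Pi.zero_apply, mul_zero, zero_mul,
      Finset.sum_const_zero, add_zero, Fin.val_zero, pow_zero, one_mul, Fin.succAbove_zero]
    rw [show (of (Fin.cons (Fin.cons 1 0) fun i => Fin.cons (-G 0 i.succ) fun j =>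
      if i = j then G 0 0 else 0) : Matrix (Fin (n + 1)) (Fin (n + 1)) ℤ) = L from rfl, e]
    simp
  have hLG : (L * G).det = G 0 0 * G.intSchur.det := by
    have e : (L * G).submatrix Fin.succ Fin.succ = G.intSchur := by
      ext i j
      simp only [submatrix_apply, mul_apply, Fin.sum_univ_succ, L, of_apply, Fin.cons_succ,
        Fin.cons_zero, ite_mul, zero_mul, Finset.sum_ite_eq, Finset.mem_univ, if_true, intSchur]
      ring
    rw [det_succ_column_zero, Fin.sum_univ_succ]
    have e0 : (L * G) 0 0 = G 0 0 := by
      simp [mul_apply, Fin.sum_univ_succ, L]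
    have e1 (i : Fin n) : (L * G) i.succ 0 = 0 := by
      simp only [mul_apply, Fin.sum_univ_succ, L, of_apply, Fin.cons_succ,
        Fin.cons_zero, ite_mul, zero_mul, Finset.sum_ite_eq, Finset.mem_univ, if_true]
      rw [hG.apply i.succ 0 |>.symm]
      ring
    simp only [e0, e1, mul_zero, zero_mul, Finset.sum_const_zero, add_zero, Fin.val_zero, pow_zero,
      one_mul, Fin.succAbove_zero, e]
  rw [det_mul, hL] at hLG
  rw [hLG, mul_comm]

/-- `G` is positive definite on integral vectors.  (Symmetry is not part of the definition.) -/
def IntPosDef (G : Matrix (Fin n) (Fin n) ℤ) : Prop :=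
  ∀ x : Fin n → ℤ, x ≠ 0 → 0 < G.intBil x x

theorem IntPosDef.congr {G U : Matrix (Fin n) (Fin n) ℤ} (hG : G.IntPosDef) (hU : IsUnit U.det) :
    (Uᵀ * G * U).IntPosDef := fun x hx => by
  rw [intBil_mulVec]
  exact hG _ (mulVec_ne_zero_of_isUnit_det hU hx)

theorem IntPosDef.zero_zero_pos {G : Matrix (Fin (n + 1)) (Fin (n + 1)) ℤ} (hG : G.IntPosDef) :
    0 < G 0 0 := by
  rw [← intBil_single G]
  exact hG _ (by simp)

theorem cons_ne_zero {t : ℤ} {x : Fin n → ℤ} (hx : x ≠ 0) : (Fin.cons t x : Fin (n + 1) → ℤ) ≠ 0 :=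
  fun h => hx (funext fun i => by simpa using congrFun h i.succ)

theorem IntPosDef.intSchur {G : Matrix (Fin (n + 1)) (Fin (n + 1)) ℤ} (hG : G.IntPosDef)
    (hs : G.IsSymm) : G.intSchur.IntPosDef := by
  intro x hx
  have h0 := hG.zero_zero_pos
  -- apply positivity to the multiple `G₀₀ x`, which lifts to the orthogonal complement of `e₀`
  let t : ℤ := -∑ i, G 0 i.succ * x i
  have h1 := hG (Fin.cons t (G 0 0 • x)) (cons_ne_zero (smul_ne_zero h0.ne' hx))
  have h2 := mul_intBil_cons_self hs t (G 0 0 • x)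
  have h3 : G 0 0 * t + ∑ i, G 0 i.succ * (G 0 0 • x) i = 0 := by
    simp only [t, Pi.smul_apply, smul_eq_mul, mul_neg, Finset.mul_sum]
    rw [← sub_eq_neg_add, ← Finset.sum_sub_distrib]
    exact Finset.sum_eq_zero fun i _ => by ring
  have h4 : G.intSchur.intBil (G 0 0 • x) (G 0 0 • x) = G 0 0 ^ 2 * G.intSchur.intBil x x := by
    simp only [intBil, mulVec_smul, dotProduct_smul, smul_dotProduct, smul_eq_mul]
    ring
  rw [h3, h4] at h2
  have h5 : 0 < G 0 0 * G.intBil (Fin.cons t (G 0 0 • x)) (Fin.cons t (G 0 0 • x)) :=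
    mul_pos h0 h1
  rw [h2] at h5
  by_contra h6
  nlinarith [sq_nonneg (G 0 0)]

/-- Extension of a change of basis of the Schur complement: the first basis vector is kept, and
multiples of it (given by `c`) are added to the other ones. -/
def extendBasis (c : Fin n → ℤ) (U : Matrix (Fin n) (Fin n) ℤ) :
    Matrix (Fin (n + 1)) (Fin (n + 1)) ℤ :=
  of (Fin.cons (Fin.cons 1 c) fun i => Fin.cons 0 (U i))

theorem det_extendBasis (c : Fin n → ℤ) (U : Matrix (Fin n) (Fin n) ℤ) :
    (extendBasis c U).det = U.det := by
  have e : (extendBasis c U).submatrix Fin.succ Fin.succ = U := by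
    ext i j
    simp [extendBasis]
  rw [det_succ_column_zero, Fin.sum_univ_succ]
  simp [extendBasis] at e ⊢
  rw [e]

theorem extendBasis_col_zero (c : Fin n → ℤ) (U : Matrix (Fin n) (Fin n) ℤ) :
    (extendBasis c U).col 0 = Fin.cons 1 0 := by
  ext i
  refine Fin.cases ?_ (fun i => ?_) i <;> simp [extendBasis, col]

theorem extendBasis_col_succ (c : Fin n → ℤ) (U : Matrix (Fin n) (Fin n) ℤ) (j : Fin n) :
    (extendBasis c U).col j.succ = Fin.cons (c j) (U.col j) := by
  ext i
  refine Fin.cases ?_ (fun i => ?_) i <;> simp [extendBasis, col]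

theorem intBil_cons_one (G : Matrix (Fin (n + 1)) (Fin (n + 1)) ℤ) (t : ℤ) (y : Fin n → ℤ) :
    G.intBil (Fin.cons 1 0) (Fin.cons t y) = G 0 0 * t + ∑ i, G 0 i.succ * y i := by
  simp [intBil, dotProduct, mulVec, Fin.sum_univ_succ]

theorem congr_extendBasis_zero_zero (G : Matrix (Fin (n + 1)) (Fin (n + 1)) ℤ) (c : Fin n → ℤ)
    (U : Matrix (Fin n) (Fin n) ℤ) : ((extendBasis c U)ᵀ * G * extendBasis c U) 0 0 = G 0 0 := by
  rw [congr_apply, extendBasis_col_zero, intBil_cons_one]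
  simp

theorem congr_extendBasis_zero_succ (G : Matrix (Fin (n + 1)) (Fin (n + 1)) ℤ) (c : Fin n → ℤ)
    (U : Matrix (Fin n) (Fin n) ℤ) (j : Fin n) :
    ((extendBasis c U)ᵀ * G * extendBasis c U) 0 j.succ =
      G 0 0 * c j + ∑ i, G 0 i.succ * U i j := by
  rw [congr_apply, extendBasis_col_zero, extendBasis_col_succ, intBil_cons_one]
  rfl

theorem intSchur_congr_extendBasis {G : Matrix (Fin (n + 1)) (Fin (n + 1)) ℤ} (hG : G.IsSymm)
    (c : Fin n → ℤ) (U : Matrix (Fin n) (Fin n) ℤ) :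
    ((extendBasis c U)ᵀ * G * extendBasis c U).intSchur = Uᵀ * G.intSchur * U := by
  ext i j
  rw [congr_apply, intSchur, of_apply, congr_extendBasis_zero_zero, congr_extendBasis_zero_succ,
    congr_extendBasis_zero_succ, congr_apply, extendBasis_col_succ, extendBasis_col_succ,
    mul_intBil_cons hG]
  simp [col]

/-- Hermite–Korkine–Zolotarev reduced integral matrices: the first diagonal entry is the minimum
of the form, the other entries of the first row are at most half of it in absolute value, and the
Schur complement is again reduced. -/
def IsHKZReduced : ∀ {n : ℕ}, Matrix (Fin n) (Fin n) ℤ → Prop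
  | 0, _ => True
  | _ + 1, G => (∀ x, x ≠ 0 → G 0 0 ≤ G.intBil x x) ∧ (∀ i, 2 * |G 0 (Fin.succ i)| ≤ G 0 0) ∧
      IsHKZReduced G.intSchur

theorem exists_two_mul_abs_le (a m : ℤ) (hm : 0 < m) : ∃ c : ℤ, 2 * |m * c + a| ≤ m := by
  have h1 := Int.emod_nonneg a hm.ne'
  have h2 := Int.emod_lt_of_pos a hm
  have h3 := Int.mul_ediv_add_emod a m
  rcases le_or_gt (2 * (a % m)) m with h | h
  · refine ⟨-(a / m), ?_⟩
    rw [show m * -(a / m) + a = a % m by linarith, abs_of_nonneg h1]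
    exact h
  · refine ⟨-(a / m) - 1, ?_⟩
    rw [show m * (-(a / m) - 1) + a = -(m - a % m) by linarith, abs_neg, abs_of_nonneg (by omega)]
    omega

/-- A vector on which some integral linear form takes the value `1` is the first column of a
unimodular matrix. -/
theorem exists_isUnit_det_col_zero_eq (v f : Fin (n + 1) → ℤ) (h : ∑ i, f i * v i = 1) :
    ∃ U : Matrix (Fin (n + 1)) (Fin (n + 1)) ℤ, IsUnit U.det ∧ U.col 0 = v := by
  let φ : (Fin (n + 1) → ℤ) →ₗ[ℤ] ℤ := Fintype.linearCombination ℤ f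
  have hφ (x : Fin (n + 1) → ℤ) : φ x = ∑ i, f i * x i := by
    simp [φ, Fintype.linearCombination_apply, mul_comm]
  have hv : φ v = 1 := (hφ v).trans h
  let b := Module.finBasis ℤ (LinearMap.ker φ)
  let B := Module.Basis.mkFinCons v b
    (fun c x hx hc => by
      have := congrArg φ hc
      rw [map_add, map_smul, hv, LinearMap.mem_ker.1 hx, map_zero] at this
      simpa using this)
    (fun z => ⟨-φ z, by
      rw [LinearMap.mem_ker, map_add, map_smul, hv]
      simp⟩)
  have hn : Module.finrank ℤ (LinearMap.ker φ) = n := by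
    have := Module.finrank_eq_card_basis B
    simp only [Module.finrank_fintype_fun_eq_card, Fintype.card_fin] at this
    omega
  let B' := B.reindex (finCongr (congrArg (· + 1) hn))
  refine ⟨(Pi.basisFun ℤ _).toMatrix B', ?_, ?_⟩
  · rw [← Module.Basis.det_apply]
    exact (Pi.basisFun ℤ _).isUnit_det B'
  · ext i
    have : B' 0 = v := by
      simp [B', B]
    simp [col, Module.Basis.toMatrix_apply, this]

/-- A minimal vector of a positive definite form belongs to a basis. -/
theorem IntPosDef.exists_congr_min {G : Matrix (Fin (n + 1)) (Fin (n + 1)) ℤ} (hG : G.IntPosDef) :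
    ∃ U : Matrix (Fin (n + 1)) (Fin (n + 1)) ℤ, IsUnit U.det ∧
      ∀ x, x ≠ 0 → (Uᵀ * G * U) 0 0 ≤ (Uᵀ * G * U).intBil x x := by
  obtain ⟨v, hv0, hv⟩ : ∃ v : Fin (n + 1) → ℤ, v ≠ 0 ∧ ∀ x, x ≠ 0 → G.intBil v v ≤ G.intBil x x := by
    have hne : {x : Fin (n + 1) → ℤ | x ≠ 0}.Nonempty := ⟨Pi.single 0 1, by simp⟩
    obtain ⟨v, hv, hmin⟩ := WellFounded.has_min
      (InvImage.wf (fun x => (G.intBil x x).toNat) wellFounded_lt) _ hne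
    refine ⟨v, hv, fun x hx => ?_⟩
    have h1 : ¬ (G.intBil x x).toNat < (G.intBil v v).toNat := hmin x hx
    have h2 := hG v hv
    have h3 := hG x hx
    omega
  -- the greatest common divisor `d` of the coordinates of `v` is a unit, by minimality
  obtain ⟨d, hd⟩ := IsPrincipalIdealRing.principal (Ideal.span (Set.range v))
  have hdv (i) : d ∣ v i := by
    have : v i ∈ Ideal.span (Set.range v) := Ideal.subset_span ⟨i, rfl⟩
    rw [hd] at this
    exact Ideal.mem_span_singleton.1 this
  choose w hw using hdv
  have hvw : v = d • w := funext hw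
  have hd0 : d ≠ 0 := by
    rintro rfl
    exact hv0 (by rw [hvw, zero_smul])
  have hw0 : w ≠ 0 := by
    rintro rfl
    exact hv0 (by rw [hvw, smul_zero])
  have hd1 : d * d = 1 := by
    have h1 := hv w hw0
    have h2 := hG w hw0
    have h3 : G.intBil v v = d * d * G.intBil w w := by
      rw [hvw]
      simp only [intBil, mulVec_smul, dotProduct_smul, smul_dotProduct, smul_eq_mul]
      ring
    rw [h3] at h1
    have h4 : 0 < d * d := mul_self_pos.2 hd0
    nlinarith
  have hd' : d ∈ Ideal.span (Set.range v) := by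
    rw [hd]
    exact Ideal.mem_span_singleton_self d
  obtain ⟨f, hf⟩ := (Submodule.mem_span_range_iff_exists_fun ℤ).1 hd'
  obtain ⟨U, hU, hUv⟩ := exists_isUnit_det_col_zero_eq v (d • f) (by
    rw [← hd1]
    nth_rewrite 3 [← hf]
    simp [Finset.mul_sum, mul_assoc])
  refine ⟨U, hU, fun x hx => ?_⟩
  rw [congr_apply, hUv, intBil_mulVec]
  exact hv _ (mulVec_ne_zero_of_isUnit_det hU hx)

/-- Every positive definite form has a Hermite–Korkine–Zolotarev reduced basis. -/
theorem IntPosDef.exists_isHKZReduced {n : ℕ} {G : Matrix (Fin n) (Fin n) ℤ} (hG : G.IntPosDef)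
    (hs : G.IsSymm) :
    ∃ U : Matrix (Fin n) (Fin n) ℤ, IsUnit U.det ∧ (Uᵀ * G * U).IsHKZReduced := by
  induction n with
  | zero => exact ⟨1, by simp, trivial⟩
  | succ n ih =>
    obtain ⟨U, hU, hmin⟩ := hG.exists_congr_min
    set H := Uᵀ * G * U with hH
    have hH1 : H.IntPosDef := hG.congr hU
    have hH2 : H.IsSymm := hs.congr U
    obtain ⟨W, hW, hred⟩ := ih (hH1.intSchur hH2) (intSchur_isSymm hH2)
    choose c hc using fun j => exists_two_mul_abs_le (∑ i, H 0 i.succ * W i j) (H 0 0)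
      hH1.zero_zero_pos
    have hV : IsUnit (extendBasis c W).det := by rwa [det_extendBasis]
    have e : (U * extendBasis c W)ᵀ * G * (U * extendBasis c W) =
        (extendBasis c W)ᵀ * H * extendBasis c W := by
      simp only [hH, transpose_mul, Matrix.mul_assoc]
    refine ⟨U * extendBasis c W, by rw [det_mul]; exact hU.mul hV, ?_⟩
    rw [e]
    refine ⟨fun x hx => ?_, fun j => ?_, ?_⟩
    · rw [congr_extendBasis_zero_zero, intBil_mulVec]
      exact hmin _ (mulVec_ne_zero_of_isUnit_det hV hx)
    · rw [congr_extendBasis_zero_zero, congr_extendBasis_zero_succ]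
      exact hc j
    · rw [intSchur_congr_extendBasis hH2]
      exact hred

end Matrix

/-! ### The inequalities of Hermite and of Korkine and Zolotarev -/

namespace Matrix

open Matrix

variable {n : ℕ}

/-- Hermite's inequality: the minimum of a reduced form is at most `4/3` times the second
Gram–Schmidt norm, which is `G.intSchur 0 0 / G 0 0`. -/
theorem IsHKZReduced.three_mul_sq_le {G : Matrix (Fin (n + 2)) (Fin (n + 2)) ℤ}
    (h : G.IsHKZReduced) (hs : G.IsSymm) (hG : G.IntPosDef) :
    3 * G 0 0 ^ 2 ≤ 4 * G.intSchur 0 0 := by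
  have h0 := hG.zero_zero_pos
  have h1 := h.1 (Fin.cons 0 (Pi.single 0 1)) (cons_ne_zero (by simp))
  have h2 := mul_intBil_cons_self hs 0 (Pi.single 0 1)
  rw [intBil_single] at h2
  have h3 := h.2.1 0
  simp only [mul_zero, zero_add, Pi.single_apply, mul_ite, mul_one, Finset.sum_ite_eq',
    Finset.mem_univ, if_true] at h2
  have h4 := abs_le.1 (show |2 * G 0 (Fin.succ 0)| ≤ G 0 0 by rwa [abs_mul, abs_two])
  have h5 := sq_le_sq' h4.1 h4.2
  have h6 := mul_le_mul_of_nonneg_left h1 h0.le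
  rw [h2] at h6
  nlinarith

/-- The core of `two_thirds_le_of_reduced`, for the absolute values `a`, `b`, `k` of the Gram–Schmidt
coefficients: `e3`, `e4` and `e5` are the conditions at the vectors with last coordinate `1` that are
closest to the last axis, after eliminating the third Gram–Schmidt norm, which is supposed to be
smaller than `2/3`. -/
theorem false_of_ternary_inequalities {a b k A : ℚ} (ha0 : 0 ≤ a) (ha1 : a ≤ 1 / 2) (hb0 : 0 ≤ b)
    (hb1 : b ≤ 1 / 2) (hk0 : 0 ≤ k) (hk1 : k ≤ 1 / 2) (h1 : 1 ≤ A + a ^ 2)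
    (e3 : 1 / 3 < (1 - a - b) ^ 2 + (1 - k) ^ 2 * A) (e4 : 1 / 3 < b ^ 2 + k ^ 2 * A)
    (e5 : A * (1 - k ^ 2) < 2 / 3) : False := by
  have hA : 3 / 4 ≤ A := by nlinarith only [ha0, ha1, h1]
  have hk4 : k ^ 2 ≤ 1 / 4 := by nlinarith only [hk0, hk1]
  have hk : 1 / 3 < k := by
    have := mul_le_mul_of_nonneg_right hA (show 0 ≤ 1 - k ^ 2 by linarith)
    by_contra! h
    nlinarith only [this, h, e5, hk0]
  have hA' : A < 8 / 9 := by
    have := mul_nonneg (show 0 ≤ A by linarith) (show 0 ≤ 1 / 4 - k ^ 2 by linarith)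
    linarith
  have ha : 1 / 3 ≤ a := by
    by_contra! h
    nlinarith only [h, ha0, h1, hA']
  have hb : 1 / 3 ≤ b := by
    have := mul_nonneg (show 0 ≤ A by linarith) (show 0 ≤ 1 / 4 - k ^ 2 by linarith)
    by_contra! h
    nlinarith only [h, hb0, this, hA', e4]
  -- the chord of the square root on `[1/9, 1/4]`
  have ha' : 6 / 5 * a ^ 2 + 1 / 5 ≤ a := by nlinarith only [ha, ha1]
  have hb' : 6 / 5 * b ^ 2 + 1 / 5 ≤ b := by nlinarith only [hb, hb1]
  have hu : 1 - a - b ≤ -1 + 6 / 5 * (A * (1 + k ^ 2)) := by linarith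
  have hk2 : 0 < 1 - k ^ 2 := by linarith
  have hu' : 5 * (1 - k ^ 2) * (1 - a - b) ≤ 9 * k ^ 2 - 1 := by
    have i1 := mul_le_mul_of_nonneg_left hu hk2.le
    have i2 := mul_le_mul_of_nonneg_right e5.le (show 0 ≤ 1 + k ^ 2 by positivity)
    linarith
  have hsq : (5 * (1 - k ^ 2)) ^ 2 * (1 - a - b) ^ 2 ≤ (9 * k ^ 2 - 1) ^ 2 := by
    rw [← mul_pow]
    exact pow_le_pow_left₀ (mul_nonneg (by linarith) (by linarith)) hu' 2
  have hw : (3 * k - 1) / 3 < (1 + k) * (1 - a - b) ^ 2 := by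
    have i1 := mul_lt_mul_of_pos_left e3 (show 0 < 1 + k by linarith)
    have i2 := mul_le_mul_of_nonneg_left e5.le (show 0 ≤ 1 - k by linarith)
    linarith
  have hfin : 3 * ((3 * k - 1) * (3 * k + 1) ^ 2) ≤ 25 * ((1 - k) ^ 2 * (1 + k)) := by
    have i1 := mul_nonneg (show 0 ≤ 1 - 2 * k by linarith)
      (show 0 ≤ 28 + 40 * k + 28 * k ^ 2 by positivity)
    linarith
  have i1 := mul_lt_mul_of_pos_left hw (show 0 < 25 * (1 - k ^ 2) ^ 2 by positivity)
  have i2 := mul_le_mul_of_nonneg_left hsq (show 0 ≤ 1 + k by linarith)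
  have i3 := mul_le_mul_of_nonneg_left hfin
    (show 0 ≤ (1 + k) * (3 * k - 1) by exact mul_nonneg (by linarith) (by linarith))
  linarith

/-- The real inequality behind `IsHKZReduced.two_mul_sq_mul_le`: `A` and `D` are the second and
third Gram–Schmidt norms of a reduced ternary form with minimum `1`, and `α`, `β`, `c` are the
Gram–Schmidt coefficients. -/
theorem two_thirds_le_of_reduced {α β c A D : ℚ} (hα : |α| ≤ 1 / 2) (hβ : |β| ≤ 1 / 2)
    (hc : |c| ≤ 1 / 2) (h1 : 1 ≤ A + α ^ 2) (h2 : ∀ s : ℤ, A ≤ (s + c) ^ 2 * A + D)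
    (h3 : ∀ s t : ℤ, 1 ≤ (t + α * s + β) ^ 2 + (s + c) ^ 2 * A + D) : 2 / 3 ≤ D := by
  by_contra! hD
  obtain ⟨hα1, hα2⟩ := abs_le.1 hα
  obtain ⟨hβ1, hβ2⟩ := abs_le.1 hβ
  have hc0 := abs_nonneg c
  have ha0 := abs_nonneg α
  have hb0 := abs_nonneg β
  have hA : 3 / 4 ≤ A := by nlinarith
  -- it suffices to find suitable `s`, `t` for the absolute values
  obtain ⟨s, t, hs, hst⟩ : ∃ s t : ℤ, ((s : ℚ) + c) ^ 2 = (1 - |c|) ^ 2 ∧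
      ((t : ℚ) + α * s + β) ^ 2 ≤ (1 - |α| - |β|) ^ 2 := by
    obtain ⟨s, hs1, hs2, hs3⟩ : ∃ s : ℤ, ((s : ℚ) + c) ^ 2 = (1 - |c|) ^ 2 ∧
        |α * s| = |α| ∧ |α * s| ≤ 1 / 2 := by
      rcases abs_cases c with ⟨h, _⟩ | ⟨h, _⟩
      · exact ⟨-1, by rw [h]; push_cast; ring, by simp, by simpa using hα⟩
      · exact ⟨1, by rw [h]; push_cast; ring, by simp, by simpa using hα⟩
    suffices h : ∀ x : ℚ, |x| ≤ 1 / 2 → ∃ t : ℤ, |(t : ℚ) + x + β| ≤ 1 - |x| - |β| by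
      obtain ⟨t, ht⟩ := h _ hs3
      rw [hs2] at ht
      exact ⟨s, t, hs1, by rw [← sq_abs]; exact pow_le_pow_left₀ (abs_nonneg _) ht 2⟩
    clear hs3
    intro x hs3
    rcases abs_cases x with ⟨hx, _⟩ | ⟨hx, _⟩ <;> rcases abs_cases β with ⟨hy, _⟩ | ⟨hy, _⟩ <;>
      rw [hx] at hs3 ⊢ <;> rw [hy] at hβ ⊢
    · exact ⟨-1, abs_le.2 ⟨by push_cast; linarith, by push_cast; linarith⟩⟩
    · exact ⟨0, abs_le.2 ⟨by push_cast; linarith, by push_cast; linarith⟩⟩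
    · exact ⟨0, abs_le.2 ⟨by push_cast; linarith, by push_cast; linarith⟩⟩
    · exact ⟨1, abs_le.2 ⟨by push_cast; linarith, by push_cast; linarith⟩⟩
  have e0 := h3 0 0
  have e1 := h3 s t
  have e2 := h2 0
  rw [hs] at e1
  simp only [Int.cast_zero, mul_zero, zero_add] at e0 e2
  rw [← sq_abs c, ← sq_abs β] at e0
  rw [← sq_abs c] at e2
  rw [← sq_abs α] at h1
  exact false_of_ternary_inequalities (abs_nonneg α) hα (abs_nonneg β) hβ (abs_nonneg c) hc h1
    (by linarith) (by linarith) (by linarith)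

/-- The inequality of Korkine and Zolotarev: the minimum of a reduced form is at most `3/2` times
the third Gram–Schmidt norm.  The integral Schur complements carry the factors `G 0 0` and
`G 0 0 * G.intSchur 0 0`, up to which their first entries are the Gram–Schmidt norms. -/
theorem IsHKZReduced.two_mul_sq_mul_le {G : Matrix (Fin (n + 3)) (Fin (n + 3)) ℤ}
    (h : G.IsHKZReduced) (hs : G.IsSymm) (hG : G.IntPosDef) :
    2 * G 0 0 ^ 2 * G.intSchur 0 0 ≤ 3 * G.intSchur.intSchur 0 0 := by
  have hH := hG.intSchur hs
  have hHs := intSchur_isSymm hs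
  have m0 := hG.zero_zero_pos
  have m1 := hH.zero_zero_pos
  set H := G.intSchur with hHdef
  have q2 (s : ℤ) := mul_intBil_cons_self hHs s (Pi.single 0 1)
  have q1 (s t : ℤ) := mul_intBil_cons_self hs t (Fin.cons s (Pi.single 0 1))
  have q0 (t : ℤ) := mul_intBil_cons_self hs t (Pi.single 0 1)
  simp only [intBil_single, Pi.single_apply, mul_ite, mul_one, mul_zero, Finset.sum_ite_eq',
    Finset.mem_univ, if_true] at q2 q0
  simp only [Fin.sum_univ_succ (n := n + 1), Fin.cons_zero, Fin.cons_succ, Pi.single_apply, mul_ite,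
    mul_one, mul_zero, Finset.sum_ite_eq', Finset.mem_univ, if_true] at q1
  have hx (s : ℤ) : (Fin.cons s (Pi.single 0 1) : Fin (n + 2) → ℤ) ≠ 0 := cons_ne_zero (by simp)
  have b2 (s : ℤ) := mul_le_mul_of_nonneg_left (h.2.2.1 _ (hx s)) m1.le
  have b1 (s t : ℤ) := mul_le_mul_of_nonneg_left (h.1 (Fin.cons t (Fin.cons s (Pi.single 0 1)))
    (cons_ne_zero (hx s))) m0.le
  have b0 := mul_le_mul_of_nonneg_left (h.1 (Fin.cons 0 (Pi.single 0 1))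
    (cons_ne_zero (by simp))) m0.le
  have r01 := h.2.1 0
  have r02 := h.2.1 1
  have r12 := h.2.2.2.1 0
  simp only [q2, ← hHdef] at b2 r12
  simp only [q1, ← hHdef] at b1
  simp only [q0, ← hHdef] at b0
  change 2 * |G 0 (Fin.succ 1)| ≤ _ at r02
  change ∀ s t : ℤ, _ ≤ (_ + (_ + G 0 (Fin.succ 1))) ^ 2 + H.intBil _ _ at b1
  have b1' (s t : ℤ) : H 0 0 * (G 0 0 * G 0 0) ≤
      H 0 0 * (G 0 0 * t + (G 0 (Fin.succ 0) * s + G 0 (Fin.succ 1))) ^ 2 +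
        ((H 0 0 * s + H 0 (Fin.succ 0)) ^ 2 + H.intSchur 0 0) := by
    rw [← q2, ← mul_add]
    exact mul_le_mul_of_nonneg_left (b1 s t) m1.le
  generalize H.intSchur 0 0 = D at *
  generalize H 0 (Fin.succ 0) = c at *
  generalize H 0 0 = A at *
  generalize G 0 (Fin.succ 0) = α at *
  generalize G 0 (Fin.succ 1) = β at *
  generalize G 0 0 = m at *
  have hm : (0 : ℚ) < m := by exact_mod_cast m0
  have hA : (0 : ℚ) < A := by exact_mod_cast m1
  have habs {x y : ℤ} (hy : (0 : ℚ) < y) (h : 2 * |x| ≤ y) : |(x : ℚ) / y| ≤ 1 / 2 := by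
    rw [abs_div, abs_of_pos hy, div_le_div_iff₀ hy two_pos]
    have : 2 * |(x : ℚ)| ≤ y := by exact_mod_cast h
    linarith
  have key := two_thirds_le_of_reduced (α := α / m) (β := β / m) (c := c / A) (A := A / m ^ 2)
    (D := D / (m ^ 2 * A)) (habs hm r01) (habs hm r02) (habs hA r12) ?_ ?_ ?_
  · rw [div_le_div_iff₀ three_pos (by positivity)] at key
    have : (2 * m ^ 2 * A : ℚ) ≤ 3 * D := by linarith
    exact_mod_cast this
  · have : (m * m : ℚ) ≤ (m * 0 + α) ^ 2 + A := by exact_mod_cast b0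
    rw [div_pow, ← add_div, le_div_iff₀ (by positivity)]
    linarith
  · intro s
    have : (A * A : ℚ) ≤ (A * s + c) ^ 2 + D := by exact_mod_cast b2 s
    have e : ((s : ℚ) + c / A) ^ 2 * (A / m ^ 2) + D / (m ^ 2 * A) =
      ((A * s + c) ^ 2 + D) / (m ^ 2 * A) := by field_simp
    rw [e, div_le_div_iff₀ (by positivity) (by positivity)]
    have := mul_le_mul_of_nonneg_right this (sq_nonneg (m : ℚ))
    linarith
  · intro s t
    have : (A * (m * m) : ℚ) ≤ A * (m * t + (α * s + β)) ^ 2 + ((A * s + c) ^ 2 + D) := by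
      exact_mod_cast b1' s t
    have e : ((t : ℚ) + α / m * s + β / m) ^ 2 + (s + c / A) ^ 2 * (A / m ^ 2) + D / (m ^ 2 * A) =
      (A * (m * t + (α * s + β)) ^ 2 + ((A * s + c) ^ 2 + D)) / (m ^ 2 * A) := by
      field_simp
      ring
    rw [e, le_div_iff₀ (by positivity)]
    linarith

/-- The constants in the bound `IsHKZReduced.hkzConstant_mul_pow_le`.  In terms of the Gram–Schmidt
norms `m₀, m₁, m₂, …` of a reduced form of rank `2 (k + 1)`, the factor `3 / 4` comes from
`m₁ ≥ 3/4 m₀`, and the factor `(2 / 3) ^ (2 k)` from `m₂ ≥ 2/3 m₀` and the bound for the form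
of rank `2 k` with minimum `m₂`. -/
def hkzConstant : ℕ → ℚ
  | 0 => 1
  | k + 1 => 3 / 4 * (2 / 3) ^ (2 * k) * hkzConstant k

theorem hkzConstant_nonneg (k : ℕ) : 0 ≤ hkzConstant k := by
  induction k with
  | zero => exact zero_le_one
  | succ k ih => exact mul_nonneg (by positivity) ih

/-- A lower bound for the determinant of a reduced form of even rank in terms of its minimum. -/
theorem IsHKZReduced.hkzConstant_mul_pow_le (k : ℕ)
    {G : Matrix (Fin (2 * k + 2)) (Fin (2 * k + 2)) ℤ} (h : G.IsHKZReduced) (hs : G.IsSymm)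
    (hG : G.IntPosDef) : hkzConstant (k + 1) * (G 0 0 : ℚ) ^ (2 * k + 2) ≤ G.det := by
  have m0 : (0 : ℚ) < G 0 0 := by exact_mod_cast hG.zero_zero_pos
  have m1 : (0 : ℚ) < G.intSchur 0 0 := by exact_mod_cast (hG.intSchur hs).zero_zero_pos
  have d0 : (G.intSchur.det : ℚ) * G 0 0 = (G 0 0 : ℚ) ^ (2 * k + 1) * G.det := by
    exact_mod_cast det_intSchur_mul hs
  have e1 : 3 / 4 * (G 0 0 : ℚ) ^ 2 ≤ G.intSchur 0 0 := by
    have : (3 * G 0 0 ^ 2 : ℚ) ≤ 4 * G.intSchur 0 0 := by exact_mod_cast h.three_mul_sq_le hs hG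
    linarith
  rw [pow_succ, mul_right_comm, mul_left_inj' m0.ne'] at d0
  have d1 : (G.intSchur.intSchur.det : ℚ) * G.intSchur 0 0 =
      (G.intSchur 0 0 : ℚ) ^ (2 * k) * G.intSchur.det := by
    exact_mod_cast det_intSchur_mul (intSchur_isSymm hs)
  rw [d0] at d1
  cases k with
  | zero =>
    rw [show G.intSchur.intSchur.det = 1 from det_fin_zero] at d1
    simp only [mul_zero, pow_zero, one_mul, Int.cast_one] at d1
    simp only [hkzConstant, mul_zero, pow_zero, mul_one, zero_add]
    rwa [← d1]
  | succ k =>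
    have ih := IsHKZReduced.hkzConstant_mul_pow_le k (G := G.intSchur.intSchur) h.2.2.2.2
      (intSchur_isSymm (intSchur_isSymm hs)) ((hG.intSchur hs).intSchur (intSchur_isSymm hs))
    have e2 : 2 / 3 * (G 0 0 : ℚ) ^ 2 * G.intSchur 0 0 ≤ G.intSchur.intSchur 0 0 := by
      have : (2 * G 0 0 ^ 2 * G.intSchur 0 0 : ℚ) ≤ 3 * G.intSchur.intSchur 0 0 := by
        exact_mod_cast h.two_mul_sq_mul_le hs hG
      linarith
    rw [hkzConstant]
    have hc := hkzConstant_nonneg (k + 1)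
    generalize hkzConstant (k + 1) = C at *
    generalize (G.intSchur.intSchur.det : ℚ) = D2 at *
    generalize (G.intSchur.intSchur 0 0 : ℚ) = B at *
    generalize (G.intSchur 0 0 : ℚ) = A at *
    generalize (G 0 0 : ℚ) = m at *
    generalize (G.det : ℚ) = D at *
    have f1 : C * (2 / 3 * m ^ 2 * A) ^ (2 * k + 2) * A ≤
        A ^ (2 * (k + 1)) * (m ^ (2 * (k + 1)) * D) := by
      rw [← d1]
      exact mul_le_mul_of_nonneg_right ((mul_le_mul_of_nonneg_left
        (pow_le_pow_left₀ (by positivity) e2 _) hc).trans ih) m1.le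
    have f2 : C * (2 / 3 * m ^ 2 * A) ^ (2 * k + 2) * A =
        A ^ (2 * (k + 1)) * (m ^ (2 * (k + 1)) *
          (C * (2 / 3) ^ (2 * (k + 1)) * m ^ (2 * (k + 1)) * A)) := by
      rw [show 2 * k + 2 = 2 * (k + 1) by ring]
      ring
    rw [f2] at f1
    have f3 := le_of_mul_le_mul_left (le_of_mul_le_mul_left f1 (by positivity)) (by positivity)
    refine le_trans ?_ f3
    have f4 := mul_le_mul_of_nonneg_left e1
      (show 0 ≤ C * (2 / 3) ^ (2 * (k + 1)) * m ^ (2 * (k + 1)) by positivity)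
    refine le_trans (le_of_eq ?_) f4
    ring

/-- A positive definite integral form of rank `10` and determinant at most `74` represents a
positive integer smaller than `4`: the determinant of a reduced form of rank `10` with minimum at
least `4` is at least `(3/4)⁵ (2/3)²⁰ 4¹⁰ > 74`. -/
theorem IntPosDef.exists_lt_four {G : Matrix (Fin 10) (Fin 10) ℤ} (hG : G.IntPosDef)
    (hs : G.IsSymm) (hd : G.det ≤ 74) : ∃ x, x ≠ 0 ∧ G.intBil x x < 4 := by
  obtain ⟨U, hU, hred⟩ := hG.exists_isHKZReduced hs
  by_contra! hmin
  have h := IsHKZReduced.hkzConstant_mul_pow_le 4 hred (hs.congr U) (hG.congr hU)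
  rw [det_congr hU] at h
  have h4 : (4 : ℚ) ≤ ((Uᵀ * G * U) 0 0 : ℤ) := by
    rw [congr_apply]
    have := mulVec_ne_zero_of_isUnit_det hU (x := Pi.single 0 1) (by simp)
    rw [mulVec_single_one] at this
    exact_mod_cast hmin _ this
  have h5 := pow_le_pow_left₀ (by norm_num) h4 (2 * 4 + 2)
  have h6 : (G.det : ℚ) ≤ 74 := by exact_mod_cast hd
  have h7 := mul_le_mul_of_nonneg_left h5 (hkzConstant_nonneg (4 + 1))
  norm_num [hkzConstant] at h7 h
  linarith

end Matrix

/-! ### Uniqueness of the forms of rank two and four -/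

namespace Matrix

open Matrix

/-- The symmetric matrix with diagonal `4, 4, 4, z` and the given entries above the diagonal. -/
def quaternaryGram (p r s t u v z : ℤ) : Matrix (Fin 4) (Fin 4) ℤ :=
  !![4, p, r, s; p, 4, t, u; r, t, 4, v; s, u, v, z]

/-- The bilinear form of `quaternaryGram`, written out so that it evaluates fast in the kernel. -/
def quaternaryBil (p r s t u v z : ℤ) (x y : ℤ × ℤ × ℤ × ℤ) : ℤ :=
  x.1 * (4 * y.1 + p * y.2.1 + r * y.2.2.1 + s * y.2.2.2) +
  x.2.1 * (p * y.1 + 4 * y.2.1 + t * y.2.2.1 + u * y.2.2.2) +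
  x.2.2.1 * (r * y.1 + t * y.2.1 + 4 * y.2.2.1 + v * y.2.2.2) +
  x.2.2.2 * (s * y.1 + u * y.2.1 + v * y.2.2.1 + z * y.2.2.2)

/-- The vectors of rank four with coordinates in `{-1, 0, 1}`. -/
def ternaryVectors : List (ℤ × ℤ × ℤ × ℤ) :=
  let l : List ℤ := [-1, 0, 1]
  l.product (l.product (l.product l))

/-- The search for four vectors with coordinates in `{-1, 0, 1}` whose Gram matrix is
`quaternaryGram 2 1 0 1 1 2 4`. -/
def quaternarySearch (p r s t u v z : ℤ) : Bool :=
  let B := quaternaryBil p r s t u v z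
  let l := ternaryVectors.filter fun x => B x x == 4
  l.any fun x => l.any fun y => B x y == 2 && l.any fun c => B x c == 1 && B y c == 1 &&
    l.any fun d => B x d == 0 && B y d == 1 && B c d == 2

/-- The determinant of `quaternaryGram`, expanded along the first two rows. -/
def quaternaryDet (p r s t u v z : ℤ) : ℤ :=
  (16 - p * p) * (4 * z - v * v) - (4 * t - p * r) * (t * z - u * v) +
  (4 * u - p * s) * (t * v - 4 * u) + (p * t - 4 * r) * (r * z - v * s) -
  (p * u - 4 * s) * (r * v - 4 * s) + (r * u - t * s) * (r * u - t * s)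

/-- The search succeeds for all `quaternaryGram`s of determinant `121` in the range that contains the
reduced ones; the signs of the basis vectors make the first row nonnegative. -/
def quaternaryCheck : Bool :=
  let l2 : List ℤ := [-2, -1, 0, 1, 2]
  let l0 : List ℤ := [0, 1, 2]
  l0.all fun p => l0.all fun r => l0.all fun s => l2.all fun t => l2.all fun u =>
    [-3, -2, -1, 0, 1, 2, 3].all fun v => [4, 6].all fun z =>
      !(quaternaryDet p r s t u v z == 121) || quaternarySearch p r s t u v z

theorem quaternaryGram_det (p r s t u v z : ℤ) :
    (quaternaryGram p r s t u v z).det = quaternaryDet p r s t u v z := by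
  simp [quaternaryGram, quaternaryDet, det_succ_row_zero, Fin.sum_univ_succ, Fin.succAbove]
  ring

set_option maxRecDepth 100000 in
theorem quaternaryCheck_eq_true : quaternaryCheck = true := by
  decide +kernel

theorem exists_congr_of_quaternaryDet_eq {p r s t u v z : ℤ} (hp : 0 ≤ p ∧ p ≤ 2)
    (hr : 0 ≤ r ∧ r ≤ 2) (hs : 0 ≤ s ∧ s ≤ 2) (ht : |t| ≤ 2) (hu : |u| ≤ 2) (hv : |v| ≤ 3)
    (hz : z = 4 ∨ z = 6) (hd : quaternaryDet p r s t u v z = 121) :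
    ∃ X : Matrix (Fin 4) (Fin 4) ℤ,
      Xᵀ * quaternaryGram p r s t u v z * X = quaternaryGram 2 1 0 1 1 2 4 := by
  have h := quaternaryCheck_eq_true
  rw [quaternaryCheck] at h
  simp only [List.all_eq_true] at h
  rw [abs_le] at ht hu hv
  have h1 := h p (by simp; omega) r (by simp; omega) s (by simp; omega) t (by simp; omega) u
    (by simp; omega) v (by simp; omega) z (by simpa using hz)
  rw [hd] at h1
  have h2 : quaternarySearch p r s t u v z = true := by simpa using h1
  simp only [quaternarySearch, List.any_eq_true, Bool.and_eq_true, beq_iff_eq, List.mem_filter]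
    at h2
  obtain ⟨x, ⟨-, hxx⟩, y, ⟨-, hyy⟩, hxy, c, ⟨-, hcc⟩, ⟨hxc, hyc⟩, d, ⟨-, hdd⟩, ⟨hxd, hyd⟩, hcd⟩ := h2
  refine ⟨!![x.1, y.1, c.1, d.1; x.2.1, y.2.1, c.2.1, d.2.1; x.2.2.1, y.2.2.1, c.2.2.1, d.2.2.1;
    x.2.2.2, y.2.2.2, c.2.2.2, d.2.2.2], ?_⟩
  unfold quaternaryBil at *
  ext i j
  fin_cases i <;> fin_cases j <;>
    simp [quaternaryGram, mul_apply, Fin.sum_univ_four] <;> linarith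

theorem exists_sign (p : ℤ) : ∃ e : ℤ, e * e = 1 ∧ e * p = |p| := by
  rcases abs_cases p with ⟨h, _⟩ | ⟨h, _⟩
  · exact ⟨1, by simp, by simp [h]⟩
  · exact ⟨-1, by simp, by simp [h]⟩

theorem quaternaryGram_congr_sign {e f g : ℤ} (he : e * e = 1) (hf : f * f = 1) (hg : g * g = 1)
    (p r s t u v z : ℤ) :
    (diagonal ![1, e, f, g])ᵀ * quaternaryGram p r s t u v z * diagonal ![1, e, f, g] =
      quaternaryGram (e * p) (f * r) (g * s) (e * f * t) (e * g * u) (f * g * v) z := by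
  rw [diagonal_transpose]
  ext i j
  rw [mul_diagonal, diagonal_mul]
  fin_cases i <;> fin_cases j <;> simp [quaternaryGram] <;>
    first | ring1 | linear_combination 4 * he | linear_combination 4 * hf | linear_combination z * hg

/-- Reduction of the quaternary forms of determinant `121` with off-diagonal entries of any sign. -/
theorem exists_congr_quaternaryGram {p r s t u v z : ℤ} (hp : |p| ≤ 2)
    (hr : |r| ≤ 2) (hs : |s| ≤ 2) (ht : |t| ≤ 2) (hu : |u| ≤ 2) (hv : |v| ≤ 3)
    (hz : z = 4 ∨ z = 6) (hd : (quaternaryGram p r s t u v z).det = 121) :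
    ∃ X : Matrix (Fin 4) (Fin 4) ℤ,
      Xᵀ * quaternaryGram p r s t u v z * X = quaternaryGram 2 1 0 1 1 2 4 := by
  obtain ⟨e, he, hep⟩ := exists_sign p
  obtain ⟨f, hf, hfr⟩ := exists_sign r
  obtain ⟨g, hg, hgs⟩ := exists_sign s
  have hS := quaternaryGram_congr_sign he hf hg p r s t u v z
  set S : Matrix (Fin 4) (Fin 4) ℤ := diagonal ![1, e, f, g] with hSdef
  have hSd : IsUnit S.det := by
    refine IsUnit.of_mul_eq_one S.det ?_
    rw [hSdef, det_diagonal]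
    simp only [Fin.prod_univ_four]
    simp
    linear_combination f * f * g * g * he + g * g * hf + hg
  rw [hep, hfr, hgs] at hS
  have h1 {e f : ℤ} (he : e * e = 1) (hf : f * f = 1) : |e * f| = 1 := by
    rcases Int.isUnit_iff.1 (IsUnit.of_mul_eq_one e he) with rfl | rfl <;>
    rcases Int.isUnit_iff.1 (IsUnit.of_mul_eq_one f hf) with rfl | rfl <;> simp
  obtain ⟨X, hX⟩ := exists_congr_of_quaternaryDet_eq ⟨abs_nonneg p, hp⟩ ⟨abs_nonneg r, hr⟩
    ⟨abs_nonneg s, hs⟩ (t := e * f * t) (u := e * g * u) (v := f * g * v)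
    (by rwa [abs_mul, h1 he hf, one_mul]) (by rwa [abs_mul, h1 he hg, one_mul])
    (by rwa [abs_mul, h1 hf hg, one_mul]) hz (by rw [← quaternaryGram_det, ← hS, det_congr hSd, hd])
  refine ⟨S * X, ?_⟩
  rw [← hX, ← hS]
  simp only [transpose_mul, Matrix.mul_assoc]

/-- An integral matrix between forms of the same nonzero determinant is unimodular. -/
theorem isUnit_det_of_congr {n : ℕ} {G H X : Matrix (Fin n) (Fin n) ℤ} (h : Xᵀ * G * X = H)
    (hd : G.det = H.det) (h0 : H.det ≠ 0) : IsUnit X.det := by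
  refine IsUnit.of_mul_eq_one X.det ?_
  have := congrArg det h
  rw [det_mul, det_mul, det_transpose, hd] at this
  exact mul_right_cancel₀ h0 (by linarith)

/-- A positive definite even form of rank two, with minimum at least `4` and determinant dividing
`23`, is unique up to equivalence: the determinant `1` is excluded by Hermite's inequality. -/
theorem exists_congr_binary {G : Matrix (Fin 2) (Fin 2) ℤ} (hs : G.IsSymm)
    (hev : ∀ x, Even (G.intBil x x)) (hmin : ∀ x, x ≠ 0 → 4 ≤ G.intBil x x) (hd : G.det ∣ 23) :
    ∃ U : Matrix (Fin 2) (Fin 2) ℤ, IsUnit U.det ∧ Uᵀ * G * U = !![4, 1; 1, 6] := by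
  have hG : G.IntPosDef := fun x hx => by have := hmin x hx; omega
  obtain ⟨U, hU, hred⟩ := hG.exists_isHKZReduced hs
  have hs' := hs.congr U
  have hev' (x) : Even ((Uᵀ * G * U).intBil x x) := by rw [intBil_mulVec]; exact hev _
  have hmin' (x) (hx : x ≠ 0) : 4 ≤ (Uᵀ * G * U).intBil x x := by
    rw [intBil_mulVec]; exact hmin _ (mulVec_ne_zero_of_isUnit_det hU hx)
  have hd' : (Uᵀ * G * U).det ∣ 23 := by rwa [det_congr hU]
  have hG' := hG.congr hU
  suffices h : ∃ X : Matrix (Fin 2) (Fin 2) ℤ, Xᵀ * (Uᵀ * G * U) * X = !![4, 1; 1, 6] ∧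
      (Uᵀ * G * U).det = 23 by
    obtain ⟨X, hX, hXd⟩ := h
    refine ⟨U * X, ?_, ?_⟩
    · rw [det_mul]
      exact hU.mul (isUnit_det_of_congr hX (by simp [hXd]) (by simp))
    · rw [← hX]
      simp only [transpose_mul, Matrix.mul_assoc]
  generalize Uᵀ * G * U = R at *
  have h1 := hred.three_mul_sq_le hs' hG'
  have h2 := hred.2.1 0
  have hev0 := hev' (Pi.single 0 1)
  have hev1 := hev' (Pi.single 1 1)
  have hmin0 := hmin' (Pi.single 0 1) (by simp)
  rw [intBil_single] at hev0 hev1 hmin0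
  have h10 : R 1 0 = R 0 1 := hs'.apply 0 1
  have hR : R = !![R 0 0, R 0 1; R 0 1, R 1 1] := by
    ext i j
    fin_cases i <;> fin_cases j <;> simp [h10]
  simp only [intSchur, of_apply] at h1
  change 3 * R 0 0 ^ 2 ≤ 4 * (R 0 0 * R 1 1 - R 0 1 * R 0 1) at h1
  change 2 * |R 0 1| ≤ R 0 0 at h2
  generalize R 0 0 = a at *
  generalize R 0 1 = b at *
  generalize R 1 1 = c at *
  have hdet : R.det = a * c - b * b := by rw [hR]; simp
  have h3 : a * c - b * b ≤ 23 := by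
    rw [← hdet]
    exact Int.le_of_dvd (by norm_num) hd'
  have ha : a = 4 := by
    have : a ≤ 5 := by nlinarith
    obtain ⟨k, rfl⟩ := hev0
    omega
  subst ha
  have h23 : 4 * c - b * b = 23 := by
    rw [hdet] at hd'
    have h4 := (Nat.dvd_prime (by norm_num : Nat.Prime 23)).1 (Int.natAbs_dvd_natAbs.2 hd')
    omega
  have hb := abs_le.1 (show |b| ≤ 2 by omega)
  have hb' : (b = 1 ∨ b = -1) ∧ c = 6 := by
    obtain ⟨hb1, hb2⟩ := hb
    interval_cases b <;> omega
  obtain ⟨hb1 | hb1, rfl⟩ := hb' <;> subst hb1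
  · exact ⟨1, by simpa using hR, by rw [hdet]; norm_num⟩
  · refine ⟨!![1, 0; 0, -1], ?_, by rw [hdet]; norm_num⟩
    rw [hR]
    ext i j
    fin_cases i <;> fin_cases j <;> simp [mul_apply, Fin.sum_univ_two]

/-- The diagonal of a reduced even quaternary form with minimum `4` and determinant `121`: the
entries `h`, `k` are those of the iterated Schur complements, whose determinants are
`1936 = 4² * 121` and `1936 * h00`.  Hermite's inequality leaves the values `12`, `15`, `16` for `h00`,
and in each case a short interval for `k00`. -/
theorem quaternary_diagonal_bounds {p r s x y z h00 h11 h22 h01 h02 k00 k11 k01 : ℤ}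
    (h00e : h00 = 4 * x - p * p) (h11e : h11 = 4 * y - r * r) (h22e : h22 = 4 * z - s * s)
    (k00e : k00 = h00 * h11 - h01 * h01)
    (k11e : k11 = h00 * h22 - h02 * h02) (kd : k00 * k11 - k01 * k01 = 1936 * h00)
    (hp : 2 * |p| ≤ 4) (hr : 2 * |r| ≤ 4) (hs : 2 * |s| ≤ 4) (h01b : 2 * |h01| ≤ h00)
    (h02b : 2 * |h02| ≤ h00) (k01b : 2 * |k01| ≤ k00) (hh : 3 * 4 ^ 2 ≤ 4 * h00)
    (hk : 3 * h00 ^ 2 ≤ 4 * k00) (hl : 3 * k00 ^ 2 ≤ 4 * (1936 * h00)) (hx : 4 ≤ x) (hy : 4 ≤ y)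
    (hz : 4 ≤ z) (hxe : Even x) (hye : Even y) (hze : Even z) :
    x = 4 ∧ y = 4 ∧ (z = 4 ∨ z = 6) := by
  have hp2 := abs_le.1 (show |p| ≤ 2 by omega)
  have hsq {a b : ℤ} (h : 2 * |a| ≤ b) : 4 * (a * a) ≤ b * b := by
    have := abs_nonneg a
    nlinarith [sq_abs a]
  have hr2 := hsq hr
  have hs2 := hsq hs
  have h01s := hsq h01b
  have h02s := hsq h02b
  have k01s := hsq k01b
  have hpp : p * p ≤ 4 := by nlinarith
  have h00u : h00 ≤ 16 := by
    by_contra! h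
    have h1 : 17 ≤ h00 := h
    have h2 : 0 ≤ 3 * h00 ^ 2 := by positivity
    have h3 := mul_le_mul hk hk h2 (h2.trans hk)
    have h4 : 27 * h00 ^ 4 ≤ 64 * 1936 * h00 := by nlinarith
    have h5 : h00 ^ 3 * 27 ≤ 64 * 1936 := by
      by_contra! h6
      nlinarith
    have h6 := pow_le_pow_left₀ (by norm_num) h1 3
    linarith
  have hx4 : x = 4 := by
    obtain ⟨k, rfl⟩ := hxe
    omega
  subst hx4
  refine ⟨rfl, ?_⟩
  have hyz {y z : ℤ} (hye : Even y) (hze : Even z) (hy : 4 ≤ y) (hz : 4 ≤ z) (hy' : y ≤ 5)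
      (hz' : z ≤ 7) : y = 4 ∧ (z = 4 ∨ z = 6) := by
    obtain ⟨k, rfl⟩ := hye
    obtain ⟨l, rfl⟩ := hze
    omega
  have h3 : h00 = 12 ∨ h00 = 15 ∨ h00 = 16 := by
    obtain ⟨hp1, hp2⟩ := hp2
    interval_cases p <;> omega
  have h4 : 4 * (k00 * k11) ≤ 4 * (1936 * h00) + k00 * k00 := by linarith
  rcases h3 with h3 | h3 | h3 <;> rw [h3] at hk hl h01s h02s k00e k11e h4 <;> norm_num at hk hl
  · have k1 : 108 ≤ k00 := by omega
    have k2 : k00 ≤ 176 := by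
      by_contra! h
      nlinarith only [h, hl]
    have k3 : k11 ≤ 260 := by
      by_contra! h
      have i1 := mul_nonneg (sub_nonneg.2 k1) (sub_nonneg.2 k2)
      have i2 := mul_le_mul_of_nonneg_left (Int.add_one_le_of_lt h) (show 0 ≤ k00 by omega)
      linarith
    exact hyz hye hze hy hz (by omega) (by omega)
  · have k1 : 169 ≤ k00 := by omega
    have k2 : k00 ≤ 196 := by
      by_contra! h
      nlinarith only [h, hl]
    have k3 : k11 ≤ 214 := by
      by_contra! h
      have i1 := mul_nonneg (sub_nonneg.2 k1) (sub_nonneg.2 k2)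
      have i2 := mul_le_mul_of_nonneg_left (Int.add_one_le_of_lt h) (show 0 ≤ k00 by omega)
      linarith
    exact hyz hye hze hy hz (by omega) (by omega)
  · have k1 : 192 ≤ k00 := by omega
    have k2 : k00 ≤ 203 := by
      by_contra! h
      nlinarith only [h, hl]
    have k3 : k11 ≤ 209 := by
      by_contra! h
      have i1 := mul_nonneg (sub_nonneg.2 k1) (sub_nonneg.2 k2)
      have i2 := mul_le_mul_of_nonneg_left (Int.add_one_le_of_lt h) (show 0 ≤ k00 by omega)
      linarith
    exact hyz hye hze hy hz (by omega) (by omega)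

/-- A positive definite even form of rank four, with minimum at least `4` and determinant dividing
`121`, is unique up to equivalence.  The inequalities of Hermite and of Korkine and Zolotarev leave
finitely many reduced forms, each of which contains the given one. -/
theorem exists_congr_quaternary {G : Matrix (Fin 4) (Fin 4) ℤ} (hs : G.IsSymm)
    (hev : ∀ x, Even (G.intBil x x)) (hmin : ∀ x, x ≠ 0 → 4 ≤ G.intBil x x) (hd : G.det ∣ 121) :
    ∃ U : Matrix (Fin 4) (Fin 4) ℤ, IsUnit U.det ∧
      Uᵀ * G * U = !![4, 2, 1, 0; 2, 4, 1, 1; 1, 1, 4, 2; 0, 1, 2, 4] := by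
  have hG : G.IntPosDef := fun x hx => by have := hmin x hx; omega
  obtain ⟨U, hU, hred⟩ := hG.exists_isHKZReduced hs
  have hs' := hs.congr U
  have hev' (x) : Even ((Uᵀ * G * U).intBil x x) := by rw [intBil_mulVec]; exact hev _
  have hmin' (x) (hx : x ≠ 0) : 4 ≤ (Uᵀ * G * U).intBil x x := by
    rw [intBil_mulVec]; exact hmin _ (mulVec_ne_zero_of_isUnit_det hU hx)
  have hd' : (Uᵀ * G * U).det ∣ 121 := by rwa [det_congr hU]
  have hG' := hG.congr hU
  change ∃ U : Matrix (Fin 4) (Fin 4) ℤ, IsUnit U.det ∧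
      Uᵀ * G * U = quaternaryGram 2 1 0 1 1 2 4
  suffices h : ∃ X : Matrix (Fin 4) (Fin 4) ℤ, Xᵀ * (Uᵀ * G * U) * X = quaternaryGram 2 1 0 1 1 2 4
      ∧ (Uᵀ * G * U).det = 121 by
    obtain ⟨X, hX, hXd⟩ := h
    refine ⟨U * X, ?_, ?_⟩
    · have h121 : (quaternaryGram 2 1 0 1 1 2 4).det = 121 := by
        rw [quaternaryGram_det]; rfl
      rw [det_mul]
      exact hU.mul (isUnit_det_of_congr hX (by rw [hXd, h121]) (by simp [h121]))
    · rw [← hX]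
      simp only [transpose_mul, Matrix.mul_assoc]
  generalize Uᵀ * G * U = R at *
  have hdiag (i : Fin 4) : 4 ≤ R i i ∧ Even (R i i) := by
    have h1 := hev' (Pi.single i 1)
    have h2 := hmin' (Pi.single i 1) (by simp)
    rw [intBil_single] at h1 h2
    exact ⟨h2, h1⟩
  have hH := hG'.intSchur hs'
  have hHs := intSchur_isSymm hs'
  have hK := hH.intSchur hHs
  have hKs := intSchur_isSymm hHs
  have hbound := IsHKZReduced.hkzConstant_mul_pow_le 1 hred hs' hG'
  -- the determinants `1` and `11` are too small for the minimum `4`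
  have ha : R 0 0 = 4 ∧ R.det = 121 := by
    norm_num [hkzConstant] at hbound
    have h1 : R 0 0 ^ 4 ≤ 4 * R.det := by
      have : (R 0 0 : ℚ) ^ 4 ≤ 4 * R.det := by linarith
      exact_mod_cast this
    have h2 : 4 ^ 4 ≤ R 0 0 ^ 4 := pow_le_pow_left₀ (by norm_num) (hdiag 0).1 4
    have h3 : R.det = 121 := by
      have h4 := (Nat.dvd_prime_pow (by norm_num : Nat.Prime 11) (m := 2)).1
        (Int.natAbs_dvd_natAbs.2 hd')
      obtain ⟨k, hk, h5⟩ := h4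
      interval_cases k <;> omega
    refine ⟨?_, h3⟩
    have h5 : R 0 0 < 5 := by
      by_contra! h
      have := pow_le_pow_left₀ (by norm_num) h 4
      omega
    have := (hdiag 0).1
    omega
  obtain ⟨ha, hdet⟩ := ha
  have dH : R.intSchur.det = 1936 := by
    have := det_intSchur_mul hs'
    rw [ha, hdet] at this
    norm_num at this
    omega
  have dK : R.intSchur.intSchur.det = 1936 * R.intSchur 0 0 := by
    have := det_intSchur_mul hHs
    rw [dH, sq] at this
    have h0 := hH.zero_zero_pos.ne'
    exact mul_right_cancel₀ h0 (by linarith)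
  have h1 := hred.three_mul_sq_le hs' hG'
  have h2 := hred.2.2.three_mul_sq_le hHs hH
  have h3 := hred.2.2.2.2.three_mul_sq_le hKs hK
  have hl : R.intSchur.intSchur.intSchur 0 0 = 1936 * R.intSchur 0 0 := by
    rw [← dK, det_fin_two, intSchur, of_apply]
    have : R.intSchur.intSchur 1 0 = R.intSchur.intSchur 0 1 := hKs.apply 0 1
    rw [this]
    rfl
  rw [hl] at h3
  rw [ha] at h1
  have b1 := hred.2.1
  rw [ha] at b1
  have h12 : 2 * |R.intSchur 0 2| ≤ R.intSchur 0 0 := hred.2.2.2.1 1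
  have key := quaternary_diagonal_bounds (p := R 0 1) (r := R 0 2) (s := R 0 3) (x := R 1 1)
    (y := R 2 2) (z := R 3 3) (h00 := R.intSchur 0 0)
    (h11 := R.intSchur 1 1) (h22 := R.intSchur 2 2) (h01 := R.intSchur 0 1)
    (h02 := R.intSchur 0 2) (k00 := R.intSchur.intSchur 0 0)
    (k11 := R.intSchur.intSchur 1 1) (k01 := R.intSchur.intSchur 0 1)
    (by rw [← ha]; rfl) (by rw [← ha]; rfl) (by rw [← ha]; rfl) rfl rfl hl
    (b1 0) (b1 1) (b1 2) (hred.2.2.2.1 0) h12 (hred.2.2.2.2.2.1 0) h1 h2 h3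
    (hdiag 1).1 (hdiag 2).1 (hdiag 3).1 (hdiag 1).2 (hdiag 2).2 (hdiag 3).2
  obtain ⟨hx, hy, hz⟩ := key
  have hR : R = quaternaryGram (R 0 1) (R 0 2) (R 0 3) (R 1 2) (R 1 3) (R 2 3) (R 3 3) := by
    have e (i j) : R i j = R j i := hs'.apply j i
    ext i j
    fin_cases i <;> fin_cases j <;> simp [quaternaryGram, ha, hx, hy, e 1 0, e 2 0, e 3 0, e 2 1,
      e 3 1, e 3 2]
  -- `eᵢ ± eⱼ` has norm at least `4`
  have hpair (i j : Fin 4) (hij : i ≠ j) : 2 * |R i j| ≤ R i i + R j j - 4 := by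
    have e : R j i = R i j := hs'.apply i j
    have f (c : ℤ) : 4 ≤ R i i + 2 * c * R i j + c * c * R j j := by
      have := hmin' (Pi.single i 1 + c • Pi.single j 1) (fun h => by
        have := congrFun h i
        simp [hij] at this)
      simp only [intBil, mulVec_add, mulVec_smul, dotProduct_add, add_dotProduct, smul_dotProduct,
        dotProduct_smul, smul_eq_mul] at this
      change 4 ≤ R.intBil _ _ + c * R.intBil _ _ + c * (R.intBil _ _ + c * R.intBil _ _) at this
      simp only [intBil_single, e] at this
      linarith
    have f1 := f 1
    have f2 := f (-1)
    rcases abs_cases (R i j) with ⟨h, _⟩ | ⟨h, _⟩ <;> rw [h] <;> linarith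
  have hp : |R 0 1| ≤ 2 := by have := b1 0; change 2 * |R 0 1| ≤ 4 at this; omega
  have hs3 : |R 0 3| ≤ 2 := by have := b1 2; change 2 * |R 0 3| ≤ 4 at this; omega
  have hu : |R 1 3| ≤ 2 := by
    have e1 : R.intSchur 0 2 = 4 * R 1 3 - R 0 1 * R 0 3 := by rw [← ha]; rfl
    have e2 : R.intSchur 0 0 = 4 * R 1 1 - R 0 1 * R 0 1 := by rw [← ha]; rfl
    rw [e1, e2, hx] at h12
    rw [abs_le] at hp hs3
    obtain ⟨p1, p2⟩ := hp
    obtain ⟨q1, q2⟩ := hs3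
    generalize R 0 1 = p at *
    generalize R 0 3 = q at *
    have i1 := le_abs_self (4 * R 1 3 - p * q)
    have i2 := neg_abs_le (4 * R 1 3 - p * q)
    generalize |4 * R 1 3 - p * q| = w at *
    rw [abs_le]
    generalize R 1 3 = u at *
    clear * - h12 p1 p2 q1 q2 i1 i2
    interval_cases p <;> interval_cases q <;> omega
  have g02 := hpair 0 2 (by decide)
  have g12 := hpair 1 2 (by decide)
  have g23 := hpair 2 3 (by decide)
  obtain ⟨X, hX⟩ := exists_congr_quaternaryGram (p := R 0 1) (r := R 0 2) (s := R 0 3)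
    (t := R 1 2) (u := R 1 3) (v := R 2 3) hp (by omega) hs3 (by omega) hu (by omega) hz
    (by rw [← hR, hdet])
  exact ⟨X, by rw [hR]; exact hX, hdet⟩

end Matrix

/-! ### Modules over the ring of `p`-th cyclotomic integers -/

open Polynomial in
/-- Modulo the `p`-th cyclotomic polynomial, `p` and `(X - 1) ^ (p - 1)` divide each other. -/
theorem exists_cyclotomic_dvd_sub (p : ℕ) [hp : Fact p.Prime] :
    (∃ g : ℤ[X], cyclotomic p ℤ ∣ (X - 1) ^ (p - 1) - C (p : ℤ) * g) ∧
      ∃ w : ℤ[X], cyclotomic p ℤ ∣ C (p : ℤ) - (X - 1) ^ (p - 1) * w := by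
  obtain ⟨g, hg⟩ : C (p : ℤ) ∣ (X - 1) ^ (p - 1) - cyclotomic p ℤ := by
    rw [C_dvd_iff_dvd_coeff]
    intro i
    have h1 : ((X - 1) ^ (p - 1) - cyclotomic p ℤ).map (Int.castRingHom (ZMod p)) = 0 := by
      have := cyclotomic_mul_prime_eq_pow_of_not_dvd (ZMod p) (p := p) (n := 1)
        (by simpa using hp.out.ne_one)
      rw [one_mul, cyclotomic_one] at this
      simp [this]
    have h2 := congrArg (fun f => coeff f i) h1
    simp only [coeff_map, coeff_zero] at h2
    exact (ZMod.intCast_zmod_eq_zero_iff_dvd _ p).1 h2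
  have hp0 : (p : ℤ) ≠ 0 := by exact_mod_cast hp.out.ne_zero
  refine ⟨⟨g, 1, by rw [← hg]; ring⟩, ?_⟩
  -- `g` is congruent to `-1` modulo `X - 1`; invert it using the nilpotency of `X - 1` modulo `p`
  have hg1 : g.eval 1 = -1 := by
    have h := congrArg (eval 1) hg
    rw [eval_sub, eval_pow, eval_sub, eval_X, eval_one, sub_self, eval_one_cyclotomic_prime,
      zero_pow (Nat.sub_ne_zero_of_lt hp.out.one_lt), eval_mul, eval_C] at h
    exact mul_left_cancel₀ hp0 (by linarith)
  obtain ⟨v, hv⟩ : X - C 1 ∣ g + 1 := by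
    rw [dvd_iff_isRoot, IsRoot, eval_add, hg1, eval_one]
    norm_num
  rw [C_1] at hv
  set S := ∑ i ∈ Finset.range (p - 1), ((X - 1) * v) ^ i with hS
  have hS' : S * (1 - (X - 1) * v) = 1 - ((X - 1) * v) ^ (p - 1) := by
    rw [hS, mul_comm, mul_neg_geom_sum]
  refine ⟨C (p : ℤ) * v ^ (p - 1) - S, S, ?_⟩
  have e1 : (X - 1) ^ (p - 1) = cyclotomic p ℤ + C (p : ℤ) * ((X - 1) * v - 1) := by
    rw [← hv, add_sub_cancel_right, ← hg]
    ring
  rw [mul_pow] at hS'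
  linear_combination (-C (p : ℤ)) * hS' + S * e1

theorem LinearMap.card_quotient_range_eq_natAbs_det {M : Type*} [AddCommGroup M] [Module.Free ℤ M]
    [Module.Finite ℤ M] (f : M →ₗ[ℤ] M) (hf : Function.Injective f) :
    Nat.card (M ⧸ LinearMap.range f) = (LinearMap.det f).natAbs := by
  rw [← Submodule.natAbs_det_equiv (LinearMap.range f) (LinearEquiv.ofInjective f hf)]
  rfl

/-- If `1 + τ + ⋯ + τ ^ (p - 1) = 0` on a free module of rank `r`, then `r = k (p - 1)` and the
cokernel of `τ - 1` has order `p ^ k`. -/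
theorem exists_finrank_eq_of_geom_sum_eq_zero {N : Type*} [AddCommGroup N] [Module.Free ℤ N]
    [Module.Finite ℤ N] (p : ℕ) [hp : Fact p.Prime] (τ : Module.End ℤ N)
    (hτ : ∑ i ∈ Finset.range p, τ ^ i = 0) :
    ∃ k, Module.finrank ℤ N = k * (p - 1) ∧ Function.Injective (τ - 1 : Module.End ℤ N) ∧
      Nat.card (N ⧸ LinearMap.range (τ - 1 : Module.End ℤ N)) = p ^ k := by
  have hΦ : Polynomial.aeval τ (Polynomial.cyclotomic p ℤ) = 0 := by
    rw [Polynomial.cyclotomic_prime, map_sum]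
    simpa using hτ
  obtain ⟨⟨g, g', hg⟩, w, w', hw⟩ := exists_cyclotomic_dvd_sub p
  have hg1 := congrArg (Polynomial.aeval τ) hg
  have hw1 := congrArg (Polynomial.aeval τ) hw
  simp only [map_mul, hΦ, zero_mul, map_sub, map_pow, Polynomial.aeval_X, map_one,
    sub_eq_zero, Polynomial.aeval_C] at hg1 hw1
  set r := Module.finrank ℤ N
  have hdet : LinearMap.det (algebraMap ℤ (Module.End ℤ N) (p : ℤ)) = (p : ℤ) ^ r := by
    rw [Algebra.algebraMap_eq_smul_one, LinearMap.det_smul, map_one, mul_one]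
  have d1 := congrArg LinearMap.det hg1
  have d2 := congrArg LinearMap.det hw1
  rw [map_mul, map_pow, hdet] at d1 d2
  set d := LinearMap.det (τ - 1 : Module.End ℤ N)
  have hd : d.natAbs ^ (p - 1) = p ^ r := by
    apply Nat.dvd_antisymm
    · have : d ^ (p - 1) ∣ (p : ℤ) ^ r := ⟨_, d2⟩
      simpa [Int.natAbs_pow] using Int.natAbs_dvd_natAbs.2 this
    · have : (p : ℤ) ^ r ∣ d ^ (p - 1) := ⟨_, d1⟩
      simpa [Int.natAbs_pow] using Int.natAbs_dvd_natAbs.2 this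
  have hp1 : p - 1 ≠ 0 := Nat.sub_ne_zero_of_lt hp.out.one_lt
  obtain ⟨k, -, hk⟩ := (Nat.dvd_prime_pow hp.out).1 (hd ▸ dvd_pow_self d.natAbs hp1)
  have hinj : Function.Injective (τ - 1 : Module.End ℤ N) := by
    have hc : Commute ((τ - 1 : Module.End ℤ N) ^ (p - 1)) (Polynomial.aeval τ w) := by
      have := congrArg (Polynomial.aeval τ)
        (mul_comm ((Polynomial.X - 1 : Polynomial ℤ) ^ (p - 1)) w)
      simp only [map_mul, map_pow, map_sub, Polynomial.aeval_X, map_one] at this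
      exact this
    rw [hc.eq, ← Nat.succ_pred hp1, pow_succ, ← mul_assoc] at hw1
    rw [← LinearMap.ker_eq_bot, LinearMap.ker_eq_bot']
    intro x hx
    have := LinearMap.congr_fun hw1 x
    rw [Module.End.mul_apply, hx, map_zero, Module.algebraMap_end_apply] at this
    have hp0 : (p : ℤ) ≠ 0 := by exact_mod_cast hp.out.ne_zero
    exact (smul_eq_zero.1 this).resolve_left hp0
  refine ⟨k, ?_, hinj, ?_⟩
  · rw [hk, ← pow_mul] at hd
    exact (Nat.pow_right_injective hp.out.two_le hd).symm
  · rw [LinearMap.card_quotient_range_eq_natAbs_det _ hinj, hk]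

/-! ### Gram matrices and direct summands of unimodular lattices -/

section Gram

variable {M : Type*} [AddCommGroup M]

/-- The Gram matrix of a family of vectors. -/
def LinearMap.BilinForm.gramMatrix (b : LinearMap.BilinForm ℤ M) {r : ℕ} (e : Fin r → M) :
    Matrix (Fin r) (Fin r) ℤ :=
  Matrix.of fun i j => b (e i) (e j)

theorem LinearMap.BilinForm.gramMatrix_intBil (b : LinearMap.BilinForm ℤ M) {r : ℕ}
    (e : Fin r → M) (x y : Fin r → ℤ) :
    (b.gramMatrix e).intBil x y = b (∑ i, x i • e i) (∑ i, y i • e i) := by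
  simp only [Matrix.intBil, gramMatrix, dotProduct, Matrix.mulVec, Matrix.of_apply, map_sum,
    LinearMap.sum_apply, map_smul, LinearMap.smul_apply, smul_eq_mul, Finset.mul_sum]
  rw [Finset.sum_comm]
  exact Finset.sum_congr rfl fun i _ => Finset.sum_congr rfl fun j _ => by ring

theorem LinearMap.BilinForm.gramMatrix_isSymm {b : LinearMap.BilinForm ℤ M}
    (hb : ∀ x y, b x y = b y x) {r : ℕ} (e : Fin r → M) : (b.gramMatrix e).IsSymm := by
  ext i j
  exact hb _ _

theorem sum_smul_basis_ne_zero {A : Submodule ℤ M} {r : ℕ} (e : Module.Basis (Fin r) ℤ A)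
    {x : Fin r → ℤ} (hx : x ≠ 0) : ∑ i, x i • (e i : M) ≠ 0 := by
  intro h
  have h1 : ∑ i, x i • e i = 0 := by
    apply Subtype.ext
    push_cast
    exact h
  exact hx (funext (Fintype.linearIndependent_iff.1 e.linearIndependent x h1))

theorem LinearMap.BilinForm.gramMatrix_det_ne_zero {b : LinearMap.BilinForm ℤ M}
    (hpos : ∀ x, x ≠ 0 → 0 < b x x) {A : Submodule ℤ M} {r : ℕ} (e : Module.Basis (Fin r) ℤ A) :
    (b.gramMatrix fun i => (e i : M)).det ≠ 0 := by
  intro h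
  obtain ⟨x, hx, h0⟩ := Matrix.exists_mulVec_eq_zero_iff.2 h
  have h1 := hpos _ (sum_smul_basis_ne_zero e hx)
  rw [← gramMatrix_intBil, Matrix.intBil, h0, dotProduct_zero] at h1
  exact lt_irrefl _ h1

variable [Module.Free ℤ M] [Module.Finite ℤ M]

/-- For a unimodular form, the index of `A ⊕ Aᗮ` is the determinant of `A`, if `A` is the kernel of
an endomorphism (hence a direct summand). -/
theorem LinearMap.BilinForm.card_quotient_sup_eq_natAbs_det {b : LinearMap.BilinForm ℤ M}
    (hb : ∀ x y, b x y = b y x) (hpos : ∀ x, x ≠ 0 → 0 < b x x)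
    (hdual : ∀ f : M →ₗ[ℤ] ℤ, ∃ y, ∀ x, b y x = f x) (f : Module.End ℤ M) {A B : Submodule ℤ M}
    (hA : A = LinearMap.ker f) (hB : ∀ y, y ∈ B ↔ ∀ a ∈ A, b y a = 0)
    {r : ℕ} (e : Module.Basis (Fin r) ℤ A) :
    Nat.card (M ⧸ A ⊔ B) = (b.gramMatrix fun i => (e i : M)).det.natAbs := by
  subst hA
  -- `Ψ` maps `M` onto the dual of `A`, with kernel `B`, and `A` onto the column space of the Gram matrix
  let Ψ : M →ₗ[ℤ] (Fin r → ℤ) := LinearMap.pi fun i => (b.flip (e i : M))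
  have hΨ (y : M) (i : Fin r) : Ψ y i = b y (e i) := rfl
  have hsurj : Function.Surjective Ψ := by
    intro c
    obtain ⟨s, hs⟩ := Module.projective_lifting_property f.rangeRestrict LinearMap.id
      f.surjective_rangeRestrict
    let ρ : M →ₗ[ℤ] LinearMap.ker f := (LinearMap.id - s ∘ₗ f.rangeRestrict).codRestrict _ fun x => by
      have h := congrArg Subtype.val (LinearMap.congr_fun hs (f.rangeRestrict x))
      simp only [LinearMap.comp_apply, LinearMap.id_apply, LinearMap.codRestrict_apply,
        LinearMap.rangeRestrict] at h
      rw [LinearMap.mem_ker, LinearMap.sub_apply, map_sub, sub_eq_zero]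
      exact h.symm
    have hρ (a : LinearMap.ker f) : ρ a = a := by
      apply Subtype.ext
      have h0 : f.rangeRestrict (a : M) = 0 := Subtype.ext a.2
      simp [ρ, h0]
    obtain ⟨y, hy⟩ := hdual (e.constr ℤ c ∘ₗ ρ)
    refine ⟨y, funext fun i => ?_⟩
    rw [hΨ, hy, LinearMap.comp_apply, hρ, e.constr_basis]
  set G := b.gramMatrix fun i => (e i : M) with hG
  have hGe (x : Fin r → ℤ) : Matrix.toLin' G x = Ψ (∑ i, x i • (e i : M)) := by
    funext j
    rw [hΨ, Matrix.toLin'_apply]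
    simp only [hG, gramMatrix, Matrix.mulVec, dotProduct, Matrix.of_apply, map_sum,
      LinearMap.sum_apply, map_smul, LinearMap.smul_apply, smul_eq_mul]
    exact Finset.sum_congr rfl fun i _ => by rw [hb, mul_comm]
  let R := LinearMap.range (Matrix.toLin' G)
  have hker : LinearMap.ker (R.mkQ ∘ₗ Ψ) = LinearMap.ker f ⊔ B := by
    ext y
    rw [LinearMap.mem_ker, LinearMap.comp_apply, Submodule.mkQ_apply, Submodule.Quotient.mk_eq_zero,
      Submodule.mem_sup]
    constructor
    · rintro ⟨x, hx⟩
      rw [hGe] at hx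
      refine ⟨∑ i, x i • (e i : M), ?_, y - ∑ i, x i • (e i : M), (hB _).2 fun a ha => ?_, by abel⟩
      · exact Submodule.sum_mem _ fun i _ => Submodule.smul_mem _ _ (e i).2
      · have h0 (i : Fin r) : b (y - ∑ i, x i • (e i : M)) (e i) = 0 := by
          rw [← hΨ, map_sub, hx, sub_self, Pi.zero_apply]
        have ha' : a = ∑ i, e.repr ⟨a, ha⟩ i • (e i : M) := by
          have := congrArg Subtype.val (e.sum_repr ⟨a, ha⟩)
          push_cast at this
          exact this.symm
        rw [ha', map_sum]
        exact Finset.sum_eq_zero fun i _ => by rw [map_smul, h0, smul_zero]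
    · rintro ⟨a, ha, z, hz, rfl⟩
      have hz0 : Ψ z = 0 := funext fun i => (hB z).1 hz _ (e i).2
      refine ⟨e.repr ⟨a, ha⟩, ?_⟩
      have := congrArg Subtype.val (e.sum_repr ⟨a, ha⟩)
      push_cast at this
      rw [hGe, map_add, hz0, add_zero, this]
  have hinj : Function.Injective (Matrix.toLin' G) := by
    rw [← LinearMap.ker_eq_bot, LinearMap.ker_eq_bot']
    intro x hx
    by_contra hx0
    exact gramMatrix_det_ne_zero hpos e (Matrix.exists_mulVec_eq_zero_iff.1 ⟨x, hx0, hx⟩)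
  rw [← hker, Nat.card_congr ((R.mkQ ∘ₗ Ψ).quotKerEquivOfSurjective
    (R.mkQ_surjective.comp hsurj)).toEquiv, LinearMap.card_quotient_range_eq_natAbs_det _ hinj,
    LinearMap.det_toLin']

end Gram

/-! ### The fixed lattice of an automorphism of prime order -/

section Automorphism

variable {M : Type*} [AddCommGroup M] {b : LinearMap.BilinForm ℤ M} {σ : Module.End ℤ M} {p : ℕ}

/-- The sublattice on which `1 + σ + ⋯ + σ ^ (p - 1)` vanishes. -/
def traceKernel (p : ℕ) (σ : Module.End ℤ M) : Submodule ℤ M :=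
  LinearMap.ker (∑ i ∈ Finset.range p, σ ^ i)

/-- The sublattice of fixed vectors. -/
def fixedVectors (σ : Module.End ℤ M) : Submodule ℤ M :=
  LinearMap.ker (σ - 1)

theorem mem_fixedVectors {x : M} : x ∈ fixedVectors σ ↔ σ x = x := by
  simp [fixedVectors, sub_eq_zero]

theorem pow_apply_of_mem_fixedVectors {x : M} (hx : x ∈ fixedVectors σ)
    (i : ℕ) : (σ ^ i) x = x := by
  induction i with
  | zero => simp
  | succ i ih => rw [pow_succ, Module.End.mul_apply, mem_fixedVectors.1 hx, ih]

theorem geom_sum_apply_of_mem_fixedVectors {x : M} (hx : x ∈ fixedVectors σ)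
    (p : ℕ) : (∑ i ∈ Finset.range p, σ ^ i) x = p • x := by
  simp [LinearMap.sum_apply, pow_apply_of_mem_fixedVectors hx]

theorem sub_one_apply_mem_traceKernel (hσ : σ ^ p = 1) (y : M) :
    (σ - 1) y ∈ traceKernel p σ := by
  rw [traceKernel, LinearMap.mem_ker, ← Module.End.mul_apply, geom_sum_mul, hσ, sub_self,
    LinearMap.zero_apply]

theorem apply_mem_traceKernel {y : M} (hy : y ∈ traceKernel p σ) :
    σ y ∈ traceKernel p σ := by
  rw [traceKernel, LinearMap.mem_ker] at hy ⊢
  have hc : Commute (∑ i ∈ Finset.range p, σ ^ i) σ :=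
    Commute.sum_left _ _ _ fun i _ => Commute.pow_self σ i
  rw [← Module.End.mul_apply, hc.eq, Module.End.mul_apply, hy, map_zero]

theorem geom_sum_apply_mem_fixedVectors (hσ : σ ^ p = 1) (y : M) :
    (∑ i ∈ Finset.range p, σ ^ i) y ∈ fixedVectors σ := by
  rw [fixedVectors, LinearMap.mem_ker, ← Module.End.mul_apply, mul_geom_sum, hσ, sub_self,
    LinearMap.zero_apply]

theorem map_pow_eq (hσb : ∀ x y, b (σ x) (σ y) = b x y) (i : ℕ) (x y : M) :
    b ((σ ^ i) x) ((σ ^ i) y) = b x y := by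
  induction i generalizing x y with
  | zero => simp
  | succ i ih => rw [pow_succ, Module.End.mul_apply, Module.End.mul_apply, ih, hσb]

theorem map_geom_sum_apply_of_mem_fixedVectors (hσb : ∀ x y, b (σ x) (σ y) = b x y) {l : M}
    (hl : l ∈ fixedVectors σ) (y : M) :
    b ((∑ i ∈ Finset.range p, σ ^ i) y) l = p * b y l := by
  have h (i : ℕ) : b ((σ ^ i) y) l = b y l := by
    conv_lhs => rw [← pow_apply_of_mem_fixedVectors hl i]
    exact map_pow_eq hσb i y l
  simp [LinearMap.sum_apply, map_sum, h]

/-- The trace kernel is the orthogonal complement of the lattice of fixed vectors. -/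
theorem mem_traceKernel_iff (hpos : ∀ x, x ≠ 0 → 0 < b x x) (hp : p ≠ 0) (hσ : σ ^ p = 1)
    (hσb : ∀ x y, b (σ x) (σ y) = b x y) (y : M) :
    y ∈ traceKernel p σ ↔ ∀ l ∈ fixedVectors σ, b y l = 0 := by
  have hp' : (p : ℤ) ≠ 0 := by exact_mod_cast hp
  constructor
  · intro hy l hl
    have h := map_geom_sum_apply_of_mem_fixedVectors (p := p) hσb hl y
    rw [LinearMap.mem_ker.1 hy, map_zero, LinearMap.zero_apply] at h
    exact (mul_eq_zero.1 h.symm).resolve_left hp'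
  · intro h
    have h1 := geom_sum_apply_mem_fixedVectors hσ y
    have h2 := map_geom_sum_apply_of_mem_fixedVectors (p := p) hσb h1 y
    rw [h _ h1, mul_zero] at h2
    rw [traceKernel, LinearMap.mem_ker]
    by_contra h3
    exact (hpos _ h3).ne' h2

/-- The lattice of fixed vectors is the orthogonal complement of the trace kernel. -/
theorem mem_fixedVectors_iff (hb : ∀ x y, b x y = b y x) (hpos : ∀ x, x ≠ 0 → 0 < b x x)
    (hp : p ≠ 0) (hσ : σ ^ p = 1) (hσb : ∀ x y, b (σ x) (σ y) = b x y) (y : M) :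
    y ∈ fixedVectors σ ↔ ∀ n ∈ traceKernel p σ, b y n = 0 := by
  constructor
  · intro hy n hn
    rw [hb]
    exact (mem_traceKernel_iff hpos hp hσ hσb n).1 hn y hy
  · intro h
    -- `|σ y - y|² = -2 b(y, σ y - y)`
    have h1 := h _ (sub_one_apply_mem_traceKernel hσ y)
    rw [mem_fixedVectors, ← sub_eq_zero]
    by_contra h3
    have h4 := hpos _ h3
    simp only [LinearMap.sub_apply, Module.End.one_apply, map_sub] at h1 h4
    rw [hσb, hb (σ y) y] at h4
    linarith

variable [Module.Free ℤ M] [Module.Finite ℤ M]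

theorem finrank_fixedVectors_add (hp : p ≠ 0) (hσ : σ ^ p = 1) :
    Module.finrank ℤ (fixedVectors σ) + Module.finrank ℤ (traceKernel p σ) =
      Module.finrank ℤ M := by
  set T := ∑ i ∈ Finset.range p, σ ^ i with hT
  have h1 := (LinearMap.ker T).finrank_quotient_add_finrank
  rw [T.quotKerEquivRange.finrank_eq] at h1
  change _ + Module.finrank ℤ (traceKernel p σ) = _ at h1
  suffices h : Module.finrank ℤ (LinearMap.range T) = Module.finrank ℤ (fixedVectors σ) by
    rw [← h, h1]
  apply le_antisymm
  · apply Submodule.finrank_mono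
    rintro _ ⟨y, rfl⟩
    exact geom_sum_apply_mem_fixedVectors hσ y
  · refine LinearMap.finrank_le_finrank_of_injective
      (f := (T.restrict (p := fixedVectors σ) (q := LinearMap.range T) fun x _ => ⟨x, rfl⟩)) ?_
    rintro ⟨x, hx⟩ ⟨y, hy⟩ hxy
    have := congrArg Subtype.val hxy
    change T x = T y at this
    rw [hT, geom_sum_apply_of_mem_fixedVectors hx, geom_sum_apply_of_mem_fixedVectors hy] at this
    rw [← Nat.cast_smul_eq_nsmul ℤ, ← Nat.cast_smul_eq_nsmul ℤ] at this
    exact Subtype.ext (smul_right_injective M (Nat.cast_ne_zero.2 hp) this)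

/-- For an automorphism `σ ≠ 1` of prime order `p`, the lattice `traceKernel p σ` has rank
`k (p - 1)` with `k ≠ 0`, and the index of `fixedVectors σ ⊔ traceKernel p σ` divides `p ^ k`. -/
theorem exists_finrank_traceKernel_eq [hp : Fact p.Prime] (hσ : σ ^ p = 1) (hσ1 : σ ≠ 1) :
    ∃ k, k ≠ 0 ∧ Module.finrank ℤ (traceKernel p σ) = k * (p - 1) ∧
      Nat.card (M ⧸ fixedVectors σ ⊔ traceKernel p σ) ∣ p ^ k := by
  let τ : Module.End ℤ (traceKernel p σ) := σ.restrict fun _ => apply_mem_traceKernel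
  have hτi (i : ℕ) (x : traceKernel p σ) : (((τ ^ i) x : traceKernel p σ) : M) = (σ ^ i) x := by
    induction i generalizing x with
    | zero => simp
    | succ i ih =>
      rw [pow_succ, pow_succ, Module.End.mul_apply, Module.End.mul_apply, ih]
      rfl
  have hτ : ∑ i ∈ Finset.range p, τ ^ i = 0 := by
    ext x
    have h := LinearMap.mem_ker.1 x.2
    rw [LinearMap.sum_apply] at h
    simp only [LinearMap.sum_apply, LinearMap.zero_apply, Submodule.coe_sum, hτi,
      ZeroMemClass.coe_zero]
    exact h
  obtain ⟨k, hk, -, hcard⟩ := exists_finrank_eq_of_geom_sum_eq_zero p τ hτ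
  refine ⟨k, ?_, hk, ?_⟩
  · rintro rfl
    rw [zero_mul] at hk
    have hbot : traceKernel p σ = ⊥ := Submodule.finrank_eq_zero.1 hk
    apply hσ1
    ext y
    have := sub_one_apply_mem_traceKernel hσ y
    rw [hbot, Submodule.mem_bot, LinearMap.sub_apply, sub_eq_zero] at this
    exact this
  · rw [← hcard]
    let R := LinearMap.range (τ - 1 : Module.End ℤ (traceKernel p σ))
    let φ : M →ₗ[ℤ] (traceKernel p σ ⧸ R) := R.mkQ ∘ₗ
      (σ - 1 : Module.End ℤ M).codRestrict _ (sub_one_apply_mem_traceKernel hσ)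
    have hker : LinearMap.ker φ = fixedVectors σ ⊔ traceKernel p σ := by
      ext y
      rw [LinearMap.mem_ker, LinearMap.comp_apply, Submodule.mkQ_apply,
        Submodule.Quotient.mk_eq_zero, Submodule.mem_sup]
      constructor
      · rintro ⟨n, hn⟩
        refine ⟨y - n, ?_, n, n.2, by abel⟩
        have := congrArg Subtype.val hn
        rw [fixedVectors, LinearMap.mem_ker, map_sub, sub_eq_zero]
        exact this.symm
      · rintro ⟨l, hl, n, hn, rfl⟩
        refine ⟨⟨n, hn⟩, Subtype.ext ?_⟩
        rw [fixedVectors, LinearMap.mem_ker] at hl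
        rw [LinearMap.codRestrict_apply, map_add, hl, zero_add]
        rfl
    rw [← hker, Nat.card_congr φ.quotKerEquivRange.toEquiv]
    exact AddSubgroup.card_addSubgroup_dvd_card (LinearMap.range φ).toAddSubgroup

/-- An automorphism of prime order `p` of a unimodular lattice splits it, up to index dividing
`p ^ k`, into the fixed lattice and its complement, the trace kernel, of rank `k (p - 1)`; the index
is the determinant of either summand. -/
theorem det_gramMatrix_dvd_pow [hp : Fact p.Prime] (hb : ∀ x y, b x y = b y x)
    (hpos : ∀ x, x ≠ 0 → 0 < b x x) (hdual : ∀ f : M →ₗ[ℤ] ℤ, ∃ y, ∀ x, b y x = f x)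
    (hσ : σ ^ p = 1) (hσ1 : σ ≠ 1) (hσb : ∀ x y, b (σ x) (σ y) = b x y) :
    ∃ k, k ≠ 0 ∧ Module.finrank ℤ (fixedVectors σ) + k * (p - 1) = Module.finrank ℤ M ∧
      Module.finrank ℤ (traceKernel p σ) = k * (p - 1) ∧
      (∀ {r : ℕ} (e : Module.Basis (Fin r) ℤ (fixedVectors σ)),
        (b.gramMatrix fun i => (e i : M)).det ∣ (p : ℤ) ^ k) ∧
      ∀ {r : ℕ} (e : Module.Basis (Fin r) ℤ (traceKernel p σ)),
        (b.gramMatrix fun i => (e i : M)).det ∣ (p : ℤ) ^ k := by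
  obtain ⟨k, hk0, hk, hcard⟩ := exists_finrank_traceKernel_eq hσ hσ1
  have hp0 := hp.out.ne_zero
  refine ⟨k, hk0, by rw [← hk, finrank_fixedVectors_add hp0 hσ], hk, fun e => ?_, fun e => ?_⟩
  · rw [LinearMap.BilinForm.card_quotient_sup_eq_natAbs_det (A := fixedVectors σ) hb hpos hdual _ rfl
      (mem_traceKernel_iff hpos hp0 hσ hσb) e] at hcard
    exact Int.natAbs_dvd_natAbs.1 (by simpa [Int.natAbs_pow] using hcard)
  · rw [sup_comm, LinearMap.BilinForm.card_quotient_sup_eq_natAbs_det (A := traceKernel p σ) hb hpos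
      hdual _ rfl
      (mem_fixedVectors_iff hb hpos hp0 hσ hσb) e] at hcard
    exact Int.natAbs_dvd_natAbs.1 (by simpa [Int.natAbs_pow] using hcard)

end Automorphism

/-! ### Automorphisms of even unimodular lattices without roots -/

section Automorphism

variable {M : Type*} [AddCommGroup M] {b : LinearMap.BilinForm ℤ M} {σ : Module.End ℤ M} {p : ℕ}

/-- A change of basis by an integral matrix of unit determinant. -/
theorem exists_basis_gramMatrix_eq {A : Submodule ℤ M} {r : ℕ} (e : Module.Basis (Fin r) ℤ A)
    {U G : Matrix (Fin r) (Fin r) ℤ} (hU : IsUnit U.det)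
    (hG : U.transpose * b.gramMatrix (fun i => (e i : M)) * U = G) :
    ∃ e' : Module.Basis (Fin r) ℤ A, b.gramMatrix (fun i => (e' i : M)) = G := by
  refine ⟨e.map (Matrix.toLinearEquiv e U hU), ?_⟩
  have h (j : Fin r) : ((e.map (Matrix.toLinearEquiv e U hU)) j : M) = ∑ i, U i j • (e i : M) := by
    rw [Module.Basis.map_apply, Matrix.toLinearEquiv_apply, Matrix.toLin_self]
    push_cast
    rfl
  ext i j
  rw [← hG, Matrix.congr_apply, LinearMap.BilinForm.gramMatrix_intBil]
  simp only [LinearMap.BilinForm.gramMatrix, Matrix.of_apply, h, Matrix.col_apply]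

variable [Module.Free ℤ M] [Module.Finite ℤ M]

/-- In an even unimodular lattice of rank `24` without roots, the fixed lattice of an automorphism
of order `23` has rank `2` and determinant dividing `23`, which determines it. -/
theorem exists_basis_fixedVectors_of_order_twentyThree (hb : ∀ x y, b x y = b y x)
    (hev : ∀ x, Even (b x x)) (hmin : ∀ x, x ≠ 0 → 4 ≤ b x x)
    (hdual : ∀ f : M →ₗ[ℤ] ℤ, ∃ y, ∀ x, b y x = f x) (hM : Module.finrank ℤ M = 24)
    (hσ : σ ^ 23 = 1) (hσ1 : σ ≠ 1) (hσb : ∀ x y, b (σ x) (σ y) = b x y) :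
    ∃ e : Module.Basis (Fin 2) ℤ (fixedVectors σ),
      b.gramMatrix (fun i => (e i : M)) = !![4, 1; 1, 6] := by
  have : Fact (Nat.Prime 23) := ⟨by norm_num⟩
  have hpos (x : M) (hx : x ≠ 0) : 0 < b x x := lt_of_lt_of_le (by norm_num) (hmin x hx)
  obtain ⟨k, hk0, hk, -, hd, -⟩ := det_gramMatrix_dvd_pow hb hpos hdual hσ hσ1 hσb
  obtain rfl : k = 1 := by omega
  let e := Module.finBasisOfFinrankEq ℤ (fixedVectors σ) (n := 2) (by omega)
  have h0 := hd e
  rw [pow_one] at h0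
  obtain ⟨U, hU, h⟩ := Matrix.exists_congr_binary (LinearMap.BilinForm.gramMatrix_isSymm hb _)
    (fun x => by rw [LinearMap.BilinForm.gramMatrix_intBil]; exact hev _)
    (fun x hx => by
      rw [LinearMap.BilinForm.gramMatrix_intBil]; exact hmin _ (sum_smul_basis_ne_zero e hx)) h0
  exact exists_basis_gramMatrix_eq e hU h

/-- In an even unimodular lattice of rank `24` without roots, the fixed lattice of an automorphism
of order `11` has rank `4` and determinant dividing `121`, which determines it: otherwise its rank is `14`, and the orthogonal complement is a lattice
of rank `10`, determinant at most `11` and minimum at least `4`, which does not exist. -/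
theorem exists_basis_fixedVectors_of_order_eleven (hb : ∀ x y, b x y = b y x)
    (hev : ∀ x, Even (b x x)) (hmin : ∀ x, x ≠ 0 → 4 ≤ b x x)
    (hdual : ∀ f : M →ₗ[ℤ] ℤ, ∃ y, ∀ x, b y x = f x) (hM : Module.finrank ℤ M = 24)
    (hσ : σ ^ 11 = 1) (hσ1 : σ ≠ 1) (hσb : ∀ x y, b (σ x) (σ y) = b x y) :
    ∃ e : Module.Basis (Fin 4) ℤ (fixedVectors σ),
      b.gramMatrix (fun i => (e i : M)) = !![4, 2, 1, 0; 2, 4, 1, 1; 1, 1, 4, 2; 0, 1, 2, 4] := by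
  have : Fact (Nat.Prime 11) := ⟨by norm_num⟩
  have hpos (x : M) (hx : x ≠ 0) : 0 < b x x := lt_of_lt_of_le (by norm_num) (hmin x hx)
  obtain ⟨k, hk0, hk, hk', hd, hd'⟩ := det_gramMatrix_dvd_pow hb hpos hdual hσ hσ1 hσb
  obtain rfl | rfl : k = 1 ∨ k = 2 := by omega
  · let e := Module.finBasisOfFinrankEq ℤ (traceKernel 11 σ) (n := 10) (by omega)
    obtain ⟨x, hx0, hx⟩ := Matrix.IntPosDef.exists_lt_four
      (G := b.gramMatrix fun i => (e i : M))
      (fun x hx => by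
        rw [LinearMap.BilinForm.gramMatrix_intBil]; exact hpos _ (sum_smul_basis_ne_zero e hx))
      (LinearMap.BilinForm.gramMatrix_isSymm hb _)
      ((Int.le_of_dvd (by norm_num) (hd' e)).trans (by norm_num))
    rw [LinearMap.BilinForm.gramMatrix_intBil] at hx
    exact absurd (hmin _ (sum_smul_basis_ne_zero e hx0)) (not_le.2 hx)
  · let e := Module.finBasisOfFinrankEq ℤ (fixedVectors σ) (n := 4) (by omega)
    have h0 := hd e
    norm_num at h0
    obtain ⟨U, hU, h⟩ := Matrix.exists_congr_quaternary (LinearMap.BilinForm.gramMatrix_isSymm hb _)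
      (fun x => by rw [LinearMap.BilinForm.gramMatrix_intBil]; exact hev _)
      (fun x hx => by
        rw [LinearMap.BilinForm.gramMatrix_intBil]; exact hmin _ (sum_smul_basis_ne_zero e hx)) h0
    exact exists_basis_gramMatrix_eq e hU h

/-- The order of the finite automorphism group of a lattice of rank less than `p - 1` is not
divisible by the prime `p`: on the trace kernel of an automorphism of order `p`, it acts through the
`p`-th cyclotomic integers, a ring of rank `p - 1`. -/
theorem Matrix.not_dvd_ncard_isometries [hp : Fact p.Prime] {n : ℕ} (hn : n < p - 1)
    {G : Matrix (Fin n) (Fin n) ℤ} (hG : G.det ≠ 0)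
    (hfin : {X : Matrix (Fin n) (Fin n) ℤ | X.transpose * G * X = G}.Finite) :
    ¬ p ∣ {X : Matrix (Fin n) (Fin n) ℤ | X.transpose * G * X = G}.ncard := by
  intro hdvd
  let H : Subgroup (Matrix (Fin n) (Fin n) ℤ)ˣ :=
    { carrier := {X | (X : Matrix (Fin n) (Fin n) ℤ).transpose * G * X = G}
      one_mem' := by simp
      mul_mem' := by
        intro X Y (hX : _ = _) (hY : _ = _)
        change ((X * Y : (Matrix (Fin n) (Fin n) ℤ)ˣ) : Matrix (Fin n) (Fin n) ℤ).transpose *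
          G * _ = G
        rw [Units.val_mul, Matrix.transpose_mul]
        calc _ = (Y : Matrix (Fin n) (Fin n) ℤ).transpose *
              ((X : Matrix (Fin n) (Fin n) ℤ).transpose * G * X) * Y := by
                simp only [Matrix.mul_assoc]
          _ = G := by rw [hX, hY]
      inv_mem' := by
        intro X (hX : _ = _)
        change _ * _ * _ = _
        conv_lhs => rw [← hX]
        have h1 : (X : Matrix (Fin n) (Fin n) ℤ) * ((X⁻¹ : (Matrix (Fin n) (Fin n) ℤ)ˣ) :
          Matrix (Fin n) (Fin n) ℤ) = 1 := X.mul_inv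
        calc _ = ((X : Matrix (Fin n) (Fin n) ℤ) * ((X⁻¹ : (Matrix (Fin n) (Fin n) ℤ)ˣ) :
              Matrix (Fin n) (Fin n) ℤ)).transpose * G * ((X : Matrix (Fin n) (Fin n) ℤ) *
                ((X⁻¹ : (Matrix (Fin n) (Fin n) ℤ)ˣ) : Matrix (Fin n) (Fin n) ℤ)) := by
              simp only [Matrix.transpose_mul, Matrix.mul_assoc]
          _ = G := by rw [h1]; simp }
  have φ : H ≃ {X : Matrix (Fin n) (Fin n) ℤ | X.transpose * G * X = G} :=
    { toFun := fun X => ⟨X.1, X.2⟩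
      invFun := fun X => ⟨Matrix.nonsingInvUnit X.1
        (Matrix.isUnit_det_of_congr X.2 rfl hG), X.2⟩
      left_inv := fun X => Subtype.ext (Units.ext rfl)
      right_inv := fun X => Subtype.ext rfl }
  have hf : Finite {X : Matrix (Fin n) (Fin n) ℤ | X.transpose * G * X = G} := hfin
  have hf' : Finite H := Finite.of_equiv _ φ.symm
  rw [← Nat.card_coe_set_eq, ← Nat.card_congr φ] at hdvd
  obtain ⟨X, hX⟩ := exists_prime_orderOf_dvd_card' p hdvd
  have hX1 : X ≠ 1 := by
    rintro rfl
    rw [orderOf_one] at hX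
    exact hp.out.ne_one hX.symm
  have hXp := pow_orderOf_eq_one X
  rw [hX] at hXp
  let f := (Matrix.toLinAlgEquiv' : Matrix (Fin n) (Fin n) ℤ ≃ₐ[ℤ] _)
  have hXp' : (X.1 : Matrix (Fin n) (Fin n) ℤ) ^ p = 1 := by
    have := congrArg (fun Y : H => (Y.1 : Matrix (Fin n) (Fin n) ℤ)) hXp
    simpa using this
  obtain ⟨k, hk0, hk, -⟩ := exists_finrank_traceKernel_eq (p := p) (σ := f X.1)
    (by rw [← map_pow, hXp', map_one])
    (fun h => hX1 (Subtype.ext (Units.ext (f.injective (by rw [h]; simp)))))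
  have h1 := Submodule.finrank_le (traceKernel p (f X.1))
  rw [hk, Module.finrank_fin_fun] at h1
  have := Nat.le_mul_of_pos_left (p - 1) (Nat.pos_of_ne_zero hk0)
  omega

end Automorphism

/-! ### Theta series and their Fourier expansions -/

/-- A product of summable families of nonnegative numbers is summable over integral vectors. -/
theorem summable_prod_int {κ : Type*} [Fintype κ] {f : ℤ → ℝ} (hf0 : ∀ m, 0 ≤ f m)
    (hf : Summable f) : Summable fun x : κ → ℤ => ∏ k, f (x k) := by
  classical
  refine summable_of_sum_le (c := (∑' m, f m) ^ Fintype.card κ)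
    (fun x => Finset.prod_nonneg fun k _ => hf0 _) fun s => ?_
  -- a finite set of vectors is contained in a box
  let t : Finset ℤ := Finset.univ.biUnion fun k => s.image fun x => x k
  have hst : s ⊆ Fintype.piFinset fun _ : κ => t := fun x hx =>
    Fintype.mem_piFinset.2 fun k => Finset.mem_biUnion.2
      ⟨k, Finset.mem_univ _, Finset.mem_image_of_mem (fun x : κ → ℤ => x k) hx⟩
  calc ∑ x ∈ s, ∏ k, f (x k) ≤ ∑ x ∈ Fintype.piFinset fun _ : κ => t, ∏ k, f (x k) :=
        Finset.sum_le_sum_of_subset_of_nonneg hst fun x _ _ => Finset.prod_nonneg fun k _ => hf0 _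
    _ = ∏ _k : κ, ∑ m ∈ t, f m := Finset.sum_prod_piFinset t fun _ => f
    _ = (∑ m ∈ t, f m) ^ Fintype.card κ := by rw [Finset.prod_const, Finset.card_univ]
    _ ≤ _ := by
        gcongr
        · exact Finset.sum_nonneg fun m _ => hf0 m
        · exact hf.sum_le_tsum t fun m _ => hf0 m

theorem summable_exp_neg_mul_sq {d : ℝ} (hd : 0 < d) :
    Summable fun m : ℤ => Real.exp (-d * (m : ℝ) ^ 2) := by
  have h := summable_pow_mul_jacobiTheta₂_term_bound 0 (T := d / Real.pi) (by positivity) 0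
  refine h.congr fun m => ?_
  have := Real.pi_ne_zero
  rw [pow_zero, one_mul]
  congr 1
  field_simp
  simp

/-- A positive definite real quadratic form is bounded below by a multiple of the sum of squares. -/
theorem Matrix.PosDef.exists_mul_sum_sq_le {n : ℕ} {Y : Matrix (Fin n) (Fin n) ℝ}
    (hY : Y.PosDef) : ∃ c > 0, ∀ v : Fin n → ℝ, c * ∑ i, v i ^ 2 ≤ v ⬝ᵥ Y *ᵥ v := by
  let S : Set (Fin n → ℝ) := {v | ∑ i, v i ^ 2 = 1}
  have hS : IsCompact S := by
    refine (isCompact_univ_pi fun _ : Fin n =>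
      isCompact_Icc (a := (-1 : ℝ)) (b := 1)).of_isClosed_subset (isClosed_eq (by fun_prop) continuous_const) fun v (hv : _ = _) i _ => ?_
    have h := Finset.single_le_sum (f := fun i => v i ^ 2) (fun i _ => sq_nonneg (v i))
      (Finset.mem_univ i)
    rw [hv] at h
    exact abs_le.1 ((sq_le_one_iff_abs_le_one _).1 h)
  have hpos {v : Fin n → ℝ} (hv : v ≠ 0) : 0 < v ⬝ᵥ Y *ᵥ v := by
    simpa using hY.dotProduct_mulVec_pos hv
  rcases S.eq_empty_or_nonempty with hE | hne
  · refine ⟨1, one_pos, fun v => ?_⟩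
    -- without unit vectors, there are no nonzero vectors
    have hv : v = 0 := by
      by_contra h0
      obtain ⟨i, hi⟩ := Function.ne_iff.1 h0
      have h1 : (Pi.single i 1 : Fin n → ℝ) ∈ S := by simp [S, Pi.single_apply]
      rw [hE] at h1
      exact h1
    simp [hv]
  · obtain ⟨u, hu, hmin⟩ := hS.exists_isMinOn hne
      (f := fun v : Fin n → ℝ => v ⬝ᵥ Y *ᵥ v) (by fun_prop)
    have hu0 : u ≠ 0 := by
      rintro rfl
      simp [S] at hu
    refine ⟨_, hpos hu0, fun v => ?_⟩
    by_cases hv : v = 0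
    · simp [hv]
    have hs : 0 < ∑ i, v i ^ 2 := by
      obtain ⟨i, hi⟩ := Function.ne_iff.1 hv
      exact Finset.sum_pos' (fun i _ => sq_nonneg (v i))
        ⟨i, Finset.mem_univ _, by have : v i ≠ 0 := hi; positivity⟩
    set r := Real.sqrt (∑ i, v i ^ 2) with hr
    have hr2 : r ^ 2 = ∑ i, v i ^ 2 := Real.sq_sqrt hs.le
    have hr0 : r ≠ 0 := (Real.sqrt_pos.2 hs).ne'
    have hmem : r⁻¹ • v ∈ S := by
      change ∑ i, (r⁻¹ * v i) ^ 2 = 1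
      simp only [mul_pow]
      rw [← Finset.mul_sum, ← hr2, ← mul_pow, inv_mul_cancel₀ hr0, one_pow]
    have h := hmin hmem
    simp only [Set.mem_ofPred_eq, Matrix.mulVec_smul, smul_dotProduct, dotProduct_smul,
      smul_eq_mul] at h
    rw [← hr2]
    calc _ ≤ (r⁻¹ * (r⁻¹ * v ⬝ᵥ Y *ᵥ v)) * r ^ 2 := by gcongr
      _ = _ := by field_simp

section Theta

variable {n : ℕ}

theorem norm_fourierExp (T : Matrix (Fin n) (Fin n) ℚ) (Z : Matrix (Fin n) (Fin n) ℂ) :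
    ‖fourierExp T Z‖ =
      Real.exp (-(2 * Real.pi) * (T.map (fun t : ℚ => (t : ℝ)) * Z.map Complex.im).trace) := by
  rw [fourierExp, Complex.norm_exp]
  congr 1
  have h : (T.map (fun t : ℚ => (t : ℂ)) * Z).trace.im =
      (T.map (fun t : ℚ => (t : ℝ)) * Z.map Complex.im).trace := by
    simp only [Matrix.trace, Matrix.diag_apply, Matrix.mul_apply, Matrix.map_apply, Complex.im_sum]
    refine Finset.sum_congr rfl fun i _ => Finset.sum_congr rfl fun j _ => ?_
    rw [← Complex.ofReal_ratCast, Complex.im_ofReal_mul]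
  rw [← h]
  have e (z : ℂ) : (2 * (Real.pi : ℂ) * Complex.I * z).re = -(2 * Real.pi) * z.im := by
    simp [Complex.mul_re, Complex.mul_im]
  exact e _

theorem fourierExp_ne_zero (T : Matrix (Fin n) (Fin n) ℚ) (Z : Matrix (Fin n) (Fin n) ℂ) :
    fourierExp T Z ≠ 0 :=
  Complex.exp_ne_zero _

variable {ι : Type*} [Fintype ι] {w : ℚ}

theorem halfGram_weightedSumSquares (x : Fin n → ι → ℚ) (i j : Fin n) :
    halfGram (QuadraticMap.weightedSumSquares ℚ fun _ : ι => w) x i j =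
      w * ∑ k, x i k * x j k := by
  simp only [halfGram, Matrix.of_apply, QuadraticMap.polar, QuadraticMap.weightedSumSquares_apply,
    smul_eq_mul, ← Finset.sum_sub_distrib, Finset.mul_sum, Finset.sum_div, Pi.add_apply]
  exact Finset.sum_congr rfl fun k _ => by ring

theorem trace_halfGram_weightedSumSquares (x : Fin n → ι → ℚ) :
    (halfGram (QuadraticMap.weightedSumSquares ℚ fun _ : ι => w) x).trace =
      ∑ k : Fin n × ι, w * x k.1 k.2 ^ 2 := by
  simp only [Matrix.trace, Matrix.diag_apply, halfGram_weightedSumSquares, Fintype.sum_prod_type,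
    Finset.mul_sum, sq]

variable {M : Submodule ℤ (ι → ℚ)}

/-- The trace of `q(x)` is a multiple of the sum of the squares of all coordinates, so that this is a
product of one-dimensional theta series. -/
theorem summable_exp_neg_trace_halfGram (hw : 0 < w) (hM : ∀ x ∈ M, ∀ i, ∃ a : ℤ, x i = a)
    {d : ℝ} (hd : 0 < d) :
    Summable fun x : Fin n → M => Real.exp (-d *
      ((halfGram (QuadraticMap.weightedSumSquares ℚ fun _ : ι => w) fun i => (x i : ι → ℚ)).trace :
        ℚ)) := by
  choose a ha using fun (x : M) => hM x x.2
  have hinj : Function.Injective fun (x : Fin n → M) (k : Fin n × ι) => a (x k.1) k.2 := by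
    intro x y hxy
    funext i
    ext k
    rw [ha, ha]
    exact_mod_cast congrFun hxy (i, k)
  have hw' : (0 : ℝ) < w := by exact_mod_cast hw
  refine ((summable_prod_int (κ := Fin n × ι) (fun m => (Real.exp_pos _).le)
    (summable_exp_neg_mul_sq (mul_pos hd hw'))).comp_injective hinj).congr fun x => ?_
  rw [trace_halfGram_weightedSumSquares, Function.comp_apply, ← Real.exp_sum]
  congr 1
  rw [Rat.cast_sum, Finset.mul_sum]
  refine Finset.sum_congr rfl fun k _ => ?_
  rw [ha]
  push_cast
  ring

theorem exists_mul_trace_halfGram_le (hw : 0 < w) {Y : Matrix (Fin n) (Fin n) ℝ} (hY : Y.PosDef) :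
    ∃ c > 0, ∀ x : Fin n → ι → ℚ,
      c * ((halfGram (QuadraticMap.weightedSumSquares ℚ fun _ : ι => w) x).trace : ℚ) ≤
        ((halfGram (QuadraticMap.weightedSumSquares ℚ fun _ : ι => w) x).map
          (fun t : ℚ => (t : ℝ)) * Y).trace := by
  obtain ⟨c, hc, h⟩ := hY.exists_mul_sum_sq_le
  refine ⟨c, hc, fun x => ?_⟩
  have hw' : (0 : ℝ) ≤ w := by exact_mod_cast hw.le
  have e1 : ((halfGram (QuadraticMap.weightedSumSquares ℚ fun _ : ι => w) x).map
      (fun t : ℚ => (t : ℝ)) * Y).trace =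
      ∑ k, w * ((fun i => (x i k : ℝ)) ⬝ᵥ Y *ᵥ fun i => (x i k : ℝ)) := by
    simp only [Matrix.trace, Matrix.diag_apply, Matrix.mul_apply, Matrix.map_apply,
      halfGram_weightedSumSquares, dotProduct, Matrix.mulVec, Finset.mul_sum, Finset.sum_mul,
      Rat.cast_mul, Rat.cast_sum]
    conv_lhs => rw [Finset.sum_comm]
    conv_rhs => rw [Finset.sum_comm]
    refine Finset.sum_congr rfl fun i _ => ?_
    conv_rhs => rw [Finset.sum_comm]
    exact Finset.sum_congr rfl fun j _ => Finset.sum_congr rfl fun k _ => by ring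
  rw [e1, trace_halfGram_weightedSumSquares, Fintype.sum_prod_type_right, Rat.cast_sum,
    Finset.mul_sum]
  refine Finset.sum_le_sum fun k _ => ?_
  refine le_trans (le_of_eq ?_) (mul_le_mul_of_nonneg_left (h _) hw')
  rw [Rat.cast_sum, Finset.mul_sum, Finset.mul_sum, Finset.mul_sum]
  refine Finset.sum_congr rfl fun i _ => ?_
  push_cast
  ring

/-- The terms of a theta series decay exponentially in the trace of `q(x)`. -/
theorem exists_norm_fourierExp_halfGram_le (hw : 0 < w) (Z : siegelUpperHalfSpace n) :
    ∃ c > 0, ∀ x : Fin n → ι → ℚ,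
      ‖fourierExp (halfGram (QuadraticMap.weightedSumSquares ℚ fun _ : ι => w) x) Z.1‖ ≤
        Real.exp (-c *
          ((halfGram (QuadraticMap.weightedSumSquares ℚ fun _ : ι => w) x).trace : ℚ)) := by
  obtain ⟨c, hc, h⟩ := exists_mul_trace_halfGram_le (ι := ι) hw Z.2.2
  refine ⟨2 * Real.pi * c, by positivity, fun x => ?_⟩
  rw [norm_fourierExp, Real.exp_le_exp, neg_mul, neg_mul, neg_le_neg_iff, mul_assoc]
  exact mul_le_mul_of_nonneg_left (h x) (by positivity)

/-- The theta series of a lattice of integral vectors converges. -/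
theorem siegelThetaConverges_weightedSumSquares (hw : 0 < w)
    (hM : ∀ x ∈ M, ∀ i, ∃ a : ℤ, x i = a) :
    SiegelThetaConverges (QuadraticMap.weightedSumSquares ℚ fun _ : ι => w) M n := by
  intro Z
  obtain ⟨c, hc, h⟩ := exists_norm_fourierExp_halfGram_le (ι := ι) hw Z
  exact .of_norm_bounded (summable_exp_neg_trace_halfGram hw hM hc) fun x => h _

/-- The determinant of `q(x)` grows at most polynomially in its trace. -/
theorem norm_det_halfGram_le (hw : 0 < w) (x : Fin n → ι → ℚ) :
    |((halfGram (QuadraticMap.weightedSumSquares ℚ fun _ : ι => w) x).det : ℝ)| ≤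
      n.factorial *
        ((halfGram (QuadraticMap.weightedSumSquares ℚ fun _ : ι => w) x).trace : ℝ) ^ n := by
  have h := Matrix.det_le (abv := AbsoluteValue.abs)
    (A := halfGram (QuadraticMap.weightedSumSquares ℚ fun _ : ι => w) x)
    (x := (halfGram (QuadraticMap.weightedSumSquares ℚ fun _ : ι => w) x).trace) fun i j => ?_
  · rw [AbsoluteValue.abs_apply, Fintype.card_fin, nsmul_eq_mul] at h
    exact_mod_cast h
  · have hs (i : Fin n) : w * ∑ k, x i k ^ 2 ≤
        (halfGram (QuadraticMap.weightedSumSquares ℚ fun _ : ι => w) x).trace := by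
      rw [trace_halfGram_weightedSumSquares, Fintype.sum_prod_type, Finset.mul_sum]
      exact Finset.single_le_sum (f := fun i => ∑ k, w * x i k ^ 2)
        (fun i _ => Finset.sum_nonneg fun k _ => by positivity) (Finset.mem_univ i)
    rw [AbsoluteValue.abs_apply, halfGram_weightedSumSquares, abs_mul, abs_of_pos hw]
    have h1 : |∑ k, x i k * x j k| ≤ (∑ k, x i k ^ 2 + ∑ k, x j k ^ 2) / 2 := by
      rw [← Finset.sum_add_distrib, Finset.sum_div]
      refine (Finset.abs_sum_le_sum_abs _ _).trans (Finset.sum_le_sum fun k _ => ?_)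
      rw [abs_le]
      constructor <;> nlinarith [sq_nonneg (x i k - x j k), sq_nonneg (x i k + x j k)]
    have h2 := mul_le_mul_of_nonneg_left h1 hw.le
    linarith [hs i, hs j]

theorem summable_det_mul_fourierExp_halfGram (hw : 0 < w)
    (hM : ∀ x ∈ M, ∀ i, ∃ a : ℤ, x i = a) (Z : siegelUpperHalfSpace n) :
    Summable fun x : Fin n → M =>
      ((halfGram (QuadraticMap.weightedSumSquares ℚ fun _ : ι => w)
          fun i => (x i : ι → ℚ)).det : ℂ) *
        fourierExp (halfGram (QuadraticMap.weightedSumSquares ℚ fun _ : ι => w)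
          fun i => (x i : ι → ℚ)) Z.1 := by
  obtain ⟨c, hc, h⟩ := exists_norm_fourierExp_halfGram_le (ι := ι) hw Z
  -- half of the exponential decay dominates the polynomial growth of the determinant
  refine .of_norm_bounded ((summable_exp_neg_trace_halfGram hw hM (half_pos hc)).mul_left
    (n.factorial * n.factorial / (c / 2) ^ n)) fun x => ?_
  set T := halfGram (QuadraticMap.weightedSumSquares ℚ fun _ : ι => w) fun i => (x i : ι → ℚ) with hT
  have ht : (0 : ℝ) ≤ T.trace := by
    rw [hT, trace_halfGram_weightedSumSquares]
    exact_mod_cast Finset.sum_nonneg fun k _ => by positivity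
  have h1 : ‖(T.det : ℂ)‖ ≤ n.factorial * (T.trace : ℝ) ^ n := by
    rw [← Complex.ofReal_ratCast, Complex.norm_real, Real.norm_eq_abs]
    exact norm_det_halfGram_le hw _
  have h2 := Real.pow_div_factorial_le_exp (c / 2 * T.trace) (by positivity) n
  rw [div_le_iff₀ (by positivity), mul_pow] at h2
  have h3 : (T.trace : ℝ) ^ n ≤ Real.exp (c / 2 * T.trace) * n.factorial / (c / 2) ^ n := by
    rw [le_div_iff₀ (by positivity), mul_comm]
    exact h2
  rw [norm_mul]
  calc _ ≤ (n.factorial * (Real.exp (c / 2 * T.trace) * n.factorial / (c / 2) ^ n)) *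
        Real.exp (-c * T.trace) := by
        gcongr
        · exact h1.trans (by gcongr)
        · exact h _
    _ = n.factorial * n.factorial / (c / 2) ^ n *
        (Real.exp (c / 2 * T.trace) * Real.exp (-c * T.trace)) := by ring
    _ = _ := by
      rw [← Real.exp_add]
      congr 2
      ring

end Theta

section Expansion

variable {V : Type*} [AddCommGroup V] [Module ℚ V] {q : QuadraticForm ℚ V} {M : Submodule ℤ V}
  {n : ℕ}

theorem halfGram_isSymm (x : Fin n → V) : (halfGram q x).IsSymm := by
  ext i j
  simp [halfGram, QuadraticMap.polar_comm q (x i)]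

theorem halfGram_mem_halfIntegralMatrices (hq : ∀ x ∈ M, ∃ a : ℤ, q x = a) (x : Fin n → M) :
    halfGram q (fun i => (x i : V)) ∈ halfIntegralMatrices n := by
  refine ⟨halfGram_isSymm _, fun i => ?_, fun i j => ?_⟩
  · obtain ⟨a, ha⟩ := hq _ (x i).2
    refine ⟨a, ?_⟩
    simp only [halfGram, Matrix.of_apply, QuadraticMap.polar_self, ha]
    simp
  · obtain ⟨a, ha⟩ := hq _ (M.add_mem (x i).2 (x j).2)
    obtain ⟨b, hb⟩ := hq _ (x i).2
    obtain ⟨c, hc⟩ := hq _ (x j).2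
    refine ⟨a - b - c, ?_⟩
    simp only [halfGram, Matrix.of_apply, QuadraticMap.polar, ha, hb, hc]
    push_cast
    ring

/-- Convergence makes the representation numbers finite, as the terms of the theta series that belong
to the same `T` are equal and nonzero. -/
theorem SiegelThetaConverges.finite (h : SiegelThetaConverges q M n)
    (T : Matrix (Fin n) (Fin n) ℚ) :
    {x : Fin n → M | halfGram q (fun i => (x i : V)) = T}.Finite := by
  by_contra hinf
  have : Infinite {x : Fin n → M | halfGram q (fun i => (x i : V)) = T} :=
    Set.infinite_coe_iff.2 hinf
  have hZ : Matrix.scalar (Fin n) Complex.I ∈ siegelUpperHalfSpace n := by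
    refine ⟨by simp [Matrix.IsSymm], ?_⟩
    convert Matrix.PosDef.one (n := Fin n) (R := ℝ) using 1
    ext i j
    by_cases hij : i = j <;> simp [hij, Matrix.one_apply]
  have h1 := (h ⟨_, hZ⟩).subtype {x : Fin n → M | halfGram q (fun i => (x i : V)) = T}
  have h2 : Summable fun _ : {x : Fin n → M | halfGram q (fun i => (x i : V)) = T} =>
      fourierExp T (Matrix.scalar (Fin n) Complex.I) := by
    refine h1.congr fun x => ?_
    rw [Function.comp_apply, x.2]
  exact fourierExp_ne_zero _ _ ((summable_const_iff _).1 h2)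

/-- Summing a theta series, with weights depending on the Gram matrix only, over the fibres of the
map that sends a tuple to its Gram matrix. -/
theorem SiegelThetaConverges.hasSum_weighted (h : SiegelThetaConverges q M n)
    (hq : ∀ x ∈ M, ∃ a : ℤ, q x = a) (a : Matrix (Fin n) (Fin n) ℚ → ℂ)
    {Z : siegelUpperHalfSpace n}
    (hs : Summable fun x : Fin n → M => a (halfGram q fun i => (x i : V)) *
      fourierExp (halfGram q fun i => (x i : V)) Z.1) :
    HasSum (fun T : halfIntegralMatrices n =>
        a T.1 * (representationNumber q M T.1 : ℂ) * fourierExp T.1 Z.1)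
      (∑' x : Fin n → M, a (halfGram q fun i => (x i : V)) *
        fourierExp (halfGram q fun i => (x i : V)) Z.1) := by
  let t (x : Fin n → M) : halfIntegralMatrices n := ⟨_, halfGram_mem_halfIntegralMatrices hq x⟩
  have h1 := (Equiv.sigmaFiberEquiv t).hasSum_iff.2 hs.hasSum
  refine h1.sigma fun T => ?_
  have hf : Finite {x : Fin n → M // t x = T} := by
    have hsub : {x | t x = T} ⊆ {x : Fin n → M | halfGram q (fun i => (x i : V)) = T.1} :=
      fun x (hx : t x = T) => congrArg Subtype.val hx
    exact ((h.finite T.1).subset hsub).to_subtype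
  have := Fintype.ofFinite {x : Fin n → M // t x = T}
  convert hasSum_fintype _ using 1
  have h2 (x : {x : Fin n → M // t x = T}) : halfGram q (fun i => (x.1 i : V)) = T.1 :=
    congrArg Subtype.val x.2
  simp only [Function.comp_apply, Equiv.sigmaFiberEquiv, Equiv.coe_fn_mk, h2, Finset.sum_const,
    nsmul_eq_mul]
  have h3 : representationNumber q M T.1 = (Finset.univ : Finset {x : Fin n → M // t x = T}).card := by
    rw [Finset.card_univ, ← Nat.card_eq_fintype_card, representationNumber, ← Nat.card_coe_set_eq]
    exact Nat.card_congr (Equiv.subtypeEquivRight fun x => by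
      simp [t, Subtype.ext_iff])
  rw [h3]
  ring

theorem SiegelThetaConverges.hasFourierExpansion (h : SiegelThetaConverges q M n)
    (hq : ∀ x ∈ M, ∃ a : ℤ, q x = a) :
    HasFourierExpansion (siegelTheta q M n)
      (fun T => (representationNumber q M T.1 : ℂ)) := by
  intro Z
  have := h.hasSum_weighted hq (fun _ => 1) (Z := Z) (by simpa using h Z)
  simpa [siegelTheta] using this

theorem SiegelThetaConverges.fourierCoefficient_eq (h : SiegelThetaConverges q M n)
    (hq : ∀ x ∈ M, ∃ a : ℤ, q x = a) (T : halfIntegralMatrices n) :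
    fourierCoefficient (siegelTheta q M n) T = representationNumber q M T.1 :=
  congrFun (h.hasFourierExpansion hq).fourierCoefficient_eq T

theorem SiegelThetaConverges.hasFourierExpansion_thetaOperator (h : SiegelThetaConverges q M n)
    (hq : ∀ x ∈ M, ∃ a : ℤ, q x = a)
    (hs : ∀ Z : siegelUpperHalfSpace n, Summable fun x : Fin n → M =>
      ((halfGram q fun i => (x i : V)).det : ℂ) * fourierExp (halfGram q fun i => (x i : V)) Z.1) :
    HasFourierExpansion (thetaOperator (siegelTheta q M n))
      (fun T => (T.1.det : ℂ) * (representationNumber q M T.1 : ℂ)) := by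
  intro Z
  have h1 := h.hasSum_weighted hq (fun T => (T.det : ℂ)) (hs Z)
  convert h1 using 1
  rw [thetaOperator, ← h1.tsum_eq]
  simp only [h.fourierCoefficient_eq hq]

end Expansion

/-! ### Representation numbers of a lattice and of a fixed lattice -/

section FixedLattice

variable {V : Type*} [AddCommGroup V] [Module ℚ V] {q : QuadraticForm ℚ V} {M : Submodule ℤ V}
  {n p : ℕ}

/-- If `σ` is an automorphism of `M` whose order divides the prime `p`, then `σ` permutes the
representations of `T` by `M`, the fixed points being the representations by the fixed lattice. -/
theorem representationNumber_modEq_fixedLattice [Fact p.Prime] {σ : V ≃ₗ[ℚ] V}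
    (hσ : σ ∈ latticeAut q M) (hσp : σ ^ p = 1) {T : Matrix (Fin n) (Fin n) ℚ}
    (hfin : {x : Fin n → M | halfGram q (fun i => (x i : V)) = T}.Finite) :
    representationNumber q M T ≡ representationNumber q (fixedLattice M σ) T [MOD p] := by
  classical
  have := hfin.to_subtype
  have := Fintype.ofFinite {x : Fin n → M | halfGram q (fun i => (x i : V)) = T}
  have hpol (x y : V) : QuadraticMap.polar q (σ x) (σ y) = QuadraticMap.polar q x y := by
    simp only [QuadraticMap.polar, ← map_add, hσ.1]
  let f : Function.End {x : Fin n → M | halfGram q (fun i => (x i : V)) = T} :=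
    fun x => ⟨fun i => ⟨σ (x.1 i), (hσ.2 _).2 (x.1 i).2⟩, by
      have h : _ = T := x.2
      change _ = T
      conv_rhs => rw [← h]
      ext i j
      simp only [halfGram, Matrix.of_apply, hpol]⟩
  have hf (k : ℕ) (x) (i : Fin n) : (((f ^ k) x).1 i : V) = (σ ^ k) (x.1 i : V) := by
    induction k generalizing x with
    | zero => rfl
    | succ k ih =>
      rw [pow_succ, pow_succ, LinearEquiv.mul_apply]
      exact ih (f x)
  have hfp : f ^ p ^ 1 = 1 := by
    funext x
    apply Subtype.ext
    funext i
    apply Subtype.ext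
    rw [hf, pow_one, hσp]
    rfl
  have h1 := Equiv.Perm.card_fixedPoints_modEq hfp
  rw [← Nat.card_eq_fintype_card, ← Nat.card_eq_fintype_card, Nat.card_coe_set_eq] at h1
  rw [representationNumber, representationNumber]
  convert h1 using 1
  rw [← Nat.card_coe_set_eq]
  refine Nat.card_congr
    { toFun := fun x => ⟨⟨fun i => ⟨x.1 i, (x.1 i).2.1⟩, x.2⟩, ?_⟩
      invFun := fun x => ⟨fun i => ⟨x.1.1 i, (x.1.1 i).2, ?_⟩, x.1.2⟩
      left_inv := fun x => rfl
      right_inv := fun x => rfl }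
  · apply Subtype.ext
    funext i
    exact Subtype.ext (x.1 i).2.2
  · exact congrArg (fun y => ((y.1 i : M) : V)) x.2

variable {r : ℕ} {G : Matrix (Fin r) (Fin r) ℤ}

/-- In coordinates, a representation of `T` is an integral matrix `X` with `Xᵗ G X = 2 T`. -/
theorem HasGramMatrix.representationNumber_eq (h : HasGramMatrix q M G)
    (T : Matrix (Fin n) (Fin n) ℚ) :
    representationNumber q M T = {X : Matrix (Fin r) (Fin n) ℤ |
      (Xᵀ * G * X).map (fun a : ℤ => (a : ℚ)) = (2 : ℚ) • T}.ncard := by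
  obtain ⟨e, he⟩ := h
  let φ : (Fin n → M) ≃ Matrix (Fin r) (Fin n) ℤ :=
    { toFun := fun x => Matrix.of fun i j => e.repr (x j) i
      invFun := fun X j => ∑ i, X i j • e i
      left_inv := fun x => funext fun j => by simp [e.sum_repr]
      right_inv := fun X => by
        ext i j
        simp [Finsupp.single_apply] }
  have hφ (X : Matrix (Fin r) (Fin n) ℤ) :
      (2 : ℚ) • halfGram q (fun i => (φ.symm X i : V)) = (Xᵀ * G * X).map fun a : ℤ => (a : ℚ) := by
    ext i j
    have h1 (k : Fin n) : (φ.symm X k : V) = ∑ i, X i k • (e i : V) := by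
      simp [φ]
    have h2 := fun x y => QuadraticMap.polarBilin_apply_apply q x y
    rw [Matrix.smul_apply, halfGram, Matrix.of_apply, smul_eq_mul, mul_div_cancel₀ _ two_ne_zero, h1,
      h1, ← h2]
    simp only [map_sum, LinearMap.sum_apply, map_zsmul, LinearMap.smul_apply, h2, he,
      Matrix.map_apply, Matrix.mul_apply, Matrix.transpose_apply, Int.cast_sum, Int.cast_mul,
      Finset.sum_mul, zsmul_eq_mul]
    simp only [Finset.mul_sum]
    exact Finset.sum_congr rfl fun k _ => Finset.sum_congr rfl fun l _ => by ring
  rw [representationNumber, ← Nat.card_coe_set_eq, ← Nat.card_coe_set_eq]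
  refine Nat.card_congr (φ.subtypeEquiv fun x => ?_)
  have h3 := hφ (φ x)
  rw [Equiv.symm_apply_apply] at h3
  simp only [Set.mem_ofPred_eq]
  rw [← h3]
  exact (smul_right_injective _ (two_ne_zero (α := ℚ))).eq_iff.symm

/-- A lattice of rank `n` with Gram matrix `G` only represents matrices `T` of degree `n` such that
`det (2 T)` is divisible by `det G`. -/
theorem HasGramMatrix.det_dvd {G : Matrix (Fin n) (Fin n) ℤ} (h : HasGramMatrix q M G)
    {T : Matrix (Fin n) (Fin n) ℚ} (hT : representationNumber q M T ≠ 0) {D : ℤ}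
    (hD : 2 ^ n * T.det = D) : G.det ∣ D := by
  rw [h.representationNumber_eq] at hT
  obtain ⟨X, hX⟩ := Set.nonempty_of_ncard_ne_zero hT
  have h1 := congrArg Matrix.det hX
  rw [Matrix.det_smul, Fintype.card_fin, hD, ← Int.coe_castRingHom] at h1
  have h2 : ((Xᵀ * G * X).det : ℚ) = D := by
    rw [← h1]
    exact (Int.castRingHom ℚ).map_det _
  rw [Matrix.det_mul, Matrix.det_mul] at h2
  exact ⟨Xᵀ.det * X.det, by rw [← Int.cast_inj (α := ℚ), ← h2]; push_cast; ring⟩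

/-- A lattice of rank `r` only represents singular matrices in degrees `n > r`. -/
theorem HasGramMatrix.det_eq_zero (h : HasGramMatrix q M G) (hr : r < n)
    {T : Matrix (Fin n) (Fin n) ℚ} (hT : representationNumber q M T ≠ 0) : T.det = 0 := by
  rw [h.representationNumber_eq] at hT
  obtain ⟨X, hX⟩ := Set.nonempty_of_ncard_ne_zero hT
  have hX : (Xᵀ * G * X).map (fun a : ℤ => (a : ℚ)) = (2 : ℚ) • T := hX
  by_contra h0
  have h1 : ((2 : ℚ) • T).rank = n := by
    rw [Matrix.rank_of_isUnit _ ((Matrix.isUnit_iff_isUnit_det _).2 ?_), Fintype.card_fin]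
    rw [Matrix.det_smul]
    exact (mul_ne_zero (pow_ne_zero _ two_ne_zero) h0).isUnit
  have h2 : (Xᵀ * G * X).map (fun a : ℤ => (a : ℚ)) =
      (Xᵀ * G).map (fun a : ℤ => (a : ℚ)) * X.map (fun a : ℤ => (a : ℚ)) :=
    Matrix.map_mul (f := Int.castRingHom ℚ)
  rw [h2] at hX
  have h3 := (Matrix.rank_mul_le_right ((Xᵀ * G).map (fun a : ℤ => (a : ℚ)))
    (X.map fun a : ℤ => (a : ℚ))).trans (Matrix.rank_le_card_height _)
  rw [hX, h1, Fintype.card_fin] at h3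
  omega

/-- The representations of `½ G` by a lattice with Gram matrix `G` are its automorphisms. -/
theorem HasGramMatrix.not_dvd_representationNumber [Fact p.Prime] {G : Matrix (Fin n) (Fin n) ℤ}
    (h : HasGramMatrix q M G) (hn : n < p - 1) (hG : G.det ≠ 0)
    (hfin : {x : Fin n → M | halfGram q (fun i => (x i : V)) =
      (2⁻¹ : ℚ) • G.map fun a : ℤ => (a : ℚ)}.Finite) :
    ¬ p ∣ representationNumber q M ((2⁻¹ : ℚ) • G.map fun a : ℤ => (a : ℚ)) := by
  have h1 := h.representationNumber_eq ((2⁻¹ : ℚ) • G.map fun a : ℤ => (a : ℚ))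
  have h2 : {X : Matrix (Fin n) (Fin n) ℤ | (Xᵀ * G * X).map (fun a : ℤ => (a : ℚ)) =
      (2 : ℚ) • (2⁻¹ : ℚ) • G.map fun a : ℤ => (a : ℚ)} =
      {X : Matrix (Fin n) (Fin n) ℤ | Xᵀ * G * X = G} := by
    ext X
    rw [Set.mem_ofPred_eq, Set.mem_ofPred_eq, smul_smul, mul_inv_cancel₀ two_ne_zero, one_smul]
    exact (Matrix.map_injective Int.cast_injective).eq_iff
  rw [h2] at h1
  rw [h1]
  refine Matrix.not_dvd_ncard_isometries hn hG ?_
  -- a finite number of representations, one of which is the given basis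
  apply Set.finite_of_ncard_ne_zero
  rw [← h1, representationNumber]
  have := (Set.ncard_pos hfin).2 ?_
  · exact this.ne'
  · obtain ⟨e, he⟩ := h
    refine ⟨e, ?_⟩
    change _ = _
    ext i j
    simp [halfGram, he, div_eq_inv_mul]

end FixedLattice

/-! ### Congruences between Fourier expansions -/

section Congruence

variable {V : Type*} [AddCommGroup V] [Module ℚ V] {q : QuadraticForm ℚ V} {M : Submodule ℤ V}
  {n p : ℕ}

theorem intCast_mem_localRingAt (hp : p.Prime) (a : ℤ) : (a : ℂ) ∈ localRingAt p :=
  ⟨a, 1, fun h => hp.one_lt.ne' (by exact_mod_cast Int.eq_one_of_dvd_one (by positivity) h),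
    by simp⟩

theorem intCast_mem_maximalIdealAt_iff (hp : p.Prime) {a : ℤ} :
    (a : ℂ) ∈ maximalIdealAt p ↔ (p : ℤ) ∣ a := by
  constructor
  · rintro ⟨c, d, hd, h⟩
    have hd0 : (d : ℂ) ≠ 0 := by
      rintro h0
      exact hd ((Int.cast_eq_zero.1 h0) ▸ dvd_zero _)
    rw [eq_div_iff hd0] at h
    have h' : a * d = p * c := by exact_mod_cast h
    exact ((Nat.prime_iff_prime_int.1 hp).dvd_or_dvd (Dvd.intro _ h'.symm)).resolve_right hd
  · rintro ⟨c, rfl⟩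
    exact ⟨c, 1, fun h => hp.one_lt.ne' (by exact_mod_cast Int.eq_one_of_dvd_one (by positivity) h),
      by simp⟩

theorem natCast_mem_maximalIdealAt_iff (hp : p.Prime) {a : ℕ} :
    (a : ℂ) ∈ maximalIdealAt p ↔ p ∣ a := by
  rw [← Int.natCast_dvd_natCast, ← intCast_mem_maximalIdealAt_iff hp, Int.cast_natCast]

theorem exists_two_pow_mul_det_eq {T : Matrix (Fin n) (Fin n) ℚ} (hT : T ∈ halfIntegralMatrices n) :
    ∃ D : ℤ, 2 ^ n * T.det = D := by
  choose N hN using hT.2.2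
  refine ⟨(Matrix.of N).det, ?_⟩
  have h : (2 : ℚ) • T = (Matrix.of N).map fun a : ℤ => (a : ℚ) := by
    ext i j
    simp [hN]
  have h1 := Matrix.det_smul T 2
  rw [Fintype.card_fin] at h1
  rw [← h1, h]
  exact ((Int.castRingHom ℚ).map_det _).symm

theorem hasFourierExpansion_zero : HasFourierExpansion (0 : siegelUpperHalfSpace n → ℂ) 0 := by
  intro Z
  simp

/-- The theta series of two lattices are congruent if their representation numbers are. -/
theorem SiegelThetaConverges.congruentMod (hp : p.Prime) {M' : Submodule ℤ V}
    (h : SiegelThetaConverges q M n) (hq : ∀ x ∈ M, ∃ a : ℤ, q x = a)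
    (h' : SiegelThetaConverges q M' n) (hq' : ∀ x ∈ M', ∃ a : ℤ, q x = a)
    (hmod : ∀ T : Matrix (Fin n) (Fin n) ℚ,
      representationNumber q M T ≡ representationNumber q M' T [MOD p]) :
    CongruentMod p (siegelTheta q M n) (siegelTheta q M' n) := by
  have e := h.hasFourierExpansion hq
  have e' := h'.hasFourierExpansion hq'
  refine ⟨by rwa [e.fourierCoefficient_eq], by rwa [e'.fourierCoefficient_eq], fun T => ?_⟩
  rw [h.fourierCoefficient_eq hq, h'.fourierCoefficient_eq hq']
  refine ⟨by exact_mod_cast intCast_mem_localRingAt hp _,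
    by exact_mod_cast intCast_mem_localRingAt hp _, ?_⟩
  have := (intCast_mem_maximalIdealAt_iff hp).2 (Nat.modEq_iff_dvd.1 (hmod T.1).symm)
  exact_mod_cast this

/-- The coefficients `det(T) a(T)` are only integral up to powers of `2`, whence the condition on
`D = det(2 T)`. -/
theorem SiegelThetaConverges.thetaOperator_congruentMod_zero (hp : p.Prime) (hp2 : p ≠ 2)
    (h : SiegelThetaConverges q M n) (hq : ∀ x ∈ M, ∃ a : ℤ, q x = a)
    (hs : ∀ Z : siegelUpperHalfSpace n, Summable fun x : Fin n → M =>
      ((halfGram q fun i => (x i : V)).det : ℂ) * fourierExp (halfGram q fun i => (x i : V)) Z.1)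
    (hdvd : ∀ (T : Matrix (Fin n) (Fin n) ℚ) (D : ℤ), 2 ^ n * T.det = D →
      (p : ℤ) ∣ D * representationNumber q M T) :
    CongruentMod p (thetaOperator (siegelTheta q M n)) 0 := by
  have e := h.hasFourierExpansion_thetaOperator hq hs
  have e' := hasFourierExpansion_zero (n := n)
  refine ⟨by rwa [e.fourierCoefficient_eq], by rwa [e'.fourierCoefficient_eq], fun T => ?_⟩
  rw [e.fourierCoefficient_eq, e'.fourierCoefficient_eq, Pi.zero_apply, sub_zero]
  obtain ⟨D, hD⟩ := exists_two_pow_mul_det_eq T.2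
  obtain ⟨c, hc⟩ := hdvd T.1 D hD
  have h2 : ¬ (p : ℤ) ∣ 2 ^ n := fun h => hp2 <| by
    have := (Nat.prime_iff_prime_int.1 hp).dvd_of_dvd_pow h
    exact (Nat.prime_dvd_prime_iff_eq hp Nat.prime_two).1 (by exact_mod_cast this)
  have hD' : (2 : ℂ) ^ n * (T.1.det : ℂ) = D := by exact_mod_cast congrArg (fun t : ℚ => (t : ℂ)) hD
  have hc' : (D : ℂ) * representationNumber q M T.1 = p * c := by exact_mod_cast hc
  have h3 : (T.1.det : ℂ) * (representationNumber q M T.1 : ℂ) = (p : ℂ) * c / (2 ^ n : ℤ) := by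
    rw [← hc', ← hD']
    push_cast
    field_simp
  exact ⟨⟨p * c, 2 ^ n, h2, h3.trans (by push_cast; rfl)⟩,
    by simpa using intCast_mem_localRingAt hp 0, ⟨c, 2 ^ n, h2, h3⟩⟩

end Congruence

/-! ### The Golay code -/

/-- The words `g_a`, which together with the all-one word span the Golay code. -/
def paleyWord (a : ZMod 23) : Option (ZMod 23) → ZMod 2
  | none => 1
  | some i => if IsSquare (i + a) then 0 else 1

theorem golayCode_eq_span :
    golayCode = Submodule.span (ZMod 2) ({fun _ => 1} ∪ Set.range paleyWord) := by
  rw [golayCode]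
  congr 2
  ext c
  constructor
  · rintro ⟨a, h0, h⟩
    refine ⟨a, funext fun i => ?_⟩
    cases i with
    | none => exact h0.symm
    | some i =>
      by_cases hi : IsSquare (i + a)
      · rw [(h i).1 hi, paleyWord, if_pos hi]
      · rw [(h i).2 hi, paleyWord, if_neg hi]
  · rintro ⟨a, rfl⟩
    exact ⟨a, rfl, fun i => ⟨fun h => if_pos h, fun h => if_neg h⟩⟩

theorem paleyWord_mem_golayCode (a : ZMod 23) : paleyWord a ∈ golayCode := by
  rw [golayCode_eq_span]
  exact Submodule.subset_span (Or.inr ⟨a, rfl⟩)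

theorem one_mem_golayCode : (fun _ => 1) ∈ golayCode := by
  rw [golayCode_eq_span]
  exact Submodule.subset_span (Or.inl rfl)

/-- The words `g_a` are pairwise orthogonal. -/
theorem paleyWord_dotProduct_paleyWord (a b : ZMod 23) : paleyWord a ⬝ᵥ paleyWord b = 0 := by
  revert a b
  decide +kernel

theorem one_dotProduct_paleyWord (a : ZMod 23) : (fun _ => 1) ⬝ᵥ paleyWord a = 0 := by
  revert a
  decide +kernel

/-- The Golay code is self-orthogonal. -/
theorem dotProduct_eq_zero_of_mem_golayCode {c d : Option (ZMod 23) → ZMod 2}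
    (hc : c ∈ golayCode) (hd : d ∈ golayCode) : c ⬝ᵥ d = 0 := by
  rw [golayCode_eq_span] at hc hd
  induction hc, hd using Submodule.span_induction₂ with
  | mem_mem c d hc hd =>
    rcases hc with rfl | ⟨a, rfl⟩ <;> rcases hd with rfl | ⟨b, rfl⟩
    · decide +kernel
    · exact one_dotProduct_paleyWord b
    · rw [dotProduct_comm]
      exact one_dotProduct_paleyWord a
    · exact paleyWord_dotProduct_paleyWord a b
  | zero_left d hd => exact zero_dotProduct d
  | zero_right c hc => exact dotProduct_zero c
  | add_left c c' d hc hc' hd h h' => rw [add_dotProduct, h, h', add_zero]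
  | add_right c d d' hc hd hd' h h' => rw [dotProduct_add, h, h', add_zero]
  | smul_left r c d hc hd h => rw [smul_dotProduct, h, smul_zero]
  | smul_right r c d hc hd h => rw [dotProduct_smul, h, smul_zero]

/-- The position of a coordinate in the ordering `∞, 0, 1, …, 22`. -/
def golayIndex : Option (ZMod 23) → ℕ
  | none => 0
  | some i => i.val + 1

/-- The first twelve coordinates; both they and the last twelve coordinates are information sets of
the Golay code. -/
def golayLeft (i : Option (ZMod 23)) : Bool :=
  decide (golayIndex i < 12)

/-- `systematicWord i` is the codeword that, among the coordinates on the same side as `i`, is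
nonzero only at `i`.  It is given by the sum of those `g_a` for which the binary digit number `a` of
the entry of the table is `1`. -/
def systematicWord (i : Option (ZMod 23)) : Option (ZMod 23) → ZMod 2 :=
  ∑ a : ZMod 23, if Nat.testBit ([345, 3002, 1501, 795, 3010, 3675, 1752, 2262, 1131, 2170, 1085,
    1003, 2630, 3941, 1979, 980, 2988, 1494, 747, 380, 190, 95, 38, 19].getD (golayIndex i) 0) a.val
    then paleyWord a else 0

theorem systematicWord_mem_golayCode (i : Option (ZMod 23)) : systematicWord i ∈ golayCode := by
  refine Submodule.sum_mem _ fun a _ => ?_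
  split_ifs
  · exact paleyWord_mem_golayCode a
  · exact Submodule.zero_mem _

theorem systematicWord_apply (i j : Option (ZMod 23)) (h : golayLeft i = golayLeft j) :
    systematicWord i j = if i = j then 1 else 0 := by
  revert i j
  decide +kernel

/-- No combination of two systematic words has weight `4`. -/
theorem hammingNorm_systematicWord_ne (i j : Option (ZMod 23)) (x y : ZMod 2) :
    hammingNorm (x • systematicWord i + y • systematicWord j) ≠ 4 := by
  revert i j x y
  decide +kernel

theorem systematicWord_dotProduct_eq_zero {c : Option (ZMod 23) → ZMod 2}
    (h : ∀ a, paleyWord a ⬝ᵥ c = 0) (i : Option (ZMod 23)) : systematicWord i ⬝ᵥ c = 0 := by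
  rw [systematicWord, sum_dotProduct]
  refine Finset.sum_eq_zero fun a _ => ?_
  split_ifs
  · exact h a
  · exact zero_dotProduct c

/-- A word orthogonal to the Golay code is determined by its coordinates on one side. -/
theorem eq_zero_of_golayLeft {c : Option (ZMod 23) → ZMod 2} (h : ∀ a, paleyWord a ⬝ᵥ c = 0)
    (s : Bool) (hc : ∀ i, golayLeft i = s → c i = 0) : c = 0 := by
  funext t
  by_cases ht : golayLeft t = s
  · exact hc t ht
  · have h1 := systematicWord_dotProduct_eq_zero h t
    rw [dotProduct, Finset.sum_eq_single t] at h1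
    · rwa [systematicWord_apply t t rfl, if_pos rfl, one_mul] at h1
    · intro j _ hj
      by_cases hjs : golayLeft j = s
      · rw [hc j hjs, mul_zero]
      · rw [systematicWord_apply t j ((Bool.eq_not_of_ne ht).trans (Bool.eq_not_of_ne hjs).symm),
          if_neg hj.symm, zero_mul]
    · simp

/-- A word orthogonal to the Golay code is a combination of the systematic words on one side. -/
theorem eq_sum_systematicWord {c : Option (ZMod 23) → ZMod 2} (h : ∀ a, paleyWord a ⬝ᵥ c = 0)
    (s : Bool) : c = ∑ i with golayLeft i = s, c i • systematicWord i := by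
  rw [← sub_eq_zero]
  refine eq_zero_of_golayLeft (fun a => ?_) s fun j hj => ?_
  · rw [dotProduct_sub, h, dotProduct_sum, zero_sub, neg_eq_zero]
    refine Finset.sum_eq_zero fun i _ => ?_
    rw [dotProduct_smul, dotProduct_eq_zero_of_mem_golayCode (paleyWord_mem_golayCode a)
      (systematicWord_mem_golayCode i), smul_zero]
  · rw [Pi.sub_apply, Finset.sum_apply, Finset.sum_eq_single j]
    · simp [systematicWord_apply j j rfl]
    · intro i hi hij
      rw [Finset.mem_filter] at hi
      rw [Pi.smul_apply, systematicWord_apply i j (hi.2.trans hj.symm), if_neg hij, smul_zero]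
    · intro hj'
      exact absurd (Finset.mem_filter.2 ⟨Finset.mem_univ j, hj⟩) hj'

/-- The Golay code is self-dual. -/
theorem mem_golayCode_iff {c : Option (ZMod 23) → ZMod 2} :
    c ∈ golayCode ↔ ∀ a, paleyWord a ⬝ᵥ c = 0 := by
  refine ⟨fun h a => dotProduct_eq_zero_of_mem_golayCode (paleyWord_mem_golayCode a) h, fun h => ?_⟩
  rw [eq_sum_systematicWord h true]
  exact Submodule.sum_mem _ fun i _ => Submodule.smul_mem _ _ (systematicWord_mem_golayCode i)

theorem hammingNorm_add_zmod_two {ι : Type*} [Fintype ι] (c d : ι → ZMod 2) :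
    hammingNorm (c + d) + 2 * (Finset.univ.filter fun i => c i * d i ≠ 0).card =
      hammingNorm c + hammingNorm d := by
  have h : ∀ x y : ZMod 2, (if x + y ≠ 0 then 1 else 0) + 2 * (if x * y ≠ 0 then 1 else 0) =
      (if x ≠ 0 then 1 else 0) + if y ≠ 0 then 1 else 0 := by decide
  simp only [hammingNorm, Finset.card_filter, Finset.mul_sum, ← Finset.sum_add_distrib]
  exact Finset.sum_congr rfl fun i _ => h (c i) (d i)

theorem even_card_of_dotProduct_eq_zero {ι : Type*} [Fintype ι] {c d : ι → ZMod 2}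
    (h : c ⬝ᵥ d = 0) : Even (Finset.univ.filter fun i => c i * d i ≠ 0).card := by
  have h1 : ∀ x : ZMod 2, x = if x ≠ 0 then 1 else 0 := by decide
  rw [even_iff_two_dvd, ← ZMod.natCast_eq_zero_iff, Finset.card_filter]
  push_cast
  exact (Finset.sum_congr rfl fun i _ => (h1 _).symm).trans h

theorem hammingNorm_paleyWord (a : ZMod 23) : hammingNorm (paleyWord a) = 12 := by
  revert a
  decide +kernel

/-- The Golay code is doubly even. -/
theorem four_dvd_hammingNorm {c : Option (ZMod 23) → ZMod 2} (hc : c ∈ golayCode) :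
    4 ∣ hammingNorm c := by
  have hadd {c d : Option (ZMod 23) → ZMod 2} (hc : c ∈ golayCode) (hd : d ∈ golayCode)
      (h4 : 4 ∣ hammingNorm c) (h4' : 4 ∣ hammingNorm d) : 4 ∣ hammingNorm (c + d) := by
    have h1 := hammingNorm_add_zmod_two c d
    obtain ⟨k, hk⟩ := even_card_of_dotProduct_eq_zero (dotProduct_eq_zero_of_mem_golayCode hc hd)
    omega
  rw [golayCode_eq_span] at hc
  induction hc using Submodule.span_induction with
  | mem c hc =>
    rcases hc with rfl | ⟨a, rfl⟩
    · decide +kernel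
    · rw [hammingNorm_paleyWord]
      norm_num
  | zero => simp
  | add c d hc hd h h' =>
    rw [← golayCode_eq_span] at hc hd
    exact hadd hc hd h h'
  | smul r c hc h =>
    have h2 : ∀ r : ZMod 2, r = 0 ∨ r = 1 := by decide
    rcases h2 r with rfl | rfl
    · simp
    · rwa [one_smul]

/-- The Golay code has minimum weight `8`: a word of weight `4` would have at most two nonzero
coordinates on one of the two sides. -/
theorem eight_le_hammingNorm {c : Option (ZMod 23) → ZMod 2} (hc : c ∈ golayCode) (h0 : c ≠ 0) :
    8 ≤ hammingNorm c := by
  have h4 := four_dvd_hammingNorm hc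
  have hpos := hammingNorm_pos_iff.2 h0
  have hne : hammingNorm c ≠ 4 := by
    intro h
    let t (s : Bool) := Finset.univ.filter fun i => golayLeft i = s ∧ c i ≠ 0
    have hsum : (t true).card + (t false).card = 4 := by
      rw [← h, hammingNorm, ← Finset.card_filter_add_card_filter_not
        (s := Finset.univ.filter fun i => c i ≠ 0) (p := fun i => golayLeft i = true),
        Finset.filter_filter, Finset.filter_filter]
      congr 1 <;> refine congrArg Finset.card (Finset.ext fun i => ?_) <;> simp [t, and_comm]
    obtain ⟨s, hs⟩ : ∃ s, (t s).card ≤ 2 := by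
      by_contra! h
      have := h true
      have := h false
      omega
    have hc' : c = ∑ i ∈ t s, c i • systematicWord i := by
      conv_lhs => rw [eq_sum_systematicWord (mem_golayCode_iff.1 hc) s]
      symm
      refine Finset.sum_subset (fun i hi => ?_) fun i hi hi' => ?_
      · simp only [t, Finset.mem_filter] at hi ⊢
        exact ⟨hi.1, hi.2.1⟩
      · simp only [t, Finset.mem_filter, Finset.mem_univ, true_and, not_and, not_not] at hi hi'
        rw [hi' hi, zero_smul]
    interval_cases ht : (t s).card
    · rw [Finset.card_eq_zero.1 ht, Finset.sum_empty] at hc'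
      exact h0 hc'
    · obtain ⟨i, hi⟩ := Finset.card_eq_one.1 ht
      rw [hi, Finset.sum_singleton] at hc'
      refine hammingNorm_systematicWord_ne i i (c i) 0 ?_
      rwa [zero_smul, add_zero, ← hc']
    · obtain ⟨i, j, hij, hi⟩ := Finset.card_eq_two.1 ht
      rw [hi, Finset.sum_pair hij] at hc'
      refine hammingNorm_systematicWord_ne i j (c i) (c j) ?_
      rwa [← hc']
  omega

/-! ### The Leech lattice is even, unimodular, and has minimum `4` -/

theorem leechForm_apply (v : Option (ZMod 23) → ℚ) : leechForm v = (1 / 16) * ∑ i, v i ^ 2 := by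
  rw [leechForm, QuadraticMap.weightedSumSquares_apply, Finset.mul_sum]
  exact Finset.sum_congr rfl fun i _ => by rw [smul_eq_mul, sq]

theorem polar_leechForm (v w : Option (ZMod 23) → ℚ) :
    QuadraticMap.polar leechForm v w = (1 / 8) * ∑ i, v i * w i := by
  simp only [QuadraticMap.polar, leechForm_apply, Finset.mul_sum, ← Finset.sum_sub_distrib]
  exact Finset.sum_congr rfl fun i _ => by rw [Pi.add_apply]; ring

theorem exists_int_of_mem_leechLattice {v : Option (ZMod 23) → ℚ} (hv : v ∈ leechLattice)
    (i : Option (ZMod 23)) : ∃ a : ℤ, v i = a := by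
  obtain ⟨m, y, h, -, -⟩ := hv
  exact ⟨_, h i⟩

/-- The number of odd entries of an integral vector. -/
theorem hammingNorm_intCast {ι : Type*} [Fintype ι] (y : ι → ℤ) :
    (hammingNorm fun i => (y i : ZMod 2) : ℤ) = ∑ i, y i % 2 := by
  rw [hammingNorm, Finset.card_filter]
  push_cast
  refine Finset.sum_congr rfl fun i _ => ?_
  rcases Int.emod_two_eq_zero_or_one (y i) with h | h
  · rw [h, if_neg]
    rw [not_not, ZMod.intCast_zmod_eq_zero_iff_dvd]
    exact Int.dvd_of_emod_eq_zero h
  · rw [h, if_pos]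
    rw [Ne, ZMod.intCast_zmod_eq_zero_iff_dvd]
    intro h'
    have := Int.emod_eq_zero_of_dvd h'
    push_cast at this
    omega

theorem exists_sum_sq_eq_hammingNorm_add {ι : Type*} [Fintype ι] (y : ι → ℤ) :
    ∃ k : ℤ, 0 ≤ k ∧ ∑ i, y i ^ 2 = (hammingNorm fun i => (y i : ZMod 2) : ℤ) + 4 * k := by
  have h (a : ℤ) : ∃ k : ℤ, 0 ≤ k ∧ a ^ 2 = a % 2 + 4 * k := by
    obtain ⟨b, hb | hb⟩ := Int.even_or_odd' a
    · exact ⟨b ^ 2, sq_nonneg b, by rw [hb, Int.mul_emod_right]; ring⟩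
    · refine ⟨b ^ 2 + b, ?_, ?_⟩
      · rcases le_or_gt 0 b with h | h <;> nlinarith
      · rw [hb, Int.mul_add_emod_self_left]
        norm_num
        ring
  choose k hk0 hk using h
  refine ⟨∑ i, k (y i), Finset.sum_nonneg fun i _ => hk0 _, ?_⟩
  rw [hammingNorm_intCast, Finset.mul_sum, ← Finset.sum_add_distrib]
  exact Finset.sum_congr rfl fun i _ => hk _

theorem card_golayCoordinates : Fintype.card (Option (ZMod 23)) = 24 := by
  simp [ZMod.card]

theorem sum_add_two_mul (m : ℤ) (y : Option (ZMod 23) → ℤ) :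
    ∑ i, (m + 2 * y i) = 24 * m + 2 * ∑ i, y i := by
  rw [Finset.sum_add_distrib, Finset.sum_const, Finset.card_univ, card_golayCoordinates,
    Finset.mul_sum]
  simp

theorem sum_add_two_mul_sq (m : ℤ) (y : Option (ZMod 23) → ℤ) :
    ∑ i, (m + 2 * y i) ^ 2 = 24 * m ^ 2 + 4 * m * ∑ i, y i + 4 * ∑ i, y i ^ 2 := by
  have h (i) : (m + 2 * y i) ^ 2 = m ^ 2 + 4 * m * y i + 4 * y i ^ 2 := by ring
  simp only [h, Finset.sum_add_distrib, Finset.sum_const, Finset.card_univ, card_golayCoordinates,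
    Finset.mul_sum]
  simp

theorem sixteen_dvd_sum_sq {m : ℤ} {y : Option (ZMod 23) → ℤ}
    (hy : (fun i => (y i : ZMod 2)) ∈ golayCode) (hs : ∑ i, (m + 2 * y i) ≡ 4 * m [ZMOD 8]) :
    16 ∣ ∑ i, (m + 2 * y i) ^ 2 := by
  rw [sum_add_two_mul] at hs
  obtain ⟨k, -, hk⟩ := exists_sum_sq_eq_hammingNorm_add y
  obtain ⟨l, hl⟩ := four_dvd_hammingNorm hy
  obtain ⟨j, hj⟩ := hs.symm.dvd
  have hA : ∑ i, y i = 4 * j - 10 * m := by linarith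
  refine ⟨m * j - m ^ 2 + l + k, ?_⟩
  rw [sum_add_two_mul_sq, hA, hk, hl]
  push_cast
  ring

/-- The Leech lattice is even. -/
theorem exists_leechForm_eq_int {v : Option (ZMod 23) → ℚ} (hv : v ∈ leechLattice) :
    ∃ a : ℤ, leechForm v = a := by
  obtain ⟨m, y, h, hy, hs⟩ := hv
  obtain ⟨a, ha⟩ := sixteen_dvd_sum_sq hy hs
  refine ⟨a, ?_⟩
  have ha' : ∑ i, ((m + 2 * y i : ℤ) : ℚ) ^ 2 = 16 * a := by exact_mod_cast ha
  simp only [leechForm_apply, h]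
  rw [ha']
  ring

/-- The Leech lattice has no vectors of norm `2`.  Such a vector has `∑ vᵢ² = 16`, which leaves no
room for odd coordinates; so `v = 2 y`, where the word of `y` has weight at most `4` and hence is
zero; so `v = 4 z` with `z` a unit vector, contradicting the congruence for `∑ vᵢ`. -/
theorem two_le_leechForm {v : Option (ZMod 23) → ℚ} (hv : v ∈ leechLattice) (h0 : v ≠ 0) :
    2 ≤ leechForm v := by
  obtain ⟨a, ha⟩ := exists_leechForm_eq_int hv
  obtain ⟨m, y, h, hy, hs⟩ := hv
  have hsum : ∑ i, (m + 2 * y i) ^ 2 = 16 * a := by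
    have h1 : leechForm v = (1 / 16) * ∑ i, ((m + 2 * y i : ℤ) : ℚ) ^ 2 := by
      simp only [leechForm_apply, h]
    rw [ha] at h1
    have : ∑ i, ((m + 2 * y i : ℤ) : ℚ) ^ 2 = 16 * a := by linarith
    exact_mod_cast this
  have hpos : 0 < ∑ i, (m + 2 * y i) ^ 2 := by
    obtain ⟨i, hi⟩ := Function.ne_iff.1 h0
    refine Finset.sum_pos' (fun i _ => sq_nonneg _) ⟨i, Finset.mem_univ i, ?_⟩
    rw [h, Pi.zero_apply, Int.cast_ne_zero] at hi
    positivity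
  rw [ha]
  by_contra hlt
  have ha1 : a = 1 := by
    have : a < 2 := by exact_mod_cast not_le.1 hlt
    omega
  rw [ha1] at hsum
  obtain ⟨l, rfl | rfl⟩ := Int.even_or_odd' m
  · -- all coordinates are even
    have hz : (fun i => ((l + y i : ℤ) : ZMod 2)) ∈ golayCode := by
      have h1 := golayCode.add_mem (golayCode.smul_mem (l : ZMod 2) one_mem_golayCode) hy
      convert h1 using 1
      funext i
      simp
    have hsq : ∑ i, (l + y i) ^ 2 = 4 := by
      have h2 (i) : (2 * l + 2 * y i) ^ 2 = 4 * (l + y i) ^ 2 := by ring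
      simp only [h2, ← Finset.mul_sum] at hsum
      omega
    obtain ⟨k, hk0, hk⟩ := exists_sum_sq_eq_hammingNorm_add fun i => l + y i
    have hzero : (fun i => ((l + y i : ℤ) : ZMod 2)) = 0 := by
      by_contra hne
      have := eight_le_hammingNorm hz hne
      omega
    have hdvd (i) : ∃ z : ℤ, l + y i = 2 * z := by
      have := congrFun hzero i
      exact (ZMod.intCast_zmod_eq_zero_iff_dvd _ 2).1 this
    choose z hz using hdvd
    have hz1 : ∑ i, z i ^ 2 = 1 := by
      simp only [hz, mul_pow, ← Finset.mul_sum] at hsq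
      omega
    have hs' : 4 * ∑ i, z i ≡ 4 * (2 * l) [ZMOD 8] := by
      convert hs using 1
      rw [Finset.mul_sum]
      exact Finset.sum_congr rfl fun i _ => by linarith [hz i]
    have hpar : Even (∑ i, z i ^ 2 - ∑ i, z i) := by
      rw [← Finset.sum_sub_distrib]
      refine Finset.even_sum _ fun i _ => ?_
      rw [sq, ← mul_sub_one]
      exact Int.even_mul_pred_self _
    obtain ⟨r, hr⟩ := hpar
    obtain ⟨j, hj⟩ := hs'.dvd
    omega
  · -- all coordinates are odd
    have h1 : ∑ _i : Option (ZMod 23), (1 : ℤ) ≤ ∑ i, (2 * l + 1 + 2 * y i) ^ 2 := by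
      refine Finset.sum_le_sum fun i _ => ?_
      have : 2 * l + 1 + 2 * y i ≠ 0 := by omega
      have := sq_pos_iff.2 this
      linarith
    rw [Finset.sum_const, Finset.card_univ, card_golayCoordinates, hsum] at h1
    norm_num at h1

/-- Vectors generating the Leech lattice: `8 eᵢ`, `4 (e_∞ + eᵢ)`, twice the words `g_a`, and
`(-3, 1, …, 1)`. -/
def leechGenerator : Option (ZMod 23) ⊕ ZMod 23 ⊕ ZMod 23 ⊕ Unit → Option (ZMod 23) → ℤ
  | .inl i, j => if i = j then 8 else 0
  | .inr (.inl i), j => if j = none ∨ j = some i then 4 else 0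
  | .inr (.inr (.inl a)), j => 2 * (paleyWord a j).val
  | .inr (.inr (.inr _)), j => if j = none then -3 else 1

theorem sum_val_paleyWord (a : ZMod 23) : ∑ i, ((paleyWord a i).val : ℤ) = 12 := by
  revert a
  decide +kernel

/-- A vector with integral inner products with the generators belongs to the Leech lattice. -/
theorem mem_leechLattice_of_forall {v : Option (ZMod 23) → ℚ}
    (h : ∀ k, ∃ a : ℤ, ∑ i, (leechGenerator k i : ℚ) * v i = 8 * a) : v ∈ leechLattice := by
  have hint (i) : ∃ a : ℤ, v i = a := by
    obtain ⟨a, ha⟩ := h (.inl i)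
    refine ⟨a, ?_⟩
    simp [leechGenerator] at ha
    linarith
  choose x hx using hint
  have h' (k) : ∃ a : ℤ, ∑ i, leechGenerator k i * x i = 8 * a := by
    obtain ⟨a, ha⟩ := h k
    refine ⟨a, ?_⟩
    simp only [hx] at ha
    exact_mod_cast ha
  have hpar (i) : ∃ y : ℤ, x i = x none + 2 * y := by
    cases i with
    | none => exact ⟨0, by ring⟩
    | some i =>
      obtain ⟨a, ha⟩ := h' (.inr (.inl i))
      have h1 : ∑ j, leechGenerator (.inr (.inl i)) j * x j = 4 * x none + 4 * x (some i) := by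
        simp [leechGenerator, Fintype.sum_option]
      exact ⟨a - x none, by linarith⟩
  choose y hy using hpar
  refine ⟨x none, y, fun i => by rw [hx, hy], ?_, ?_⟩
  · rw [mem_golayCode_iff]
    intro a
    obtain ⟨b, hb⟩ := h' (.inr (.inr (.inl a)))
    have hw := sum_val_paleyWord a
    have h1 : ∑ i, ((paleyWord a i).val : ℤ) * y i = 2 * (b - 3 * x none) := by
      have h2 : ∑ i, leechGenerator (.inr (.inr (.inl a))) i * x i =
          2 * x none * ∑ i, ((paleyWord a i).val : ℤ) + 4 * ∑ i, ((paleyWord a i).val : ℤ) * y i := by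
        rw [Finset.mul_sum, Finset.mul_sum, ← Finset.sum_add_distrib]
        refine Finset.sum_congr rfl fun i _ => ?_
        rw [leechGenerator, hy i]
        ring
      rw [h2, hw] at hb
      linarith
    have h3 := congrArg (fun t : ℤ => (t : ZMod 2)) h1
    push_cast at h3
    rw [show (2 : ZMod 2) = 0 from rfl, zero_mul] at h3
    simpa [dotProduct] using h3
  · obtain ⟨b, hb⟩ := h' (.inr (.inr (.inr ())))
    have h1 : ∑ i, leechGenerator (.inr (.inr (.inr ()))) i * x i = ∑ i, x i - 4 * x none := by
      simp [leechGenerator, Fintype.sum_option]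
      ring
    simp only [← hy]
    exact (Int.modEq_iff_dvd.2 ⟨b, by linarith⟩).symm

theorem leechGenerator_mem (k) : (fun i => (leechGenerator k i : ℚ)) ∈ leechLattice := by
  have hzero {y : Option (ZMod 23) → ℤ} (hy : ∀ i, ∃ z, y i = 2 * z) :
      (fun i => (y i : ZMod 2)) ∈ golayCode := by
    convert golayCode.zero_mem using 1
    funext i
    obtain ⟨z, hz⟩ := hy i
    exact (ZMod.intCast_zmod_eq_zero_iff_dvd _ 2).2 ⟨z, hz⟩
  match k with
  | .inl i =>
    refine ⟨0, fun j => if i = j then 4 else 0, fun j => ?_, hzero fun j => ?_, ?_⟩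
    · by_cases h : i = j <;> simp [leechGenerator, h]
    · by_cases h : i = j
      · exact ⟨2, by simp [h]⟩
      · exact ⟨0, by simp [h]⟩
    · rw [sum_add_two_mul]
      simp
  | .inr (.inl i) =>
    refine ⟨0, fun j => if j = none ∨ j = some i then 2 else 0, fun j => ?_, hzero fun j => ?_, ?_⟩
    · by_cases h : j = none ∨ j = some i <;> simp [leechGenerator, h]
    · by_cases h : j = none ∨ j = some i
      · exact ⟨1, by simp [h]⟩
      · exact ⟨0, by simp [h]⟩
    · rw [sum_add_two_mul]
      simp [Fintype.sum_option]
  | .inr (.inr (.inl a)) =>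
    refine ⟨0, fun j => ((paleyWord a j).val : ℤ), fun j => ?_, ?_, ?_⟩
    · simp [leechGenerator]
    · simpa using paleyWord_mem_golayCode a
    · rw [sum_add_two_mul, sum_val_paleyWord]
      decide
  | .inr (.inr (.inr ())) =>
    refine ⟨1, fun j => if j = none then -2 else 0, fun j => ?_, hzero fun j => ?_, ?_⟩
    · by_cases h : j = none
      · simp [leechGenerator, h]
      · simp [leechGenerator, h]
    · by_cases h : j = none
      · exact ⟨-1, by simp [h]⟩
      · exact ⟨0, by simp [h]⟩
    · rw [sum_add_two_mul]
      simp
      decide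

theorem exists_polar_leechForm_eq_int {v w : Option (ZMod 23) → ℚ} (hv : v ∈ leechLattice)
    (hw : w ∈ leechLattice) : ∃ a : ℤ, QuadraticMap.polar leechForm v w = a := by
  obtain ⟨a, ha⟩ := exists_leechForm_eq_int hv
  obtain ⟨b, hb⟩ := exists_leechForm_eq_int hw
  obtain ⟨c, hc⟩ := exists_leechForm_eq_int (leechLattice.add_mem hv hw)
  exact ⟨c - a - b, by rw [QuadraticMap.polar, ha, hb, hc]; push_cast; rfl⟩

theorem mem_leechLattice_iff {v : Option (ZMod 23) → ℚ} :
    v ∈ leechLattice ↔ ∀ k, ∃ a : ℤ,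
      QuadraticMap.polar leechForm (fun i => (leechGenerator k i : ℚ)) v = a := by
  refine ⟨fun h k => exists_polar_leechForm_eq_int (leechGenerator_mem k) h, fun h =>
    mem_leechLattice_of_forall fun k => ?_⟩
  obtain ⟨a, ha⟩ := h k
  rw [polar_leechForm] at ha
  exact ⟨a, by linarith⟩

/-- The Leech lattice is unimodular: every functional is the inner product with some `y`, whose
coordinates are the values at the vectors `8 eᵢ`. -/
theorem exists_polar_leechForm_eq (f : leechLattice →ₗ[ℤ] ℤ) :
    ∃ y : leechLattice, ∀ x : leechLattice,
      QuadraticMap.polar leechForm (y : Option (ZMod 23) → ℚ) x = f x := by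
  let y (i : Option (ZMod 23)) : ℚ := f ⟨_, leechGenerator_mem (.inl i)⟩
  have hy (x : leechLattice) : QuadraticMap.polar leechForm y x = f x := by
    choose a ha using exists_int_of_mem_leechLattice x.2
    have h1 : (8 : ℤ) • x = ∑ i, a i • (⟨_, leechGenerator_mem (.inl i)⟩ : leechLattice) := by
      apply Subtype.ext
      push_cast
      funext j
      simp [Finset.sum_apply, leechGenerator, ha]
      ring
    have h2 := congrArg f h1
    rw [map_smul, map_sum] at h2
    simp only [map_smul, smul_eq_mul] at h2
    have h3 : (8 : ℚ) * f x = ∑ i, x.1 i * y i := by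
      simp only [ha, y]
      exact_mod_cast h2
    rw [polar_leechForm]
    simp only [mul_comm (y _)]
    rw [← h3]
    ring
  refine ⟨⟨y, mem_leechLattice_iff.2 fun k => ?_⟩, hy⟩
  rw [QuadraticMap.polar_comm]
  exact ⟨_, hy ⟨_, leechGenerator_mem k⟩⟩

/-- The embedding of the integral vectors into the rational ones. -/
def intVectors : (Option (ZMod 23) → ℤ) →ₗ[ℤ] (Option (ZMod 23) → ℚ) :=
  (Algebra.linearMap ℤ ℚ).compLeft _

theorem leechLattice_le_range_intVectors : leechLattice ≤ LinearMap.range intVectors := by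
  intro v hv
  choose a ha using exists_int_of_mem_leechLattice hv
  exact ⟨a, funext fun i => by simp [intVectors, ha]⟩

instance : Module.Finite ℤ leechLattice :=
  Module.Finite.of_injective (Submodule.inclusion leechLattice_le_range_intVectors)
    (Submodule.inclusion_injective _)

instance : Module.Free ℤ leechLattice :=
  inferInstance

theorem intVectors_injective : Function.Injective intVectors := by
  intro x y h
  funext i
  have := congrFun h i
  simpa [intVectors] using this

theorem finrank_leechLattice : Module.finrank ℤ leechLattice = 24 := by
  apply le_antisymm
  · have h := Submodule.finrank_mono leechLattice_le_range_intVectors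
    rwa [LinearMap.finrank_range_of_inj intVectors_injective, Module.finrank_fintype_fun_eq_card,
      card_golayCoordinates] at h
  · let f : (Option (ZMod 23) → ℤ) →ₗ[ℤ] leechLattice :=
      ((8 : ℤ) • intVectors).codRestrict _ fun x => by
        have h : ((8 : ℤ) • intVectors) x = ∑ i, x i • fun j => (leechGenerator (.inl i) j : ℚ) := by
          funext j
          simp [leechGenerator, intVectors, Finset.sum_apply]
          ring
        rw [h]
        exact Submodule.sum_mem _ fun i _ => Submodule.smul_mem _ _ (leechGenerator_mem _)
    have hf : Function.Injective f := by
      intro x y h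
      have h1 := congrArg Subtype.val h
      exact intVectors_injective (smul_right_injective _ (by norm_num : (8 : ℤ) ≠ 0) h1)
    have h := LinearMap.finrank_le_finrank_of_injective hf
    rwa [Module.finrank_fintype_fun_eq_card, card_golayCoordinates] at h

/-! ### Automorphisms of the Leech lattice -/

/-- An endomorphism of finite order that preserves `q` and maps `M` into itself is an
automorphism of `M`. -/
theorem exists_mem_latticeAut_orderOf_eq {V : Type*} [AddCommGroup V] [Module ℚ V]
    {q : QuadraticForm ℚ V} {M : Submodule ℤ V} {f : Module.End ℚ V} (h0 : orderOf f ≠ 0)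
    (hq : ∀ x, q (f x) = q x) (hM : ∀ x ∈ M, f x ∈ M) :
    ∃ σ ∈ latticeAut q M, orderOf σ = orderOf f := by
  have hfin : IsOfFinOrder f := orderOf_pos_iff.1 (Nat.pos_of_ne_zero h0)
  obtain ⟨u, rfl⟩ := hfin.isUnit
  let σ := LinearMap.GeneralLinearGroup.generalLinearEquiv ℚ V u
  have hσ (x : V) : σ x = (u : Module.End ℚ V) x := rfl
  refine ⟨σ, ⟨fun x => hq x, fun x => ⟨fun h => ?_, fun h => hM x h⟩⟩, ?_⟩
  · have hpow (k : ℕ) (y : V) (hy : y ∈ M) : ((u : Module.End ℚ V) ^ k) y ∈ M := by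
      induction k with
      | zero => exact hy
      | succ k ih =>
        rw [pow_succ', Module.End.mul_apply]
        exact hM _ ih
    have h1 := hpow (orderOf (u : Module.End ℚ V) - 1) _ h
    rw [hσ, ← Module.End.mul_apply, ← pow_succ, Nat.sub_add_cancel (Nat.pos_of_ne_zero h0),
      pow_orderOf_eq_one] at h1
    exact h1
  · rw [orderOf_units]
    exact MulEquiv.orderOf_eq _ u

/-- The maps of the set of coordinates to itself that preserve the Golay code. -/
def PreservesGolayCode (π : Option (ZMod 23) → Option (ZMod 23)) : Prop :=
  ∀ c ∈ golayCode, c ∘ π ∈ golayCode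

theorem PreservesGolayCode.comp {π ρ : Option (ZMod 23) → Option (ZMod 23)}
    (hπ : PreservesGolayCode π) (hρ : PreservesGolayCode ρ) : PreservesGolayCode (π ∘ ρ) :=
  fun c hc => hρ _ (hπ c hc)

/-- As the Golay code is self-dual, it suffices to check orthogonality relations. -/
theorem PreservesGolayCode.of_paleyWord {π : Option (ZMod 23) → Option (ZMod 23)}
    (h : ∀ a b, paleyWord b ⬝ᵥ (paleyWord a ∘ π) = 0) : PreservesGolayCode π := by
  intro c hc
  rw [golayCode_eq_span] at hc
  have h1 : Submodule.span (ZMod 2) ({fun _ => 1} ∪ Set.range paleyWord) ≤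
      golayCode.comap (LinearMap.funLeft (ZMod 2) (ZMod 2) π) := by
    rw [Submodule.span_le]
    rintro _ (rfl | ⟨a, rfl⟩)
    · exact one_mem_golayCode
    · exact mem_golayCode_iff.2 fun b => h a b
  exact h1 hc

/-- `x ↦ -1 / x` on the projective line; note that `x ^ 21` is the inverse of `x ≠ 0`. -/
def projNegInv : Option (ZMod 23) → Option (ZMod 23)
  | none => some 0
  | some x => if x = 0 then none else some (-x ^ 21)

/-- `x ↦ x + 1` on the projective line. -/
def projShift : Option (ZMod 23) → Option (ZMod 23) :=
  Option.map (· + 1)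

/-- `x ↦ 2 x` on the projective line. -/
def projDouble : Option (ZMod 23) → Option (ZMod 23) :=
  Option.map (2 * ·)

/-- The permutation `x ↦ x³ / 9` for squares `x`, `x ↦ 9 x³` for nonsquares `x`, which together with
the fractional linear transformations generates the Mathieu group `M₂₄`; note that `18` is the
inverse of `9`. -/
def cubeTwist : Option (ZMod 23) → Option (ZMod 23) :=
  Option.map fun x => if IsSquare x then 18 * x ^ 3 else 9 * x ^ 3

theorem preservesGolayCode_projNegInv : PreservesGolayCode projNegInv :=
  .of_paleyWord (by decide +kernel)

theorem preservesGolayCode_projShift : PreservesGolayCode projShift :=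
  .of_paleyWord (by decide +kernel)

theorem preservesGolayCode_projDouble : PreservesGolayCode projDouble :=
  .of_paleyWord (by decide +kernel)

theorem preservesGolayCode_cubeTwist : PreservesGolayCode cubeTwist :=
  .of_paleyWord (by decide +kernel)

theorem PreservesGolayCode.comp_mem_leechLattice {π : Option (ZMod 23) → Option (ZMod 23)}
    (h : PreservesGolayCode π) (hπ : Function.Bijective π) {v : Option (ZMod 23) → ℚ}
    (hv : v ∈ leechLattice) : v ∘ π ∈ leechLattice := by
  obtain ⟨m, y, h1, h2, h3⟩ := hv
  refine ⟨m, y ∘ π, fun i => h1 _, h _ h2, ?_⟩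
  rwa [← (Equiv.ofBijective π hπ).sum_comp] at h3

theorem leechForm_comp {π : Option (ZMod 23) → Option (ZMod 23)} (hπ : Function.Bijective π)
    (v : Option (ZMod 23) → ℚ) : leechForm (v ∘ π) = leechForm v := by
  rw [leechForm_apply, leechForm_apply, ← (Equiv.ofBijective π hπ).sum_comp fun i => v i ^ 2]
  rfl

theorem funLeft_pow {ι : Type*} (π : ι → ι) (k : ℕ) :
    (LinearMap.funLeft ℚ ℚ π : Module.End ℚ (ι → ℚ)) ^ k = LinearMap.funLeft ℚ ℚ (π^[k]) := by
  induction k with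
  | zero => rfl
  | succ k ih =>
    rw [pow_succ, ih, Function.iterate_succ']
    rfl

theorem funLeft_eq_one_iff {ι : Type*} [DecidableEq ι] {π : ι → ι} :
    (LinearMap.funLeft ℚ ℚ π : Module.End ℚ (ι → ℚ)) = 1 ↔ ∀ i, π i = i := by
  refine ⟨fun h i => ?_, fun h => ?_⟩
  · have h1 := congrFun (LinearMap.congr_fun h (Pi.single i 1)) i
    by_contra hi
    simp [LinearMap.funLeft_apply, hi] at h1
  · ext f i
    simp [LinearMap.funLeft_apply, h]

/-- A permutation of prime power order that preserves the Golay code gives an automorphism of the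
Leech lattice of the same order. -/
theorem PreservesGolayCode.exists_orderOf_eq {π : Option (ZMod 23) → Option (ZMod 23)}
    (h : PreservesGolayCode π) (p n : ℕ) [hp : Fact p.Prime] (h1 : ∃ i, π^[p ^ n] i ≠ i)
    (h2 : ∀ i, π^[p ^ (n + 1)] i = i) :
    ∃ σ ∈ latticeAut leechForm leechLattice, orderOf σ = p ^ (n + 1) := by
  have hord : orderOf (LinearMap.funLeft ℚ ℚ π : Module.End ℚ (Option (ZMod 23) → ℚ)) =
      p ^ (n + 1) := by
    refine orderOf_eq_prime_pow (fun h => ?_) ?_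
    · rw [funLeft_pow, funLeft_eq_one_iff] at h
      obtain ⟨i, hi⟩ := h1
      exact hi (h i)
    · rw [funLeft_pow, funLeft_eq_one_iff]
      exact h2
  have hπ : Function.Bijective π := by
    have hinj : Function.Injective (π^[p ^ (n + 1) - 1 + 1]) := by
      rw [Nat.sub_add_cancel (Nat.pos_of_ne_zero (pow_ne_zero _ hp.out.ne_zero))]
      intro i j hij
      rwa [h2, h2] at hij
    rw [Function.iterate_succ] at hinj
    exact Finite.injective_iff_bijective.1 hinj.of_comp
  rw [← hord]
  exact exists_mem_latticeAut_orderOf_eq (by rw [hord]; exact pow_ne_zero _ hp.out.ne_zero)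
    (leechForm_comp hπ) fun x hx => h.comp_mem_leechLattice hπ hx

theorem exists_latticeAut_orderOf_eq_two :
    ∃ σ ∈ latticeAut leechForm leechLattice, orderOf σ = 2 :=
  preservesGolayCode_projNegInv.exists_orderOf_eq 2 0 (by decide +kernel) (by decide +kernel)

theorem exists_latticeAut_orderOf_eq_three :
    ∃ σ ∈ latticeAut leechForm leechLattice, orderOf σ = 3 :=
  (preservesGolayCode_projShift.comp preservesGolayCode_projNegInv).exists_orderOf_eq 3 0
    (by decide +kernel) (by decide +kernel)

theorem exists_latticeAut_orderOf_eq_four :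
    ∃ σ ∈ latticeAut leechForm leechLattice, orderOf σ = 4 :=
  (preservesGolayCode_projShift.comp <| preservesGolayCode_projShift.comp <|
    preservesGolayCode_projDouble.comp preservesGolayCode_projNegInv).exists_orderOf_eq 2 1 (by decide +kernel) (by decide +kernel)

theorem exists_latticeAut_orderOf_eq_five :
    ∃ σ ∈ latticeAut leechForm leechLattice, orderOf σ = 5 :=
  have : Fact (Nat.Prime 5) := ⟨by norm_num⟩
  preservesGolayCode_cubeTwist.exists_orderOf_eq 5 0
    (by decide +kernel) (by decide +kernel)

theorem exists_latticeAut_orderOf_eq_seven :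
    ∃ σ ∈ latticeAut leechForm leechLattice, orderOf σ = 7 :=
  have : Fact (Nat.Prime 7) := ⟨by norm_num⟩
  (preservesGolayCode_projShift.comp <| preservesGolayCode_projShift.comp
    preservesGolayCode_cubeTwist).exists_orderOf_eq 7 0 (by decide +kernel) (by decide +kernel)

theorem exists_latticeAut_orderOf_eq_eleven :
    ∃ σ ∈ latticeAut leechForm leechLattice, orderOf σ = 11 :=
  have : Fact (Nat.Prime 11) := ⟨by norm_num⟩
  preservesGolayCode_projDouble.exists_orderOf_eq 11 0 (by decide +kernel) (by decide +kernel)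

theorem exists_latticeAut_orderOf_eq_twentyThree :
    ∃ σ ∈ latticeAut leechForm leechLattice, orderOf σ = 23 :=
  have : Fact (Nat.Prime 23) := ⟨by norm_num⟩
  preservesGolayCode_projShift.exists_orderOf_eq 23 0 (by decide +kernel) (by decide +kernel)

/-! ### An automorphism of order `13` -/

/-- The number of the tetrad that contains a given coordinate, for the sextet of the tetrad
`{∞, 0, 1, 3}`: a partition of the coordinates into six tetrads, any two of which form a word of the
Golay code. -/
def sextetBlock (i : Option (ZMod 23)) : ℕ :=
  [0, 0, 0, 1, 0, 3, 1, 5, 2, 5, 2, 5, 3, 4, 5, 1, 4, 2, 1, 2, 3, 3, 4, 4].getD (golayIndex i) 0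

/-- Twice the matrix of the involution that subtracts from every coordinate half the sum of the
coordinates in its tetrad, and then changes the sign on one of the tetrads. -/
def sextetMatrix (i j : Option (ZMod 23)) : ℤ :=
  if sextetBlock i = sextetBlock j then
    (if sextetBlock i = 2 then -1 else 1) * (if i = j then 1 else -1) else 0

theorem sextetMatrix_symm (i j) : sextetMatrix i j = sextetMatrix j i := by
  revert i j
  decide +kernel

theorem sextetMatrix_sq (i j) :
    ∑ k, sextetMatrix i k * sextetMatrix k j = if i = j then 4 else 0 := by
  revert i j
  decide +kernel

/-- The integrality of the inner products of the generators of the Leech lattice with their images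
under the sextet involution. -/
theorem sixteen_dvd_sum_leechGenerator (k l) :
    16 ∣ ∑ i, leechGenerator l i * ∑ j, sextetMatrix i j * leechGenerator k j := by
  revert k l
  decide +kernel

/-- The involution attached to the sextet, with matrix half of `sextetMatrix`. -/
def sextetInvolution : Module.End ℚ (Option (ZMod 23) → ℚ) :=
  (Matrix.of fun i j => (sextetMatrix i j : ℚ) / 2).mulVecLin

theorem sextetInvolution_apply (v : Option (ZMod 23) → ℚ) (i : Option (ZMod 23)) :
    sextetInvolution v i = (∑ j, sextetMatrix i j * v j) / 2 := by
  simp only [sextetInvolution, Matrix.mulVecLin_apply, Matrix.mulVec, dotProduct, Matrix.of_apply,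
    Finset.sum_div]
  exact Finset.sum_congr rfl fun j _ => by ring

theorem sum_mul_sextetInvolution (v w : Option (ZMod 23) → ℚ) :
    ∑ i, v i * sextetInvolution w i = ∑ i, sextetInvolution v i * w i := by
  simp only [sextetInvolution_apply, Finset.sum_div, Finset.mul_sum, Finset.sum_mul]
  rw [Finset.sum_comm]
  refine Finset.sum_congr rfl fun i _ => Finset.sum_congr rfl fun j _ => ?_
  rw [sextetMatrix_symm i j]
  ring

theorem sextetInvolution_sextetInvolution (v : Option (ZMod 23) → ℚ) :
    sextetInvolution (sextetInvolution v) = v := by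
  funext i
  have h (k) : ∑ j, (sextetMatrix i j : ℚ) * sextetMatrix j k = if i = k then 4 else 0 := by
    exact_mod_cast sextetMatrix_sq i k
  simp only [sextetInvolution_apply, Finset.sum_div, Finset.mul_sum]
  rw [Finset.sum_comm]
  have h2 (k) : ∑ j, (sextetMatrix i j : ℚ) * (sextetMatrix j k * v k / 2) / 2 =
      if i = k then v k else 0 := by
    calc _ = (∑ j, (sextetMatrix i j : ℚ) * sextetMatrix j k) * (v k / 4) := by
          rw [Finset.sum_mul]
          exact Finset.sum_congr rfl fun j _ => by ring
      _ = _ := by rw [h k]; split_ifs <;> ring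
  simp [h2]

theorem leechForm_sextetInvolution (v : Option (ZMod 23) → ℚ) :
    leechForm (sextetInvolution v) = leechForm v := by
  rw [leechForm_apply, leechForm_apply]
  have h := sum_mul_sextetInvolution (sextetInvolution v) v
  rw [sextetInvolution_sextetInvolution] at h
  simp only [sq, h]

/-- As the Leech lattice is unimodular and the sextet involution is self-adjoint, it suffices to check
the images of the generators. -/
theorem sextetInvolution_mem_leechLattice {v : Option (ZMod 23) → ℚ} (hv : v ∈ leechLattice) :
    sextetInvolution v ∈ leechLattice := by
  -- the images of the generators have integral inner products with the generators
  have hgen (k) : sextetInvolution (fun i => (leechGenerator k i : ℚ)) ∈ leechLattice := by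
    refine mem_leechLattice_of_forall fun l => ?_
    obtain ⟨a, ha⟩ := sixteen_dvd_sum_leechGenerator k l
    refine ⟨a, ?_⟩
    have ha' : ∑ i, (leechGenerator l i : ℚ) * ∑ j, (sextetMatrix i j : ℚ) * leechGenerator k j =
        16 * a := by exact_mod_cast ha
    simp only [sextetInvolution_apply, ← mul_div_assoc, ← Finset.sum_div, ha']
    ring
  refine mem_leechLattice_iff.2 fun k => ?_
  obtain ⟨a, ha⟩ := exists_polar_leechForm_eq_int (hgen k) hv
  exact ⟨a, by rw [← ha, polar_leechForm, polar_leechForm, sum_mul_sextetInvolution]⟩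

/-- The coordinates in the order of `golayIndex`. -/
def golayCoordinates : List (Option (ZMod 23)) :=
  none :: (List.range 23).map fun i => some (i : ZMod 23)

/-- The permutation `x ↦ -1 / (2 (x + 1))` of the projective line. -/
def sextetPermutation : Option (ZMod 23) → Option (ZMod 23) :=
  projNegInv ∘ projDouble ∘ projShift

/-- The composite of the permutation and of the sextet involution, which has order `13`. -/
def sextetRotation : Module.End ℚ (Option (ZMod 23) → ℚ) :=
  sextetInvolution * LinearMap.funLeft ℚ ℚ sextetPermutation

/-- Twice the map `sextetRotation`, on lists of integral coordinates, for evaluation in the kernel. -/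
def sextetStep (L : List ℤ) : List ℤ :=
  golayCoordinates.map fun i => (golayCoordinates.map fun j =>
    sextetMatrix i j * L.getD (golayIndex (sextetPermutation j)) 0).sum

theorem getElem?_golayCoordinates (i) : golayCoordinates[golayIndex i]? = some i := by
  revert i
  decide +kernel

theorem sum_map_golayCoordinates (f : Option (ZMod 23) → ℤ) :
    (golayCoordinates.map f).sum = ∑ i, f i := by
  have h : (Finset.univ : Finset (Option (ZMod 23))).val = golayCoordinates := by decide +kernel
  rw [Finset.sum, h, Multiset.map_coe, Multiset.sum_coe]

theorem getD_map_golayCoordinates (f : Option (ZMod 23) → ℤ) (i : Option (ZMod 23)) :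
    (golayCoordinates.map f).getD (golayIndex i) 0 = f i := by
  rw [List.getD_eq_getElem?_getD, List.getElem?_map, getElem?_golayCoordinates]
  rfl

/-- The thirteenth power of `sextetRotation` fixes the standard basis vectors. -/
theorem sextetStep_iterate_thirteen (i : Option (ZMod 23)) :
    sextetStep^[13] (golayCoordinates.map fun j => if j = i then 1 else 0) =
      golayCoordinates.map fun j => if j = i then 2 ^ 13 else 0 := by
  revert i
  decide +kernel

/-- The map `sextetRotation` moves the first standard basis vector. -/
theorem sextetStep_ne :
    (sextetStep (golayCoordinates.map fun j => if j = none then 1 else 0)).getD 0 0 ≠ 2 := by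
  decide +kernel

theorem sextetRotation_apply (L : List ℤ) :
    (2 : ℚ) • sextetRotation (fun i => (L.getD (golayIndex i) 0 : ℚ)) =
      fun i => ((sextetStep L).getD (golayIndex i) 0 : ℚ) := by
  funext i
  rw [sextetStep, getD_map_golayCoordinates, sum_map_golayCoordinates, Pi.smul_apply, sextetRotation,
    Module.End.mul_apply, sextetInvolution_apply, smul_eq_mul, mul_div_cancel₀ _ two_ne_zero]
  push_cast
  rfl

theorem sextetRotation_pow_apply (L : List ℤ) (k : ℕ) :
    (2 : ℚ) ^ k • (sextetRotation ^ k) (fun i => (L.getD (golayIndex i) 0 : ℚ)) =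
      fun i => ((sextetStep^[k] L).getD (golayIndex i) 0 : ℚ) := by
  induction k with
  | zero => simp
  | succ k ih =>
    rw [pow_succ, pow_succ', Module.End.mul_apply, mul_comm, mul_smul, ← map_smul, ih,
      sextetRotation_apply, Function.iterate_succ_apply']

theorem single_eq_getD_golayCoordinates (i : Option (ZMod 23)) : (Pi.single i 1 : Option (ZMod 23) → ℚ) =
    fun j => ((golayCoordinates.map fun j => if j = i then (1 : ℤ) else 0).getD (golayIndex j) 0 : ℚ)
    := by
  funext j
  rw [getD_map_golayCoordinates, Pi.single_apply]
  push_cast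
  rfl

theorem orderOf_sextetRotation : orderOf sextetRotation = 13 := by
  have : Fact (Nat.Prime 13) := ⟨by norm_num⟩
  refine orderOf_eq_prime ?_ fun h => ?_
  · refine LinearMap.pi_ext' fun i => LinearMap.ext_ring ?_
    have h := sextetRotation_pow_apply (golayCoordinates.map fun j => if j = i then (1 : ℤ) else 0) 13
    rw [← single_eq_getD_golayCoordinates, sextetStep_iterate_thirteen] at h
    refine smul_right_injective _ (by norm_num : (2 : ℚ) ^ 13 ≠ 0) (h.trans ?_)
    funext j
    rw [getD_map_golayCoordinates]
    change _ = (2 : ℚ) ^ 13 * (Pi.single i 1 : Option (ZMod 23) → ℚ) j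
    rw [Pi.single_apply]
    split_ifs <;> norm_num
  · have h1 := congrFun (sextetRotation_apply
      (golayCoordinates.map fun j => if j = none then (1 : ℤ) else 0)) none
    rw [← single_eq_getD_golayCoordinates, h] at h1
    refine sextetStep_ne ?_
    have h2 : (2 : ℚ) = ((sextetStep (golayCoordinates.map fun j => if j = none then 1 else 0)).getD
      0 0 : ℤ) := by simpa [golayIndex] using h1
    exact_mod_cast h2.symm

theorem exists_latticeAut_orderOf_eq_thirteen :
    ∃ σ ∈ latticeAut leechForm leechLattice, orderOf σ = 13 := by
  have hπ : PreservesGolayCode sextetPermutation :=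
    preservesGolayCode_projNegInv.comp (preservesGolayCode_projDouble.comp preservesGolayCode_projShift)
  have hbij : Function.Bijective sextetPermutation :=
    Finite.injective_iff_bijective.1 (by decide +kernel)
  rw [← orderOf_sextetRotation]
  refine exists_mem_latticeAut_orderOf_eq (by rw [orderOf_sextetRotation]; norm_num)
    (fun x => (leechForm_sextetInvolution _).trans (leechForm_comp hbij x)) fun x hx =>
      sextetInvolution_mem_leechLattice (hπ.comp_mem_leechLattice hbij hx)

/-! ### Fixed lattices in the Leech lattice -/

/-- The integral bilinear form of the Leech lattice. -/
noncomputable def leechBilin : LinearMap.BilinForm ℤ leechLattice :=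
  LinearMap.mk₂ ℤ (fun x y => (QuadraticMap.polar leechForm (x : Option (ZMod 23) → ℚ) y).num)
    (fun x x' y => by
      obtain ⟨a, ha⟩ := exists_polar_leechForm_eq_int x.2 y.2
      obtain ⟨b, hb⟩ := exists_polar_leechForm_eq_int x'.2 y.2
      rw [Submodule.coe_add, QuadraticMap.polar_add_left, ha, hb]
      exact_mod_cast rfl)
    (fun c x y => by
      obtain ⟨a, ha⟩ := exists_polar_leechForm_eq_int x.2 y.2
      rw [Submodule.coe_smul, ← QuadraticMap.polarBilin_apply_apply, map_zsmul, LinearMap.smul_apply,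
        QuadraticMap.polarBilin_apply_apply, ha, zsmul_eq_mul, smul_eq_mul]
      exact_mod_cast rfl)
    (fun x y y' => by
      obtain ⟨a, ha⟩ := exists_polar_leechForm_eq_int x.2 y.2
      obtain ⟨b, hb⟩ := exists_polar_leechForm_eq_int x.2 y'.2
      rw [Submodule.coe_add, QuadraticMap.polar_add_right, ha, hb]
      exact_mod_cast rfl)
    (fun c x y => by
      obtain ⟨a, ha⟩ := exists_polar_leechForm_eq_int x.2 y.2
      rw [Submodule.coe_smul, ← QuadraticMap.polarBilin_apply_apply, map_zsmul,
        QuadraticMap.polarBilin_apply_apply, ha, zsmul_eq_mul, smul_eq_mul]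
      exact_mod_cast rfl)

theorem coe_leechBilin (x y : leechLattice) :
    (leechBilin x y : ℚ) = QuadraticMap.polar leechForm (x : Option (ZMod 23) → ℚ) y := by
  obtain ⟨a, ha⟩ := exists_polar_leechForm_eq_int x.2 y.2
  rw [leechBilin, LinearMap.mk₂_apply, ha, Rat.num_intCast]

theorem leechBilin_comm (x y : leechLattice) : leechBilin x y = leechBilin y x := by
  rw [← Int.cast_inj (α := ℚ), coe_leechBilin, coe_leechBilin, QuadraticMap.polar_comm]

theorem coe_leechBilin_self (x : leechLattice) :
    (leechBilin x x : ℚ) = 2 * leechForm (x : Option (ZMod 23) → ℚ) := by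
  rw [coe_leechBilin, QuadraticMap.polar_self]
  simp

theorem even_leechBilin_self (x : leechLattice) : Even (leechBilin x x) := by
  obtain ⟨a, ha⟩ := exists_leechForm_eq_int x.2
  refine ⟨a, ?_⟩
  have := coe_leechBilin_self x
  rw [ha] at this
  have h : leechBilin x x = 2 * a := by exact_mod_cast this
  omega

theorem four_le_leechBilin_self (x : leechLattice) (hx : x ≠ 0) : 4 ≤ leechBilin x x := by
  have h := two_le_leechForm x.2 (by simpa using hx)
  have := coe_leechBilin_self x
  have h4 : (4 : ℚ) ≤ (leechBilin x x : ℤ) := by linarith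
  exact_mod_cast h4

theorem exists_leechBilin_eq (f : leechLattice →ₗ[ℤ] ℤ) : ∃ y, ∀ x, leechBilin y x = f x := by
  obtain ⟨y, hy⟩ := exists_polar_leechForm_eq f
  refine ⟨y, fun x => ?_⟩
  rw [← Int.cast_inj (α := ℚ), coe_leechBilin, hy]

/-- The restriction of an automorphism to the Leech lattice. -/
def restrictAut {σ : (Option (ZMod 23) → ℚ) ≃ₗ[ℚ] (Option (ZMod 23) → ℚ)}
    (hσ : σ ∈ latticeAut leechForm leechLattice) : Module.End ℤ leechLattice :=
  ((σ : (Option (ZMod 23) → ℚ) →ₗ[ℚ] (Option (ZMod 23) → ℚ)).restrictScalars ℤ).restrict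
    fun x hx => (hσ.2 x).2 hx

section

variable {σ : (Option (ZMod 23) → ℚ) ≃ₗ[ℚ] (Option (ZMod 23) → ℚ)}
  (hσ : σ ∈ latticeAut leechForm leechLattice)

theorem coe_restrictAut_apply (x : leechLattice) :
    (restrictAut hσ x : Option (ZMod 23) → ℚ) = σ x :=
  rfl

theorem coe_restrictAut_pow_apply (k : ℕ) (x : leechLattice) :
    ((restrictAut hσ ^ k) x : Option (ZMod 23) → ℚ) = (σ ^ k) x := by
  induction k generalizing x with
  | zero => rfl
  | succ k ih =>
    rw [pow_succ, pow_succ, Module.End.mul_apply, LinearEquiv.mul_apply, ih, coe_restrictAut_apply]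

theorem restrictAut_pow_eq_one {k : ℕ} (h : σ ^ k = 1) : restrictAut hσ ^ k = 1 := by
  refine LinearMap.ext fun x => Subtype.ext ?_
  rw [coe_restrictAut_pow_apply, h]
  rfl

theorem restrictAut_ne_one (h : σ ≠ 1) : restrictAut hσ ≠ 1 := by
  -- the Leech lattice contains a basis of the ambient space
  intro h1
  apply h
  apply LinearEquiv.toLinearMap_injective
  refine LinearMap.pi_ext' fun i => LinearMap.ext_ring ?_
  have h2 := congrArg Subtype.val (LinearMap.congr_fun h1 ⟨_, leechGenerator_mem (.inl i)⟩)
  have h3 : (fun j => (leechGenerator (.inl i) j : ℚ)) = (8 : ℚ) • Pi.single i 1 := by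
    funext j
    by_cases hij : i = j
    · simp [leechGenerator, hij]
    · simp [leechGenerator, hij, Ne.symm hij]
  rw [coe_restrictAut_apply] at h2
  change σ (fun j => (leechGenerator (.inl i) j : ℚ)) = fun j => (leechGenerator (.inl i) j : ℚ) at h2
  rw [h3, map_smul] at h2
  exact smul_right_injective _ (by norm_num : (8 : ℚ) ≠ 0) h2

theorem leechBilin_restrictAut (x y : leechLattice) :
    leechBilin (restrictAut hσ x) (restrictAut hσ y) = leechBilin x y := by
  rw [← Int.cast_inj (α := ℚ), coe_leechBilin, coe_leechBilin, coe_restrictAut_apply,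
    coe_restrictAut_apply]
  simp only [QuadraticMap.polar, ← map_add, hσ.1]

/-- The fixed vectors of the restriction form the fixed lattice. -/
def fixedVectorsEquiv : fixedVectors (restrictAut hσ) ≃ₗ[ℤ] fixedLattice leechLattice σ where
  toFun x := ⟨x, x.1.2, congrArg Subtype.val (mem_fixedVectors.1 x.2)⟩
  invFun x := ⟨⟨x, x.2.1⟩, mem_fixedVectors.2 (Subtype.ext x.2.2)⟩
  map_add' _ _ := rfl
  map_smul' _ _ := rfl
  left_inv _ := rfl
  right_inv _ := rfl

theorem hasGramMatrix_fixedLattice {r : ℕ} {G : Matrix (Fin r) (Fin r) ℤ}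
    (h : ∃ e : Module.Basis (Fin r) ℤ (fixedVectors (restrictAut hσ)),
      leechBilin.gramMatrix (fun i => (e i : leechLattice)) = G) :
    HasGramMatrix leechForm (fixedLattice leechLattice σ) G := by
  obtain ⟨e, rfl⟩ := h
  exact ⟨e.map (fixedVectorsEquiv hσ), fun i j => (coe_leechBilin _ _).symm⟩

theorem hasGramMatrix_fixedLattice_of_order_twentyThree
    (hσ : σ ∈ latticeAut leechForm leechLattice) (h : orderOf σ = 23) :
    HasGramMatrix leechForm (fixedLattice leechLattice σ) !![4, 1; 1, 6] :=
  hasGramMatrix_fixedLattice hσ (exists_basis_fixedVectors_of_order_twentyThree leechBilin_comm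
    even_leechBilin_self four_le_leechBilin_self exists_leechBilin_eq finrank_leechLattice
    (restrictAut_pow_eq_one hσ (orderOf_dvd_iff_pow_eq_one.1 h.dvd))
    (restrictAut_ne_one hσ (by rintro rfl; simp at h)) (leechBilin_restrictAut hσ))

theorem hasGramMatrix_fixedLattice_of_order_eleven
    (hσ : σ ∈ latticeAut leechForm leechLattice) (h : orderOf σ = 11) :
    HasGramMatrix leechForm (fixedLattice leechLattice σ)
      !![4, 2, 1, 0; 2, 4, 1, 1; 1, 1, 4, 2; 0, 1, 2, 4] :=
  hasGramMatrix_fixedLattice hσ (exists_basis_fixedVectors_of_order_eleven leechBilin_comm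
    even_leechBilin_self four_le_leechBilin_self exists_leechBilin_eq finrank_leechLattice
    (restrictAut_pow_eq_one hσ (orderOf_dvd_iff_pow_eq_one.1 h.dvd))
    (restrictAut_ne_one hσ (by rintro rfl; simp at h)) (leechBilin_restrictAut hσ))

end

theorem HasGramMatrix.finrank_eq {V : Type*} [AddCommGroup V] [Module ℚ V] {q : QuadraticForm ℚ V}
    {M : Submodule ℤ V} {r : ℕ} {G : Matrix (Fin r) (Fin r) ℤ} (h : HasGramMatrix q M G) :
    Module.finrank ℤ M = r := by
  obtain ⟨e, -⟩ := h
  rw [Module.finrank_eq_card_basis e, Fintype.card_fin]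

theorem fixedLattice_le {V : Type*} [AddCommGroup V] [Module ℚ V] (M : Submodule ℤ V)
    (σ : V ≃ₗ[ℚ] V) : fixedLattice M σ ≤ M :=
  fun _ h => h.1

theorem siegelThetaConverges_of_le_leechLattice {M : Submodule ℤ (Option (ZMod 23) → ℚ)}
    (hM : M ≤ leechLattice) (n : ℕ) : SiegelThetaConverges leechForm M n :=
  siegelThetaConverges_weightedSumSquares (by norm_num)
    fun _ hx => exists_int_of_mem_leechLattice (hM hx)

/-! ### The congruences -/

section

variable {σ : (Option (ZMod 23) → ℚ) ≃ₗ[ℚ] (Option (ZMod 23) → ℚ)} {p n : ℕ}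

theorem representationNumber_leechLattice_modEq [Fact p.Prime]
    (hσ : σ ∈ latticeAut leechForm leechLattice) (h : orderOf σ = p)
    (T : Matrix (Fin n) (Fin n) ℚ) :
    representationNumber leechForm leechLattice T ≡
      representationNumber leechForm (fixedLattice leechLattice σ) T [MOD p] :=
  representationNumber_modEq_fixedLattice hσ (by rw [← h, pow_orderOf_eq_one])
    ((siegelThetaConverges_of_le_leechLattice le_rfl n).finite T)

/-- If the fixed lattice of an automorphism of order `p` has rank `n` and determinant divisible by
`p`, then `Θ` annihilates the degree `n` theta series modulo `p`: the representation number of `T`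
by the Leech lattice is divisible by `p` unless the fixed lattice represents `T`, and then
`det (2 T)` is divisible by the determinant of the fixed lattice. -/
theorem thetaOperator_siegelTheta_congruentMod_zero [hp : Fact p.Prime] (hp2 : p ≠ 2)
    (hσ : σ ∈ latticeAut leechForm leechLattice) (h : orderOf σ = p)
    {G : Matrix (Fin n) (Fin n) ℤ} (hG : HasGramMatrix leechForm (fixedLattice leechLattice σ) G)
    (hdvd : (p : ℤ) ∣ G.det) :
    CongruentMod p (thetaOperator (siegelTheta leechForm leechLattice n)) 0 := by
  refine (siegelThetaConverges_of_le_leechLattice le_rfl n).thetaOperator_congruentMod_zero hp.out hp2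
    (fun x hx => exists_leechForm_eq_int hx)
    (summable_det_mul_fourierExp_halfGram (by norm_num) fun x hx => exists_int_of_mem_leechLattice hx)
    fun T D hD => ?_
  by_cases h0 : representationNumber leechForm (fixedLattice leechLattice σ) T = 0
  · have h1 := representationNumber_leechLattice_modEq hσ h T
    rw [h0] at h1
    exact (Int.natCast_dvd_natCast.2 ((Nat.modEq_zero_iff_dvd).1 h1)).mul_left D
  · exact (hdvd.trans (hG.det_dvd h0 hD)).mul_right _

/-- Half the Gram matrix of the fixed lattice of an automorphism of order `p` has a representation
number prime to `p`, as it is congruent to the order of the automorphism group of the fixed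
lattice. -/
theorem hasNondegenerateCoefficient_siegelTheta [hp : Fact p.Prime]
    (hσ : σ ∈ latticeAut leechForm leechLattice) (h : orderOf σ = p)
    {G : Matrix (Fin n) (Fin n) ℤ} (hG : HasGramMatrix leechForm (fixedLattice leechLattice σ) G)
    (hn : n < p - 1) (hdet : G.det ≠ 0) :
    HasNondegenerateCoefficientNotDivisibleBy p (siegelTheta leechForm leechLattice n) := by
  have hc := siegelThetaConverges_of_le_leechLattice (fixedLattice_le leechLattice σ) n
  have hcΛ := siegelThetaConverges_of_le_leechLattice (le_refl leechLattice) n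
  have h1 := hG.not_dvd_representationNumber hn hdet (hc.finite _)
  set T := (2⁻¹ : ℚ) • G.map fun a : ℤ => (a : ℚ) with hT
  have hmem : T ∈ halfIntegralMatrices n := by
    have hne : representationNumber leechForm (fixedLattice leechLattice σ) T ≠ 0 := by
      intro h0
      rw [h0] at h1
      exact h1 (dvd_zero p)
    obtain ⟨x, hx⟩ := Set.nonempty_of_ncard_ne_zero hne
    have hx : _ = T := hx
    rw [← hx]
    exact halfGram_mem_halfIntegralMatrices
      (fun y hy => exists_leechForm_eq_int (fixedLattice_le _ _ hy)) x
  refine ⟨⟨T, hmem⟩, ?_, ?_⟩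
  · have hG' : (G.map fun a : ℤ => (a : ℚ)).det = (G.det : ℚ) :=
      ((Int.castRingHom ℚ).map_det G).symm
    change T.det ≠ 0
    rw [hT, Matrix.det_smul, hG']
    exact mul_ne_zero (by positivity) (Int.cast_ne_zero.2 hdet)
  · rw [hcΛ.fourierCoefficient_eq fun x hx => exists_leechForm_eq_int hx,
      natCast_mem_maximalIdealAt_iff hp.out, (representationNumber_leechLattice_modEq hσ h T).dvd_iff
        dvd_rfl]
    exact h1

/-- In degrees larger than the rank of the fixed lattice, the nondegenerate coefficients are
divisible by `p`. -/
theorem not_hasNondegenerateCoefficient_siegelTheta [hp : Fact p.Prime]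
    (hσ : σ ∈ latticeAut leechForm leechLattice) (h : orderOf σ = p) {r : ℕ}
    {G : Matrix (Fin r) (Fin r) ℤ} (hG : HasGramMatrix leechForm (fixedLattice leechLattice σ) G)
    (hn : r < n) :
    ¬ HasNondegenerateCoefficientNotDivisibleBy p (siegelTheta leechForm leechLattice n) := by
  rintro ⟨T, hT, h1⟩
  rw [(siegelThetaConverges_of_le_leechLattice le_rfl n).fourierCoefficient_eq
    fun x hx => exists_leechForm_eq_int hx, natCast_mem_maximalIdealAt_iff hp.out,
    (representationNumber_leechLattice_modEq hσ h T.1).dvd_iff dvd_rfl] at h1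
  refine hT (hG.det_eq_zero hn fun h0 => h1 ?_)
  rw [h0]
  exact dvd_zero p

end

theorem det_quaternary :
    (!![4, 2, 1, 0; 2, 4, 1, 1; 1, 1, 4, 2; 0, 1, 2, 4] : Matrix (Fin 4) (Fin 4) ℤ).det = 121 := by
  decide +kernel

theorem det_binary : (!![4, 1; 1, 6] : Matrix (Fin 2) (Fin 2) ℤ).det = 23 := by
  decide +kernel

theorem mainTheorem3 :
    -- the Leech lattice has automorphisms of the following orders
    (∀ k ∈ ({2, 3, 4, 5, 7, 11, 13, 23} : Finset ℕ),
      ∃ σ ∈ latticeAut leechForm leechLattice, orderOf σ = k) ∧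
    -- its theta series converge, and their Fourier coefficients are the representation numbers
    (∀ n : ℕ, SiegelThetaConverges leechForm leechLattice n ∧
      HasFourierExpansion (siegelTheta leechForm leechLattice n)
        (fun T => (representationNumber leechForm leechLattice T.1 : ℂ))) ∧
    -- the prime 23
    (∀ σ ∈ latticeAut leechForm leechLattice, orderOf σ = 23 →
      Module.finrank ℤ (fixedLattice leechLattice σ) = 2 ∧
      HasGramMatrix leechForm (fixedLattice leechLattice σ) !![4, 1; 1, 6]) ∧
    CongruentMod 23 (thetaOperator (siegelTheta leechForm leechLattice 2)) 0 ∧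
    HasNondegenerateCoefficientNotDivisibleBy 23 (siegelTheta leechForm leechLattice 2) ∧
    -- the prime 11
    (∀ σ ∈ latticeAut leechForm leechLattice, orderOf σ = 11 →
      Module.finrank ℤ (fixedLattice leechLattice σ) = 4 ∧
      HasGramMatrix leechForm (fixedLattice leechLattice σ)
        !![4, 2, 1, 0; 2, 4, 1, 1; 1, 1, 4, 2; 0, 1, 2, 4] ∧
      SiegelThetaConverges leechForm (fixedLattice leechLattice σ) 4 ∧
      HasFourierExpansion (siegelTheta leechForm (fixedLattice leechLattice σ) 4)
        (fun T => (representationNumber leechForm (fixedLattice leechLattice σ) T.1 : ℂ)) ∧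
      CongruentMod 11 (siegelTheta leechForm leechLattice 4)
        (siegelTheta leechForm (fixedLattice leechLattice σ) 4)) ∧
    (!![4, 2, 1, 0; 2, 4, 1, 1; 1, 1, 4, 2; 0, 1, 2, 4] : Matrix (Fin 4) (Fin 4) ℤ).det = 121 ∧
    CongruentMod 11 (thetaOperator (siegelTheta leechForm leechLattice 4)) 0 ∧
    IsGreatest {n : ℕ | HasNondegenerateCoefficientNotDivisibleBy 11
      (siegelTheta leechForm leechLattice n)} 4 := by
  have : Fact (Nat.Prime 11) := ⟨by norm_num⟩
  have : Fact (Nat.Prime 23) := ⟨by norm_num⟩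
  have hconv (n : ℕ) := siegelThetaConverges_of_le_leechLattice (le_refl leechLattice) n
  have heven (x : Option (ZMod 23) → ℚ) (hx : x ∈ leechLattice) : ∃ a : ℤ, leechForm x = a :=
    exists_leechForm_eq_int hx
  obtain ⟨τ, hτ, hτ23⟩ := exists_latticeAut_orderOf_eq_twentyThree
  have hGτ := hasGramMatrix_fixedLattice_of_order_twentyThree hτ hτ23
  obtain ⟨ρ, hρ, hρ11⟩ := exists_latticeAut_orderOf_eq_eleven
  have hGρ := hasGramMatrix_fixedLattice_of_order_eleven hρ hρ11
  refine ⟨fun k hk => ?_, fun n => ⟨hconv n, (hconv n).hasFourierExpansion heven⟩,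
    fun σ hσ h => ?_, ?_, ?_, fun σ hσ h => ?_, det_quaternary, ?_, ?_, fun n hn => ?_⟩
  · simp only [Finset.mem_insert, Finset.mem_singleton] at hk
    rcases hk with rfl | rfl | rfl | rfl | rfl | rfl | rfl | rfl
    · exact exists_latticeAut_orderOf_eq_two
    · exact exists_latticeAut_orderOf_eq_three
    · exact exists_latticeAut_orderOf_eq_four
    · exact exists_latticeAut_orderOf_eq_five
    · exact exists_latticeAut_orderOf_eq_seven
    · exact exists_latticeAut_orderOf_eq_eleven
    · exact exists_latticeAut_orderOf_eq_thirteen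
    · exact exists_latticeAut_orderOf_eq_twentyThree
  · have hG := hasGramMatrix_fixedLattice_of_order_twentyThree hσ h
    exact ⟨hG.finrank_eq, hG⟩
  · exact thetaOperator_siegelTheta_congruentMod_zero (by norm_num) hτ hτ23 hGτ
      (by rw [det_binary]; norm_num)
  · exact hasNondegenerateCoefficient_siegelTheta hτ hτ23 hGτ (by norm_num)
      (by rw [det_binary]; norm_num)
  · have hG := hasGramMatrix_fixedLattice_of_order_eleven hσ h
    have hc := siegelThetaConverges_of_le_leechLattice (fixedLattice_le leechLattice σ) 4
    have he (x) (hx : x ∈ fixedLattice leechLattice σ) := heven x (fixedLattice_le _ _ hx)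
    exact ⟨hG.finrank_eq, hG, hc, hc.hasFourierExpansion he, (hconv 4).congruentMod (by norm_num)
      heven hc he (representationNumber_leechLattice_modEq hσ h)⟩
  · exact thetaOperator_siegelTheta_congruentMod_zero (by norm_num) hρ hρ11 hGρ
      (by rw [det_quaternary]; norm_num)
  · exact hasNondegenerateCoefficient_siegelTheta hρ hρ11 hGρ (by norm_num)
      (by rw [det_quaternary]; norm_num)
  · exact not_lt.1 fun hlt => not_hasNondegenerateCoefficient_siegelTheta hρ hρ11 hGρ hlt hn
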